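/- All digraphs are finite, and paths are simple and directed; the length of a path is its number of arcs. For a vertex $x$ of a tournament $T$ let $d^+(x)$ and $d^-(x)$ be its outdegree and indegree (its semidegrees). $T$ is $m$-irregular if $\max_{x}|d^+(x)-d^-(x)|=m$, and regular if this maximum is $0$. A digraph of order $p$ is $d$-strongly panconnected if for all distinct vertices $x,y$ and every integer $k$ with $d\le k\le p-1$ it contains both an $(x,y)$-path and a $(y,x)$-path of length $k$; it is strongly panconnected if it is $3$-strongly panconnected. Write $X\to Y$ if every vertex of $X$ dominates every vertex of $Y$. Let $\mathcal G$ be the family of regular tournaments $G$ of order $6k+3\ge 9$ whose vertex set is a disjoint union $\{x,y,z\}\cup A\cup B\cup C\cup S$ (with $x,y,z$ distinct), where $|A|=|C|=2k-1$, $|B|=k+2$, $|S|=k$, the subtournaments induced by $A$, by $C$ and by $\{z\}\cup B\cup S$ are regular, and $A\to B\cup S\to C$, $C\to A$, $C\to z\to A$, $x\to\{y,z\}\cup A\cup S$, $\{x,z\}\cup C\cup S\to y$, $y\to A\cup B$, $B\cup C\to x$. Theorem 1.5. Let $T$ be an $m$-irregular tournament of order $p$ with $p+m\ge 11$. (a)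 If $m\le\frac13(p-5)$, then $T$ is $4$-strongly panconnected. (b) If $m\le\frac15(p-3)$, then $T$ is strongly panconnected, or $T$ is isomorphic to $G-S$ for some $G\in\mathcal G$, where $S$ is the set in the description of $G$. Moreover, for such $T$ the condition $m\le\frac13(p-5)$ (respectively, $m\le\frac15(p-3)$) holds if and only if all semidegrees of $T$ are between $\frac13(p+1)$ and $\frac23(p-2)$ (respectively, between $\frac15(2p-1)$ and $\frac15(3p-4)$); so the conclusion of (a) (respectively, (b)) also holds under these semidegree bounds. -/

import Mathlib

namespace Digraph

variable {V : Type*}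

/-- A tournament: no loops, and for every two distinct vertices exactly one of the two possible
arcs is present. -/
def IsTournament (T : Digraph V) : Prop :=
  (∀ x, ¬ T.Adj x x) ∧ ∀ x y, x ≠ y → (T.Adj x y ↔ ¬ T.Adj y x)

/-- The outdegree of `x`. -/
noncomputable def outdegree (D : Digraph V) (x : V) : ℕ := {y | D.Adj x y}.ncard

/-- The indegree of `x`. -/
noncomputable def indegree (D : Digraph V) (x : V) : ℕ := {y | D.Adj y x}.ncard

/-- The irregularity: the maximum of `|d⁺(x) - d⁻(x)|` over all vertices `x`. -/
noncomputable def irregularity [Fintype V] (D : Digraph V) : ℕ :=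
  Finset.univ.sup fun x => ((D.outdegree x : ℤ) - (D.indegree x : ℤ)).natAbs

/-- `T` is an `m`-irregular tournament. -/
def IsIrregularTournament [Fintype V] (T : Digraph V) (m : ℕ) : Prop :=
  T.IsTournament ∧ T.irregularity = m

/-- `T` is a regular tournament. -/
def IsRegularTournament [Fintype V] (T : Digraph V) : Prop :=
  T.IsIrregularTournament 0

/-- All semidegrees (indegrees and outdegrees) of `D` lie between `a` and `b`. -/
def SemidegreesBetween (D : Digraph V) (a b : ℝ) : Prop :=
  ∀ x, (a ≤ (D.outdegree x : ℝ) ∧ (D.outdegree x : ℝ) ≤ b) ∧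
    (a ≤ (D.indegree x : ℝ) ∧ (D.indegree x : ℝ) ≤ b)

/-- `D` has a simple directed path from `x` to `y` with exactly `k` arcs; it is given by the list
of its `k + 1` distinct vertices. -/
def HasPath (D : Digraph V) (x y : V) (k : ℕ) : Prop :=
  ∃ l : List V, l.Nodup ∧ l.IsChain D.Adj ∧ l.head? = some x ∧ l.getLast? = some y ∧
    l.length = k + 1

/-- `D` is `d`-strongly panconnected: for any two distinct vertices `x`, `y` and each `k` with
`d ≤ k ≤ p - 1`, where `p` is the order of `D`, there are an `(x,y)`-path and a `(y,x)`-path of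
length `k`. -/
def StronglyPanconnectedFrom [Fintype V] (d : ℕ) (D : Digraph V) : Prop :=
  ∀ x y, x ≠ y → ∀ k, d ≤ k → k ≤ Fintype.card V - 1 → D.HasPath x y k ∧ D.HasPath y x k

/-- `D` is strongly panconnected: paths of all lengths `3, …, p - 1` in both directions. -/
def StronglyPanconnected [Fintype V] (D : Digraph V) : Prop :=
  D.StronglyPanconnectedFrom 3

/-- The subdigraph induced by a set `X` of vertices. -/
def induce (D : Digraph V) (X : Finset V) : Digraph {v // v ∈ X} where
  Adj u v := D.Adj u v

/-- `X → Y`: every vertex of `X` dominates every vertex of `Y`. -/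
def Dominates (D : Digraph V) (X Y : Finset V) : Prop :=
  ∀ u ∈ X, ∀ v ∈ Y, D.Adj u v

/-- `G` is a tournament of the exceptional family `𝒢`, with parameter `k` and with vertex set
`{x, y, z} ∪ A ∪ B ∪ C ∪ S`. The order is `6k + 3`, which is the sum of `3` and the prescribed
sizes of `A`, `B`, `C`, `S`; so `x`, `y`, `z` are distinct and `{x, y, z}`, `A`, `B`, `C`, `S` are
pairwise disjoint. -/
structure IsExceptional [Fintype V] [DecidableEq V] (G : Digraph V) (k : ℕ) (x y z : V)
    (A B C S : Finset V) : Prop where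
  regular : G.IsRegularTournament
  one_le : 1 ≤ k
  order : Fintype.card V = 6 * k + 3
  vertexSet : {x, y, z} ∪ A ∪ B ∪ C ∪ S = Finset.univ
  card_A : A.card = 2 * k - 1
  card_C : C.card = 2 * k - 1
  card_B : B.card = k + 2
  card_S : S.card = k
  regular_A : (G.induce A).IsRegularTournament
  regular_C : (G.induce C).IsRegularTournament
  regular_zBS : (G.induce ({z} ∪ B ∪ S)).IsRegularTournament
  A_to_BS : G.Dominates A (B ∪ S)
  BS_to_C : G.Dominates (B ∪ S) C
  C_to_A : G.Dominates C A
  C_to_z : G.Dominates C {z}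
  z_to_A : G.Dominates {z} A
  x_to : G.Dominates {x} ({y, z} ∪ A ∪ S)
  to_y : G.Dominates ({x, z} ∪ C ∪ S) {y}
  y_to : G.Dominates {y} (A ∪ B)
  to_x : G.Dominates (B ∪ C) {x}

/-- `T` is, up to isomorphism, of the form `G - S` where `G` is a tournament of the exceptional
family `𝒢` and `S` is the set `S` in its description. The vertices of `G` are labelled by
`0, …, 6k + 2`. -/
def ComesFromExceptional (T : Digraph V) : Prop :=
  ∃ (k : ℕ) (G : Digraph (Fin (6 * k + 3))) (x y z : Fin (6 * k + 3))
    (A B C S : Finset (Fin (6 * k + 3))),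
    G.IsExceptional k x y z A B C S ∧ Nonempty (T.Adj ≃r (G.induce Sᶜ).Adj)

end Digraph

namespace TournamentPaths

/-! Since d⁺ + d⁻ = p - 1 at every vertex, the bounds on m are bounds on semidegrees. In (a) all
semidegrees are at least some δ with p + 1 ≤ 3δ, and p + m ≥ 11 forces δ ≥ 4; this is `Dense`.

Lengths at least 4. Two internally disjoint paths from x to y can always be merged into one path on
the same vertices (`Conn.merge`). Take two such paths with few inner vertices in all, let S be the
set of these and W the set of remaining vertices (`Frame`). To lengthen the merged path by exactly g
vertices, it suffices to find a path with g inner vertices, all in W, joining a suitable pair of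
vertices of the frame. If there is none (`Stuck`), domination is carried along the g-vertex paths of
W: when v dominates the first vertex, v' dominates the last. For g = 1, and for strong W, this ends
with all of S dominating all of W, with the reverse, or with a degree contradiction; for other W one
counts degrees at its initial and terminal strong components. The result is `Frame.hasConn_add`.
Uniform domination is excluded by counting arcs (`Frame.not_forall_dominate`), which works when S
has at most five vertices, or six with some extra arcs. The starting pair of paths is found by
sorting the vertices v by whether x → v and whether v → y, and counting paths of length two between
the classes (`card_through`).

Length 3. Without a path of length 3 from x to y, no out-neighbour of x dominates an in-neighbour of
y. Under the bound of (b) the resulting degree inequalities are all tight, which determines the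
tournament up to the arcs inside {z} ∪ B (`exists_config`). Conversely, k vertices can be added to
such a tournament so that it becomes a member of the exceptional family: the missing outdegrees of
{z} ∪ B are dealt out cyclically to a nearly regular tournament on the new vertices
(`Config.exists_relation`, `Config.comesFromExceptional`). -/

/-- The arc relation of a tournament. -/
structure IsTour {V : Type*} (r : V → V → Prop) : Prop where
  irrefl : ∀ x, ¬ r x x
  asymm : ∀ {x y}, r x y → ¬ r y x
  total : ∀ {x y}, x ≠ y → r x y ∨ r y x

/-! ### Paths as vertex sets, merging of parallel paths, and paths in strong tournaments -/

section Paths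

variable {V : Type*} {r : V → V → Prop}

theorem IsTour.ne (hT : IsTour r) {a b : V} (h : r a b) : a ≠ b := by
  rintro rfl
  exact hT.irrefl _ h

theorem IsTour.of_not (hT : IsTour r) {a b : V} (hab : a ≠ b) (h : ¬ r a b) : r b a :=
  (hT.total hab).resolve_left h

theorem IsTour.flip (hT : IsTour r) : IsTour (flip r) :=
  ⟨hT.irrefl, fun h h' => hT.asymm h h', fun h => hT.total h.symm⟩

variable [DecidableEq V]

/-- `Conn r a b S`: there is a path from `a` to `b` whose set of inner vertices is `S`. -/
inductive Conn (r : V → V → Prop) : V → V → Finset V → Prop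
  | arc {a b : V} : r a b → Conn r a b ∅
  | cons {a c b : V} {S : Finset V} : r a c → c ∉ S → Conn r c b S → Conn r a b (insert c S)

/-- `Seg r a b G`: there is a path from `a` to `b` with vertex set `G`. -/
inductive Seg (r : V → V → Prop) : V → V → Finset V → Prop
  | single (a : V) : Seg r a a {a}
  | cons {a c b : V} {G : Finset V} : r a c → a ∉ G → Seg r c b G → Seg r a b (insert a G)

theorem Conn.append {a v b : V} {S S' : Finset V} (h : Conn r a v S) (h' : Conn r v b S')
    (hv : v ∉ S) (hv' : v ∉ S') (hd : Disjoint S S') : Conn r a b (insert v (S ∪ S')) := by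
  induction h with
  | arc h => simpa using Conn.cons h hv' h'
  | @cons a c v S hac hc _ ih =>
    simp only [Finset.mem_insert, not_or] at hv
    rw [Finset.disjoint_insert_left] at hd
    have := Conn.cons hac (S := insert v (S ∪ S')) (by
      simp only [Finset.mem_insert, Finset.mem_union, not_or]
      exact ⟨fun h => hv.1 h.symm, hc, hd.1⟩) (ih h' hv.2 hv' hd.2)
    convert this using 1
    ext w
    simp only [Finset.mem_insert, Finset.mem_union]
    tauto

theorem Conn.split_first {a b : V} {S : Finset V} (h : Conn r a b S) (P : V → Prop)
    (hP : ∃ v ∈ S, P v) : ∃ v S₁ S₂, P v ∧ (∀ w ∈ S₁, ¬ P w) ∧ Conn r a v S₁ ∧ Conn r v b S₂ ∧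
      v ∉ S₁ ∧ v ∉ S₂ ∧ Disjoint S₁ S₂ ∧ S = insert v (S₁ ∪ S₂) := by
  induction h with
  | arc h => simp at hP
  | @cons a c b S hac hc hS ih =>
    by_cases hPc : P c
    · exact ⟨c, ∅, S, hPc, by simp, Conn.arc hac, hS, by simp, hc, by simp, by simp⟩
    · obtain ⟨v, hv, hPv⟩ := hP
      have hvS : v ∈ S := by
        rcases Finset.mem_insert.1 hv with rfl | h
        · exact absurd hPv hPc
        · exact h
      obtain ⟨v, S₁, S₂, h1, h2, h3, h4, h5, h6, h7, rfl⟩ := ih ⟨v, hvS, hPv⟩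
      simp only [Finset.mem_insert, Finset.mem_union, not_or] at hc
      refine ⟨v, insert c S₁, S₂, h1, ?_, Conn.cons hac hc.2.1 h3, h4, ?_, h6, ?_, ?_⟩
      · intro w hw
        rcases Finset.mem_insert.1 hw with rfl | h
        · exact hPc
        · exact h2 w h
      · simp only [Finset.mem_insert, not_or]
        exact ⟨fun h => hc.1 h.symm, h5⟩
      · rw [Finset.disjoint_insert_left]
        exact ⟨hc.2.2, h7⟩
      · ext w
        simp only [Finset.mem_insert, Finset.mem_union]
        tauto

theorem Conn.split {a b v : V} {S : Finset V} (h : Conn r a b S) (hv : v ∈ S) :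
    ∃ S₁ S₂, Conn r a v S₁ ∧ Conn r v b S₂ ∧ v ∉ S₁ ∧ v ∉ S₂ ∧ Disjoint S₁ S₂ ∧
      S = insert v (S₁ ∪ S₂) := by
  obtain ⟨w, S₁, S₂, rfl, -, h⟩ := h.split_first (· = v) ⟨v, hv, rfl⟩
  exact ⟨S₁, S₂, h⟩

/-- Two internally disjoint paths of a tournament with the same ends can be merged. -/
theorem Conn.merge (hT : IsTour r) {a b : V} {S S' : Finset V} (h : Conn r a b S)
    (h' : Conn r a b S') (hd : Disjoint S S') : Conn r a b (S ∪ S') := by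
  induction hn : S.card + S'.card using Nat.strong_induction_on generalizing a S S' with
  | _ n ih =>
    cases h with
    | arc h => simpa using h'
    | @cons _ c _ S hac hc hS =>
      cases h' with
      | arc h' => simpa using Conn.cons hac hc hS
      | @cons _ c' _ S' hac' hc' hS' =>
        have hne : c ≠ c' := by
          rintro rfl
          exact Finset.disjoint_left.1 hd (Finset.mem_insert_self _ _) (Finset.mem_insert_self _ _)
        have hd0 := hd
        rw [Finset.disjoint_insert_left, Finset.disjoint_insert_right] at hd
        rw [Finset.disjoint_insert_right, Finset.disjoint_insert_left] at hd0
        rw [Finset.card_insert_of_notMem hc, Finset.card_insert_of_notMem hc'] at hn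
        -- The arc between the two first inner vertices decides which comes first. If it is c → c',
        -- the second path rerouted through c is parallel to the rest of the first one, starting
        -- from c.
        rcases hT.total hne with h1 | h1
        · have h2 := ih (S.card + (insert c' S').card)
            (by rw [Finset.card_insert_of_notMem hc']; omega) hS (Conn.cons h1 hc' hS')
            (by rw [Finset.disjoint_insert_right]; exact hd.2) rfl
          have h3 := Conn.cons hac (by simp only [Finset.mem_union, not_or]; exact ⟨hc, hd.1⟩) h2
          rwa [← Finset.insert_union] at h3
        · have h2 := ih ((insert c S).card + S'.card)
            (by rw [Finset.card_insert_of_notMem hc]; omega) (Conn.cons h1 hc hS) hS'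
            (by rw [Finset.disjoint_insert_left]; exact hd0.2) rfl
          have h3 := Conn.cons hac' (by simp only [Finset.mem_union, not_or]; exact ⟨hd0.1, hc'⟩) h2
          rwa [← Finset.union_insert] at h3

theorem Conn.flip {a b : V} {S : Finset V} (h : Conn r a b S) : Conn (flip r) b a S := by
  induction h with
  | arc h => exact Conn.arc h
  | @cons a c b S hac hc _ ih =>
    simpa using ih.append (Conn.arc (r := _root_.flip r) hac) hc (by simp) (by simp)

theorem Seg.left_mem {a b : V} {G : Finset V} (h : Seg r a b G) : a ∈ G := by
  cases h <;> simp

theorem Seg.right_mem {a b : V} {G : Finset V} (h : Seg r a b G) : b ∈ G := by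
  induction h with
  | single => simp
  | cons _ _ _ ih => exact Finset.mem_insert_of_mem ih

theorem Seg.append {a b c d : V} {G G' : Finset V} (h : Seg r a b G) (hbc : r b c)
    (h' : Seg r c d G') (hd : Disjoint G G') : Seg r a d (G ∪ G') := by
  induction h with
  | single a =>
    rw [← Finset.insert_eq]
    exact Seg.cons hbc (by simpa using hd) h'
  | @cons a e b G hae ha _ ih =>
    rw [Finset.disjoint_insert_left] at hd
    rw [Finset.insert_union]
    exact Seg.cons hae (by simp only [Finset.mem_union, not_or]; exact ⟨ha, hd.1⟩) (ih hbc hd.2)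

theorem Seg.conn {a b v w : V} {G : Finset V} (h : Seg r a b G) (hv : r v a) (hw : r b w) :
    Conn r v w G := by
  induction h generalizing v with
  | single a => simpa using Conn.cons hv (by simp) (Conn.arc hw)
  | @cons a e b G hae ha _ ih => exact Conn.cons hv ha (ih hae hw)

theorem Seg.flip {a b : V} {G : Finset V} (h : Seg r a b G) : Seg (flip r) b a G := by
  induction h with
  | single a => exact Seg.single a
  | @cons a e b G hae ha _ ih =>
    have := ih.append (r := _root_.flip r) hae (Seg.single a) (by simpa using ha)
    rwa [Finset.union_comm, ← Finset.insert_eq] at this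

/-- The first vertex of a path with at least two vertices can be removed. -/
theorem Seg.tail {a b : V} {G : Finset V} (h : Seg r a b G) (hG : 2 ≤ G.card) :
    ∃ c, r a c ∧ Seg r c b (G.erase a) := by
  cases h with
  | single => simp at hG
  | @cons _ c _ G hac ha h => exact ⟨c, hac, by rwa [Finset.erase_insert ha]⟩

/-- A vertex dominated by some vertex of a path can be added without changing the first vertex. -/
theorem Seg.insert_of_left (hT : IsTour r) {a b u : V} {G : Finset V} (h : Seg r a b G)
    (hu : u ∉ G) (hv : ∃ v ∈ G, r v u) : ∃ b', Seg r a b' (insert u G) := by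
  induction h with
  | single a =>
    obtain ⟨v, hv, hvu⟩ := hv
    rw [Finset.mem_singleton] at hv
    subst hv
    refine ⟨u, ?_⟩
    rw [Finset.pair_comm]
    exact Seg.cons hvu (by simpa using fun h => hu (by simp [h])) (Seg.single u)
  | @cons a e b G hae ha h ih =>
    simp only [Finset.mem_insert, not_or] at hu
    have hau : a ∉ insert u G := by
      simp only [Finset.mem_insert, not_or]
      exact ⟨fun h => hu.1 h.symm, ha⟩
    by_cases hG : ∃ v ∈ G, r v u
    · obtain ⟨b', hb'⟩ := ih hu.2 hG
      exact ⟨b', by rw [Finset.insert_comm]; exact Seg.cons hae hau hb'⟩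
    -- Here `u` dominates all of `G`, so the only vertex that can dominate it is `a`, and `u` fits
    -- right behind `a`.
    · push Not at hG
      obtain ⟨v, hv, hvu⟩ := hv
      rcases Finset.mem_insert.1 hv with rfl | hv
      · have hue : r u e := hT.of_not (fun h' => hu.2 (h' ▸ h.left_mem)) (hG e h.left_mem)
        exact ⟨b, by rw [Finset.insert_comm]; exact Seg.cons hvu hau (Seg.cons hue hu.2 h)⟩
      · exact absurd hvu (hG v hv)

theorem exists_seg (hT : IsTour r) {G : Finset V} (hG : G.Nonempty) : ∃ a b, Seg r a b G := by
  induction hG using Finset.Nonempty.cons_induction with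
  | singleton a => exact ⟨a, a, Seg.single a⟩
  | cons u G hu hG ih =>
    obtain ⟨a, b, h⟩ := ih
    rw [Finset.cons_eq_insert]
    by_cases hv : r a u
    · obtain ⟨b', hb'⟩ := h.insert_of_left hT hu ⟨a, h.left_mem, hv⟩
      exact ⟨a, b', hb'⟩
    · exact ⟨u, b, Seg.cons (hT.of_not (fun h' => hu (h' ▸ h.left_mem)) hv) hu h⟩

/-- `W` is not the union of two disjoint nonempty sets the first of which dominates the second. -/
def Strong (r : V → V → Prop) (W : Finset V) : Prop :=
  ∀ X ⊆ W, X.Nonempty → (∀ a ∈ X, ∀ b ∈ W, b ∉ X → r a b) → X = W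

theorem Strong.flip {W : Finset V} (hW : Strong r W) :
    Strong (flip r) W := by
  intro X hX hXne h
  by_contra hne
  have hne' : (W \ X).Nonempty := by
    rw [Finset.sdiff_nonempty]
    exact fun h' => hne (Finset.Subset.antisymm hX h')
  have := hW (W \ X) Finset.sdiff_subset hne' (by
    intro a ha b hb hbX
    simp only [Finset.mem_sdiff, not_and, not_not] at ha hbX
    exact h b (hbX hb) a ha.1 ha.2)
  obtain ⟨a, ha⟩ := hXne
  have h2 : a ∈ W \ X := by rw [this]; exact hX ha
  exact (Finset.mem_sdiff.1 h2).2 ha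

/-- The path grows one vertex at a time. It can stop growing only if no vertex of it dominates an
outside vertex; then the outside dominates the path, against strength. -/
theorem Strong.exists_seg_left (hT : IsTour r) {W : Finset V} (hW : Strong r W) {w : V}
    (hw : w ∈ W) {g : ℕ} (hg : 1 ≤ g) (hgW : g ≤ W.card) :
    ∃ b G, Seg r w b G ∧ G ⊆ W ∧ G.card = g := by
  induction g, hg using Nat.le_induction with
  | base => exact ⟨w, {w}, Seg.single w, by simpa using hw, by simp⟩
  | succ g hg ih =>
    obtain ⟨b, G, h, hGW, hcard⟩ := ih (by omega)
    have hne : (W \ G).Nonempty := by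
      rw [← Finset.card_pos, Finset.card_sdiff_of_subset hGW]
      omega
    by_cases hex : ∃ u ∈ W \ G, ∃ v ∈ G, r v u
    · obtain ⟨u, hu, hv⟩ := hex
      rw [Finset.mem_sdiff] at hu
      obtain ⟨b', hb'⟩ := h.insert_of_left hT hu.2 hv
      exact ⟨b', _, hb', Finset.insert_subset hu.1 hGW, by
        rw [Finset.card_insert_of_notMem hu.2, hcard]⟩
    · push Not at hex
      have := hW (W \ G) Finset.sdiff_subset hne (by
        intro a ha b hb hbX
        simp only [Finset.mem_sdiff, not_and, not_not] at hbX
        have hbG := hbX hb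
        exact hT.of_not (fun h' => (Finset.mem_sdiff.1 ha).2 (h' ▸ hbG)) (hex a ha b hbG))
      have h2 : w ∈ W \ G := by rw [this]; exact hw
      exact absurd h.left_mem (Finset.mem_sdiff.1 h2).2

theorem Strong.exists_seg_right (hT : IsTour r) {W : Finset V} (hW : Strong r W) {w : V}
    (hw : w ∈ W) {g : ℕ} (hg : 1 ≤ g) (hgW : g ≤ W.card) :
    ∃ a G, Seg r a w G ∧ G ⊆ W ∧ G.card = g := by
  obtain ⟨b, G, h, h1, h2⟩ := hW.flip.exists_seg_left hT.flip hw hg hgW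
  exact ⟨b, G, h.flip, h1, h2⟩

end Paths

/-! ### Absorbing a path between two vertices of given paths -/

section Insertion

variable {V : Type*} [DecidableEq V] {r : V → V → Prop}

theorem Conn.exists_first {a b : V} {S : Finset V} (h : Conn r a b S) (hS : S.Nonempty) :
    ∃ c S', r a c ∧ Conn r c b S' ∧ c ∉ S' ∧ S = insert c S' := by
  cases h with
  | arc h => simp at hS
  | @cons _ c _ S hac hc h => exact ⟨c, S, hac, h, hc, rfl⟩

theorem Conn.exists_last {a b : V} {S : Finset V} (h : Conn r a b S) (hS : S.Nonempty) :
    ∃ c S', r c b ∧ Conn r a c S' ∧ c ∉ S' ∧ S = insert c S' := by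
  obtain ⟨c, S', h1, h2, h3⟩ := h.flip.exists_first hS
  exact ⟨c, S', h1, h2.flip, h3⟩

/-- The part of the path behind `v` and the path through `G` both lead from `v` to `y`, so they
merge. -/
theorem Conn.insert_to_end (hT : IsTour r) {x y v : V} {S G : Finset V} (h : Conn r x y S)
    (hG : Disjoint S G) (hv : v ∈ S) (hc : Conn r v y G) : Conn r x y (S ∪ G) := by
  obtain ⟨L, R, hL, hR, h1, h2, h3, rfl⟩ := h.split hv
  rw [Finset.disjoint_left] at *
  simp only [Finset.mem_insert, Finset.mem_union] at *
  have e1 := hR.merge hT hc (by rw [Finset.disjoint_left]; grind)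
  have e2 := hL.append e1 h1 (by simp only [Finset.mem_union]; grind) (by
    simp only [Finset.disjoint_left, Finset.mem_union]; grind)
  convert e2 using 1
  rw [Finset.insert_union, Finset.union_assoc]

theorem Conn.insert_from_start (hT : IsTour r) {x y v : V} {S G : Finset V} (h : Conn r x y S)
    (hG : Disjoint S G) (hv : v ∈ S) (hc : Conn r x v G) : Conn r x y (S ∪ G) :=
  (h.flip.insert_to_end hT.flip hG hv hc.flip).flip

/-- A path from a vertex of one path to a vertex of a parallel path can be absorbed. -/
theorem Conn.insert_cross (hT : IsTour r) {x y v w : V} {S S' G : Finset V} (h : Conn r x y S)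
    (h' : Conn r x y S') (hd : Disjoint S S') (hG : Disjoint S G) (hG' : Disjoint S' G)
    (hv : v ∈ S) (hw : w ∈ S') (hc : Conn r v w G) : Conn r x y (S ∪ S' ∪ G) := by
  obtain ⟨L, R, hL, hR, h1, h2, h3, rfl⟩ := h.split hv
  simp only [Finset.disjoint_insert_left, Finset.disjoint_union_left] at hd hG
  have e1 : Conn r x w (insert v (L ∪ G)) := hL.append hc h1 hG.1 hG.2.1
  -- The initial part of the first path, then `G`, leads from `x` to `w` and is absorbed by the
  -- second path. Now `v` lies on the new path, so the remaining part `R` of the first path can be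
  -- absorbed towards `y`.
  have e2 := h'.insert_from_start hT (by
    simp only [Finset.disjoint_insert_right, Finset.disjoint_union_right]
    exact ⟨hd.1, hd.2.1.symm, hG'⟩) hw e1
  have e3 := e2.insert_to_end hT (v := v) (G := R) (by
    simp only [Finset.disjoint_insert_left, Finset.disjoint_union_left]
    exact ⟨hd.2.2.symm, h2, h3, hG.2.2.symm⟩) (by simp) hR
  convert e3 using 1
  ext u
  simp only [Finset.mem_insert, Finset.mem_union]
  tauto

theorem Conn.insert_between (hT : IsTour r) {x y v w : V} {L R G : Finset V} (hL : Conn r x v L)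
    (hR : Conn r v y R) (h1 : v ∉ L) (h2 : v ∉ R) (hd : Disjoint L R)
    (hG : Disjoint (insert v (L ∪ R)) G) (hw : w ∈ R) (hc : Conn r v w G) :
    Conn r x y (insert v (L ∪ R) ∪ G) := by
  have e1 := hR.insert_from_start hT (G := G) (by
    rw [Finset.disjoint_left] at *
    simp only [Finset.mem_insert, Finset.mem_union] at *
    grind) hw hc
  rw [Finset.disjoint_left] at *
  simp only [Finset.mem_insert, Finset.mem_union] at *
  have e2 := hL.append e1 h1 (by simp only [Finset.mem_union]; grind) (by
    simp only [Finset.disjoint_left, Finset.mem_union]; grind)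
  convert e2 using 1
  rw [Finset.insert_union, Finset.union_assoc]

end Insertion

/-! ### Cycles of prescribed length in strong tournaments -/

section Cycles

variable {V : Type*}

/-- Both colours occur in `G`. -/
def TwoColoured (P : V → Prop) (G : Finset V) : Prop := (∃ w ∈ G, P w) ∧ ∃ w ∈ G, ¬ P w

theorem TwoColoured.mono {P : V → Prop} {G G' : Finset V} (h : TwoColoured P G) (hG : G ⊆ G') :
    TwoColoured P G' := by
  obtain ⟨⟨u, hu, hPu⟩, v, hv, hPv⟩ := h
  exact ⟨⟨u, hG hu, hPu⟩, v, hG hv, hPv⟩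

variable [DecidableEq V] {r : V → V → Prop}

theorem Seg.split {a b w : V} {G : Finset V} (h : Seg r a b G) (hw : w ∈ G) :
    w = a ∨ ∃ c G₁ G₂, Seg r a c G₁ ∧ r c w ∧ Seg r w b G₂ ∧ Disjoint G₁ G₂ ∧ G = G₁ ∪ G₂ := by
  induction h with
  | single a => exact Or.inl (by simpa using hw)
  | @cons a e b G hae ha h ih =>
    rcases Finset.mem_insert.1 hw with rfl | hw
    · exact Or.inl rfl
    · rcases ih hw with rfl | ⟨c, G₁, G₂, h1, h2, h3, h4, rfl⟩
      · exact Or.inr ⟨a, {a}, G, Seg.single a, hae, h, by simpa using ha, by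
          rw [Finset.insert_eq]⟩
      · simp only [Finset.mem_union, not_or] at ha
        exact Or.inr ⟨c, insert a G₁, G₂, Seg.cons hae ha.1 h1, h2, h3, by
          rw [Finset.disjoint_insert_left]; exact ⟨ha.2, h4⟩, by rw [Finset.insert_union]⟩

/-- `Back r G u u'`: there is a cycle with vertex set `G` on which `u'` precedes `u`. -/
def Back (r : V → V → Prop) (G : Finset V) (u u' : V) : Prop := Seg r u u' G ∧ r u' u

/-- `G` is the vertex set of a cycle. -/
def CycOn (r : V → V → Prop) (G : Finset V) : Prop := ∃ a b, Back r G a b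

theorem CycOn.exists_back {G : Finset V} (h : CycOn r G) {w : V} (hw : w ∈ G) :
    ∃ w', Back r G w w' := by
  obtain ⟨a, b, h, hba⟩ := h
  rcases h.split hw with rfl | ⟨c, G₁, G₂, h1, h2, h3, h4, rfl⟩
  · exact ⟨b, h, hba⟩
  · exact ⟨c, by rw [Finset.union_comm]; exact h3.append hba h1 h4.symm, h2⟩

theorem Back.right_mem {G : Finset V} {u u' : V} (h : Back r G u u') : u' ∈ G := h.1.right_mem

/-- `Back` describes the whole cycle opened at one arc, so the cycle is reopened at each step: `G₁`
is the part already traversed, `G₂` the part ahead. -/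
theorem Seg.forall_of_back {a b c e : V} {G G₁ G₂ : Finset V} (h₂ : Seg r c b G₂)
    (h₁ : Seg r a e G₁) (hec : r e c) (hba : r b a) (hd : Disjoint G₁ G₂) (hG : G = G₁ ∪ G₂)
    (P : V → Prop) (hP : ∀ u u', Back r G u u' → P u' → P u) (he : P e) : ∀ w ∈ G₂, P w := by
  induction h₂ generalizing e G₁ with
  | single c =>
    have := hP c e ⟨by
      rw [hG, Finset.union_comm]
      exact (Seg.single c).append hba h₁ hd.symm, hec⟩ he
    simpa using this
  | @cons c d b G₂ hcd hc h ih =>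
    have hPc := hP c e ⟨by
      rw [hG, Finset.union_comm]
      exact (Seg.cons hcd hc h).append hba h₁ hd.symm, hec⟩ he
    have hd0 := hd
    rw [Finset.disjoint_insert_right] at hd
    have := ih (h₁.append hec (Seg.single c) (by simpa using hd.1)) hcd hba (by
      rw [Finset.disjoint_union_left, Finset.disjoint_singleton_left]
      exact ⟨hd.2, hc⟩) (by
      rw [hG, Finset.union_assoc, Finset.insert_eq]) hPc
    intro w hw
    rcases Finset.mem_insert.1 hw with rfl | hw
    · exact hPc
    · exact this w hw

theorem CycOn.forall_of_succ {G : Finset V} (h : CycOn r G) (P : V → Prop)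
    (hP : ∀ u u', Back r G u u' → P u' → P u) {w : V} (hw : w ∈ G) (hPw : P w) :
    ∀ u ∈ G, P u := by
  obtain ⟨b, hb, hbw⟩ := h.exists_back hw
  cases hb with
  | single => simpa using hPw
  | @cons _ d _ G₂ hcd hc h₂ =>
    have := Seg.forall_of_back h₂ (Seg.single w) hcd hbw (by simpa using hc)
      (Finset.insert_eq _ _) P hP hPw
    intro u hu
    rcases Finset.mem_insert.1 hu with rfl | hu
    · exact hPw
    · exact this u hu

/-- The backward direction is the one needed later: a path round a cycle of g vertices runs from a
vertex to its predecessor, so domination is handed on backwards. -/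
theorem CycOn.forall_of_back {G : Finset V} (h : CycOn r G) (P : V → Prop)
    (hP : ∀ u u', Back r G u u' → P u → P u') {w : V} (hw : w ∈ G) (hPw : P w) :
    ∀ u ∈ G, P u := by
  by_contra hcon
  push Not at hcon
  obtain ⟨u, hu, hPu⟩ := hcon
  exact h.forall_of_succ (fun v => ¬ P v) (fun u u' h h1 h2 => h1 (hP u u' h h2)) hu hPu w hw hPw

theorem Strong.exists_arc {W X : Finset V} (hT : IsTour r) (hW : Strong r W) (hX : X ⊆ W)
    (hne : X.Nonempty) (hXW : X ≠ W) : ∃ a ∈ X, ∃ b ∈ W, b ∉ X ∧ r a b := by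
  by_contra hcon
  push Not at hcon
  have h2 := hW (W \ X) Finset.sdiff_subset
    (by rw [Finset.sdiff_nonempty]; exact fun h' => hXW (Finset.Subset.antisymm hX h'))
    (by
      intro a ha b hb hbX
      simp only [Finset.mem_sdiff, not_and, not_not] at ha hbX
      exact hT.of_not (fun h => ha.2 (h ▸ hbX hb)) (hcon b (hbX hb) a ha.1 ha.2))
  obtain ⟨a, ha⟩ := hne
  have h3 : a ∈ W \ X := by rw [h2]; exact hX ha
  exact (Finset.mem_sdiff.1 h3).2 ha

theorem cycOn_triangle (hT : IsTour r) {a b c : V} (h1 : r a b) (h2 : r b c) (h3 : r c a) :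
    CycOn r {a, b, c} :=
  ⟨a, c, Seg.cons h1 (by
    simp only [Finset.mem_insert, Finset.mem_singleton, not_or]
    exact ⟨hT.ne h1, (hT.ne h3).symm⟩) (Seg.cons h2 (by simpa using hT.ne h2) (Seg.single c)), h3⟩

theorem card_triangle (hT : IsTour r) {a b c : V} (h1 : r a b) (h2 : r b c) (h3 : r c a) :
    ({a, b, c} : Finset V).card = 3 :=
  Finset.card_eq_three.2 ⟨a, b, c, hT.ne h1, (hT.ne h3).symm, hT.ne h2, rfl⟩

/-- Suppose all triangles are monochromatic, and let p → q join two colours. Let R consist of those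
out-neighbours of p that have the other colour or are dominated by an out-neighbour of p of the
other colour. Then no arc leaves R, although q is in R and p is not; this contradicts strength. -/
theorem Strong.exists_triangle (hT : IsTour r) {W : Finset V} (hW : Strong r W) (P : V → Prop)
    (hP : TwoColoured P W) :
    ∃ G ⊆ W, G.card = 3 ∧ CycOn r G ∧ TwoColoured P G := by
  classical
  by_contra hcon
  have hmono : ∀ a b c, a ∈ W → b ∈ W → c ∈ W → r a b → r b c → r c a → (P a ↔ P b) := by
    intro a b c ha hb hc h1 h2 h3
    by_contra hne
    refine hcon ⟨{a, b, c}, ?_, card_triangle hT h1 h2 h3, cycOn_triangle hT h1 h2 h3, ?_⟩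
    · intro u
      simp only [Finset.mem_insert, Finset.mem_singleton]
      rintro (rfl | rfl | rfl) <;> assumption
    · by_cases hPa : P a
      · exact ⟨⟨a, by simp, hPa⟩, b, by simp, by tauto⟩
      · exact ⟨⟨b, by simp, by tauto⟩, a, by simp, hPa⟩
  obtain ⟨p, hp, q, hq, hpq, hne⟩ : ∃ p ∈ W, ∃ q ∈ W, r p q ∧ ¬ (P p ↔ P q) := by
    obtain ⟨⟨u, hu, hPu⟩, v, hv, hPv⟩ := hP
    rcases hT.total (x := u) (y := v) (by rintro rfl; exact hPv hPu) with h | h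
    · exact ⟨u, hu, v, hv, h, by tauto⟩
    · exact ⟨v, hv, u, hu, h, by tauto⟩
  let R := W.filter fun u => r p u ∧ (¬ (P u ↔ P p) ∨
    ∃ s ∈ W, ¬ (P s ↔ P p) ∧ r p s ∧ r s u)
  have hpR : p ∉ R := fun h => hT.irrefl p (Finset.mem_filter.1 h).2.1
  obtain ⟨u, hu, t, ht, htR, hut⟩ := hW.exists_arc hT (X := R) (Finset.filter_subset _ _)
    ⟨q, Finset.mem_filter.2 ⟨hq, hpq, Or.inl (by tauto)⟩⟩ (fun h => hpR (by rw [h]; exact hp))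
  obtain ⟨huW, hpu, hu⟩ := Finset.mem_filter.1 hu
  apply htR
  have htp : t ≠ p := by
    rintro rfl
    exact hT.asymm hut hpu
  have key : ∀ s ∈ W, ¬ (P s ↔ P p) → r s u → (P u ↔ P p) → (P t ↔ P p) → r s t := by
    intro s hs h1 h2 h3 h4
    by_contra hst
    have hts : r t s := hT.of_not (by rintro rfl; exact hT.asymm h2 hut) hst
    have := hmono s u t hs huW ht h2 hut hts
    tauto
  have hpt : r p t := by
    by_contra hpt
    have htp' : r t p := hT.of_not htp.symm hpt
    have h1 := hmono p u t hp huW ht hpu hut htp'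
    have h2 := hmono u t p huW ht hp hut htp' hpu
    rcases hu with hu | ⟨s, hs, h3, h4, h5⟩
    · tauto
    · have h6 := key s hs h3 h5 (by tauto) (by tauto)
      have := hmono p s t hp hs ht h4 h6 htp'
      tauto
  refine Finset.mem_filter.2 ⟨ht, hpt, ?_⟩
  by_cases htc : P t ↔ P p
  · right
    by_cases huc : P u ↔ P p
    · rcases hu with hu | ⟨s, hs, h3, h4, h5⟩
      · tauto
      · exact ⟨s, hs, h3, h4, key s hs h3 h5 huc htc⟩
    · exact ⟨u, huW, huc, hpu, hut⟩
  · exact Or.inl htc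

/-- If `u` fits between no two consecutive vertices, then dominating one vertex of the cycle forces
`u` to dominate its predecessor, and so all of them. -/
theorem CycOn.insert (hT : IsTour r) {G : Finset V} (h : CycOn r G) {u : V} (hu : u ∉ G)
    (h1 : ∃ v ∈ G, r u v) (h2 : ∃ v ∈ G, r v u) : CycOn r (insert u G) := by
  by_contra hcon
  obtain ⟨v, hv, huv⟩ := h1
  obtain ⟨w, hw, hwu⟩ := h2
  have := h.forall_of_back (fun v => r u v) (by
    intro a b hab hua
    by_contra hub
    have hbu := hT.of_not (by rintro rfl; exact hu hab.right_mem) hub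
    exact hcon ⟨u, b, Seg.cons hua hu hab.1, hbu⟩) hv huv w hw
  exact hT.asymm this hwu

/-- Cycles of all lengths meeting both colour classes of a strong tournament. -/
theorem Strong.exists_cycOn (hT : IsTour r) {W : Finset V} (hW : Strong r W) (P : V → Prop)
    (hP : TwoColoured P W) {g : ℕ} (hg : 3 ≤ g) (hgW : g ≤ W.card) :
    ∃ G ⊆ W, G.card = g ∧ CycOn r G ∧ TwoColoured P G := by
  classical
  induction g, hg using Nat.le_induction with
  | base => exact hW.exists_triangle hT P hP
  | succ g hg ih =>
    obtain ⟨G, hGW, hcard, hcyc, hcol⟩ := ih (by omega)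
    have hGne : G ≠ W := by rintro rfl; omega
    have hG0 : G.Nonempty := Finset.card_pos.1 (by omega)
    by_cases hex : ∃ u ∈ W, u ∉ G ∧ (∃ v ∈ G, r u v) ∧ ∃ v ∈ G, r v u
    · obtain ⟨u, huW, hu, h1, h2⟩ := hex
      exact ⟨insert u G, Finset.insert_subset huW hGW, by
        rw [Finset.card_insert_of_notMem hu, hcard], hcyc.insert hT hu h1 h2,
        hcol.mono (Finset.subset_insert _ _)⟩
    -- No outside vertex can be inserted, so each one either dominates all of `G` or is dominated by
    -- all of `G`.
    · have hall : ∀ u ∈ W, u ∉ G → ∀ v ∈ G, r u v → ∀ w ∈ G, r u w := by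
        intro u hu huG v hv huv w hw
        by_contra hcon
        exact hex ⟨u, hu, huG, ⟨v, hv, huv⟩, w, hw,
          hT.of_not (fun h => huG (h ▸ hw)) hcon⟩
      obtain ⟨g₀, hg₀⟩ := hG0
      let I := W.filter fun u => u ∉ G ∧ r u g₀
      -- Strength yields an arc s → t where `G` dominates s and t dominates `G`. Putting s, t in
      -- place of one vertex of the cycle lengthens it by one.
      obtain ⟨s, hs, t, ht, hst⟩ : ∃ s ∈ W, ∃ t ∈ I, s ∉ G ∧ r g₀ s ∧ r s t := by
        have h1 : I ≠ W := fun h => by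
          have : g₀ ∈ I := by rw [h]; exact hGW hg₀
          exact (Finset.mem_filter.1 this).2.1 hg₀
        have h2 : I.Nonempty := by
          by_contra hI
          rw [Finset.not_nonempty_iff_eq_empty] at hI
          refine hGne (hW G hGW ⟨g₀, hg₀⟩ ?_)
          intro a ha b hb hbG
          by_contra hab
          have hba := hT.of_not (by rintro rfl; exact hbG ha) hab
          have : b ∈ I := Finset.mem_filter.2 ⟨hb, hbG, hall b hb hbG a ha hba g₀ hg₀⟩
          simp [hI] at this
        by_contra hcon
        push Not at hcon
        have h3 : I ∪ G = W := by
          refine hW _ (Finset.union_subset (Finset.filter_subset _ _) hGW) (h2.mono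
            Finset.subset_union_left) ?_
          intro a ha b hb hbG
          simp only [Finset.mem_union, not_or] at ha hbG
          have hb1 : ∀ v ∈ G, r v b := by
            intro v hv
            by_contra hvb
            exact hbG.1 (Finset.mem_filter.2 ⟨hb, hbG.2, hall b hb hbG.2 v hv
              (hT.of_not (fun h => hbG.2 (h ▸ hv)) hvb) g₀ hg₀⟩)
          rcases ha with ha | ha
          · exact hT.of_not (fun h => hbG.1 (h ▸ ha)) (hcon b hb a ha hbG.2 (hb1 g₀ hg₀))
          · exact hb1 a ha
        refine h1 (hW I (Finset.filter_subset _ _) h2 ?_)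
        intro a ha b hb hbI
        have hbG : b ∈ G := by
          rw [← h3, Finset.mem_union] at hb
          exact hb.resolve_left hbI
        obtain ⟨haW, haG, hag⟩ := Finset.mem_filter.1 ha
        exact hall a haW haG g₀ hg₀ hag b hbG
      obtain ⟨hsG, hgs, hst⟩ := hst
      obtain ⟨htW, htG, htg⟩ := Finset.mem_filter.1 ht
      obtain ⟨⟨w₁, hw₁, hPw₁⟩, w₂, hw₂, hPw₂⟩ := hcol
      -- The vertex to be replaced must differ from the two witnesses of the colours; this is
      -- possible because g ≥ 3.
      obtain ⟨c, hc, hc1, hc2⟩ : ∃ c ∈ G, c ≠ w₁ ∧ c ≠ w₂ := by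
        have : ((G.erase w₁).erase w₂).Nonempty := by
          rw [← Finset.card_pos]
          have h1 := Finset.pred_card_le_card_erase (s := G) (a := w₁)
          have h2 := Finset.pred_card_le_card_erase (s := G.erase w₁) (a := w₂)
          omega
        obtain ⟨c, hc⟩ := this
        simp only [Finset.mem_erase] at hc
        exact ⟨c, hc.2.2, hc.2.1, hc.1⟩
      obtain ⟨b, hb, hbc⟩ := hcyc.exists_back hc
      obtain ⟨d, hcd, hd⟩ := hb.tail (by omega)
      have hbs : r b s := by
        by_contra hbs
        have hsb := hT.of_not (by rintro rfl; exact hsG hb.right_mem) hbs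
        exact hT.asymm (hall s hs hsG b hb.right_mem hsb g₀ hg₀) hgs
      have htd : r t d := hall t htW htG g₀ hg₀ htg d (Finset.mem_of_mem_erase hd.left_mem)
      have hsegst : Seg r s t {s, t} := Seg.cons hst (by simpa using hT.ne hst) (Seg.single t)
      have hdis : Disjoint (G.erase c) {s, t} := by
        rw [Finset.disjoint_left]
        intro u hu
        simp only [Finset.mem_insert, Finset.mem_singleton]
        rintro (rfl | rfl)
        · exact hsG (Finset.mem_of_mem_erase hu)
        · exact htG (Finset.mem_of_mem_erase hu)
      refine ⟨G.erase c ∪ {s, t}, ?_, ?_, ⟨d, t, hd.append hbs hsegst hdis, htd⟩, ?_⟩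
      · refine Finset.union_subset ((Finset.erase_subset _ _).trans hGW) ?_
        intro u
        simp only [Finset.mem_insert, Finset.mem_singleton]
        rintro (rfl | rfl) <;> assumption
      · rw [Finset.card_union_of_disjoint hdis, Finset.card_erase_of_mem hc,
          Finset.card_pair (hT.ne hst)]
        omega
      · exact ⟨⟨w₁, by simp [hw₁, hc1.symm], hPw₁⟩, w₂, by simp [hw₂, hc2.symm], hPw₂⟩

end Cycles

/-! ### Degree counts in subtournaments -/

section Counting

variable {V : Type*} {r : V → V → Prop}

open Classical in
theorem sum_card_filter (hT : IsTour r) (I : Finset V) :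
    ∑ v ∈ I, (I.filter (r v)).card * 2 = I.card * (I.card - 1) := by
  have h1 : ∑ v ∈ I, (I.filter (r v)).card = ∑ v ∈ I, (I.filter (r · v)).card :=
    Finset.sum_card_bipartiteAbove_eq_sum_card_bipartiteBelow r
  have h2 : ∀ v ∈ I, (I.filter (r v)).card + (I.filter (r · v)).card = I.card - 1 := by
    intro v hv
    rw [← Finset.card_union_of_disjoint, ← Finset.card_erase_of_mem hv]
    · congr 1
      ext u
      simp only [Finset.mem_union, Finset.mem_filter, Finset.mem_erase]
      constructor
      · rintro (⟨h, h'⟩ | ⟨h, h'⟩)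
        · exact ⟨(hT.ne h').symm, h⟩
        · exact ⟨hT.ne h', h⟩
      · rintro ⟨h, h'⟩
        rcases hT.total h with h | h
        · exact Or.inr ⟨h', h⟩
        · exact Or.inl ⟨h', h⟩
    · rw [Finset.disjoint_left]
      intro u hu hu'
      exact hT.asymm (Finset.mem_filter.1 hu).2 (Finset.mem_filter.1 hu').2
  rw [← Finset.sum_mul, mul_two]
  conv_lhs => rw [h1]
  rw [← h1]
  nth_rewrite 2 [h1]
  rw [← Finset.sum_add_distrib, Finset.sum_congr rfl h2, Finset.sum_const, smul_eq_mul]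

open Classical in
theorem exists_card_filter_le (hT : IsTour r) {I : Finset V} (hI : I.Nonempty) :
    ∃ v ∈ I, 2 * (I.filter (r v)).card + 1 ≤ I.card := by
  by_contra hcon
  push Not at hcon
  have h1 := sum_card_filter hT I
  have h2 : ∑ v ∈ I, I.card ≤ ∑ v ∈ I, (I.filter (r v)).card * 2 :=
    Finset.sum_le_sum fun v hv => by have := hcon v hv; omega
  rw [h1, Finset.sum_const, smul_eq_mul] at h2
  have h3 := Nat.le_of_mul_le_mul_left h2 (Finset.card_pos.2 hI)
  have := Finset.card_pos.2 hI
  omega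

variable [Fintype V]

open Classical in
/-- The set of vertices dominated by `v`. -/
noncomputable def outSet (r : V → V → Prop) (v : V) : Finset V := Finset.univ.filter (r v)

theorem mem_outSet {v w : V} : w ∈ outSet r v ↔ r v w := by simp [outSet]

theorem card_outSet_add (hT : IsTour r) (v : V) :
    (outSet r v).card + (outSet (flip r) v).card + 1 = Fintype.card V := by
  classical
  rw [← Finset.card_union_of_disjoint, ← Finset.card_univ, ← Finset.card_erase_add_one
    (Finset.mem_univ v)]
  · congr 2
    ext u
    simp only [Finset.mem_union, mem_outSet, flip, Finset.mem_erase, Finset.mem_univ, and_true]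
    exact ⟨fun h => h.elim (fun h => (hT.ne h).symm) hT.ne, fun h => (hT.total h).symm⟩
  · rw [Finset.disjoint_left]
    intro u hu hu'
    rw [mem_outSet] at hu hu'
    exact hT.asymm hu hu'

/-- A set all of whose out-neighbours lie in itself or in a small set is large. -/
theorem card_ge_of_out (hT : IsTour r) {δ : ℕ} (hδ : ∀ v, δ ≤ (outSet r v).card) {I K : Finset V}
    (hI : I.Nonempty) (h : ∀ v ∈ I, ∀ u, r v u → u ∈ I ∨ u ∈ K) :
    2 * δ + 1 ≤ I.card + 2 * K.card := by
  classical
  -- Some vertex of `I` has at most (|I| - 1)/2 out-neighbours in `I`; the others all lie in `K`.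
  obtain ⟨v, hv, hle⟩ := exists_card_filter_le hT hI
  have h1 : outSet r v ⊆ I.filter (r v) ∪ K := by
    intro u hu
    rw [mem_outSet] at hu
    simp only [Finset.mem_union, Finset.mem_filter]
    exact (h v hv u hu).imp (fun h => ⟨h, hu⟩) id
  have h2 := (Finset.card_le_card h1).trans (Finset.card_union_le _ _)
  have := hδ v
  omega

end Counting

/-! ### Pairs of parallel paths and propagation of domination -/

section Frames

variable {V : Type*} [DecidableEq V] {r : V → V → Prop}

/-- There is a path from `x` to `y` with exactly `n` inner vertices. -/
def HasConn (r : V → V → Prop) (x y : V) (n : ℕ) : Prop :=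
  ∃ S, Conn r x y S ∧ S.card = n ∧ x ∉ S ∧ y ∉ S

theorem HasConn.flip {x y : V} {n : ℕ} (h : HasConn r x y n) : HasConn (flip r) y x n := by
  obtain ⟨S, h1, h2, h3, h4⟩ := h
  exact ⟨S, h1.flip, h2, h4, h3⟩

/-- Two internally disjoint paths from `x` to `y` with sets of inner vertices `S₁` and `S₂` in a
tournament all of whose semidegrees are at least `δ`; `W` is the set of the remaining vertices. -/
structure Frame [Fintype V] (r : V → V → Prop) (δ : ℕ) (x y : V) (S₁ S₂ W : Finset V) : Prop where
  tour : IsTour r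
  ne : x ≠ y
  conn₁ : Conn r x y S₁
  conn₂ : Conn r x y S₂
  nonempty₁ : S₁.Nonempty
  nonempty₂ : S₂.Nonempty
  disj : Disjoint S₁ S₂
  disj₁ : Disjoint S₁ W
  disj₂ : Disjoint S₂ W
  cover : ∀ v, v = x ∨ v = y ∨ v ∈ S₁ ∨ v ∈ S₂ ∨ v ∈ W
  x_notMem : x ∉ S₁ ∧ x ∉ S₂ ∧ x ∉ W
  y_notMem : y ∉ S₁ ∧ y ∉ S₂ ∧ y ∉ W
  three_le : 3 ≤ S₁.card + S₂.card
  le₁ : S₁.card ≤ S₂.card + 2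
  le₂ : S₂.card ≤ S₁.card + 2
  four_le : 4 ≤ δ
  order : Fintype.card V + 1 ≤ 3 * δ
  out_ge : ∀ v, δ ≤ (outSet r v).card
  in_ge : ∀ v, δ ≤ (outSet (flip r) v).card

namespace Frame

variable [Fintype V] {δ : ℕ} {x y : V} {S₁ S₂ W : Finset V}

theorem swap (f : Frame r δ x y S₁ S₂ W) : Frame r δ x y S₂ S₁ W :=
  { f with
    conn₁ := f.conn₂
    conn₂ := f.conn₁
    nonempty₁ := f.nonempty₂
    nonempty₂ := f.nonempty₁
    disj := f.disj.symm
    disj₁ := f.disj₂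
    disj₂ := f.disj₁
    cover := fun v => by have := f.cover v; tauto
    x_notMem := ⟨f.x_notMem.2.1, f.x_notMem.1, f.x_notMem.2.2⟩
    y_notMem := ⟨f.y_notMem.2.1, f.y_notMem.1, f.y_notMem.2.2⟩
    three_le := by have := f.three_le; omega
    le₁ := f.le₂
    le₂ := f.le₁ }

theorem flip (f : Frame r δ x y S₁ S₂ W) : Frame (_root_.flip r) δ y x S₁ S₂ W :=
  { f with
    tour := f.tour.flip
    ne := f.ne.symm
    conn₁ := f.conn₁.flip
    conn₂ := f.conn₂.flip
    cover := fun v => by have := f.cover v; tauto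
    x_notMem := f.y_notMem
    y_notMem := f.x_notMem
    out_ge := f.in_ge
    in_ge := f.out_ge }

theorem card_eq (f : Frame r δ x y S₁ S₂ W) :
    Fintype.card V = S₁.card + S₂.card + W.card + 2 := by
  have h : (Finset.univ : Finset V) = insert x (insert y (S₁ ∪ S₂ ∪ W)) := by
    ext v
    simp only [Finset.mem_univ, Finset.mem_insert, Finset.mem_union, true_iff]
    have := f.cover v
    tauto
  obtain ⟨hx1, hx2, hx3⟩ := f.x_notMem
  obtain ⟨hy1, hy2, hy3⟩ := f.y_notMem
  rw [← Finset.card_univ, h, Finset.card_insert_of_notMem (by simp [f.ne, *]),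
    Finset.card_insert_of_notMem (by simp [*]), Finset.card_union_of_disjoint (by
      rw [Finset.disjoint_union_left]; exact ⟨f.disj₁, f.disj₂⟩),
    Finset.card_union_of_disjoint f.disj]

theorem out_le (f : Frame r δ x y S₁ S₂ W) (v : V) : (outSet r v).card + 2 ≤ 2 * δ := by
  have := card_outSet_add f.tour v
  have := f.in_ge v
  have := f.order
  omega

theorem in_le (f : Frame r δ x y S₁ S₂ W) (v : V) : (outSet (_root_.flip r) v).card + 2 ≤ 2 * δ :=
  f.flip.out_le v

theorem hasConn (f : Frame r δ x y S₁ S₂ W) {G : Finset V} (hG : G ⊆ W)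
    (h : Conn r x y (S₁ ∪ S₂ ∪ G)) : HasConn r x y (S₁.card + S₂.card + G.card) := by
  refine ⟨_, h, ?_, ?_, ?_⟩
  · rw [Finset.card_union_of_disjoint, Finset.card_union_of_disjoint f.disj]
    rw [Finset.disjoint_union_left]
    exact ⟨f.disj₁.mono_right hG, f.disj₂.mono_right hG⟩
  · simp only [Finset.mem_union, not_or]
    exact ⟨⟨f.x_notMem.1, f.x_notMem.2.1⟩, fun h => f.x_notMem.2.2 (hG h)⟩
  · simp only [Finset.mem_union, not_or]
    exact ⟨⟨f.y_notMem.1, f.y_notMem.2.1⟩, fun h => f.y_notMem.2.2 (hG h)⟩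

end Frame

/-- No path from `v` to `w` has exactly `g` inner vertices, all in `W`. -/
def Blocked (r : V → V → Prop) (W : Finset V) (g : ℕ) (v w : V) : Prop :=
  ∀ G ⊆ W, G.card = g → ¬ Conn r v w G

theorem Blocked.flip {W : Finset V} {g : ℕ} {v w : V} (h : Blocked r W g v w) :
    Blocked (flip r) W g w v := fun G h1 h2 h3 => h G h1 h2 h3.flip

theorem Blocked.unflip {W : Finset V} {g : ℕ} {v w : V} (h : Blocked (_root_.flip r) W g v w) :
    Blocked r W g w v := h.flip

namespace Frame

variable [Fintype V] {δ g : ℕ} {x y : V} {S₁ S₂ W : Finset V}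

/-- The two paths cannot be extended by exactly `g` vertices. -/
def Stuck (_ : Frame r δ x y S₁ S₂ W) (g : ℕ) : Prop :=
  ¬ HasConn r x y (S₁.card + S₂.card + g)

theorem Stuck.swap {f : Frame r δ x y S₁ S₂ W} (h : f.Stuck g) : f.swap.Stuck g := by
  unfold Stuck at *
  rwa [add_comm S₂.card]

theorem Stuck.flip {f : Frame r δ x y S₁ S₂ W} (h : f.Stuck g) : f.flip.Stuck g :=
  fun h' => h h'.flip

/-- This and the next lemmas collect the pairs that no path with `g` inner vertices in `W` may join:
such a path could be merged into the frame and would lengthen it by exactly `g`. -/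
theorem Stuck.ends {f : Frame r δ x y S₁ S₂ W} (h : f.Stuck g) : Blocked r W g x y := by
  rintro G hG rfl hc
  refine h (f.hasConn hG ?_)
  refine (f.conn₁.merge f.tour f.conn₂ f.disj).merge f.tour hc ?_
  rw [Finset.disjoint_union_left]
  exact ⟨f.disj₁.mono_right hG, f.disj₂.mono_right hG⟩

theorem Stuck.to_end₁ {f : Frame r δ x y S₁ S₂ W} (h : f.Stuck g) {v : V} (hv : v ∈ S₁) :
    Blocked r W g v y := by
  rintro G hG rfl hc
  refine h (f.hasConn hG ?_)
  refine (f.conn₁.merge f.tour f.conn₂ f.disj).insert_to_end f.tour ?_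
    (Finset.mem_union_left _ hv) hc
  rw [Finset.disjoint_union_left]
  exact ⟨f.disj₁.mono_right hG, f.disj₂.mono_right hG⟩

theorem Stuck.to_end {f : Frame r δ x y S₁ S₂ W} (h : f.Stuck g) {v : V} (hv : v ∈ S₁ ∪ S₂) :
    Blocked r W g v y :=
  (Finset.mem_union.1 hv).elim h.to_end₁ h.swap.to_end₁

theorem Stuck.from_start {f : Frame r δ x y S₁ S₂ W} (h : f.Stuck g) {v : V} (hv : v ∈ S₁ ∪ S₂) :
    Blocked r W g x v := (h.flip.to_end hv).unflip

theorem Stuck.cross {f : Frame r δ x y S₁ S₂ W} (h : f.Stuck g) {v w : V} (hv : v ∈ S₁)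
    (hw : w ∈ S₂) : Blocked r W g v w := by
  rintro G hG rfl hc
  exact h (f.hasConn hG (f.conn₁.insert_cross f.tour f.conn₂ f.disj (f.disj₁.mono_right hG)
    (f.disj₂.mono_right hG) hv hw hc))

theorem Stuck.between {f : Frame r δ x y S₁ S₂ W} (h : f.Stuck g) {v w : V} {L R : Finset V}
    (hL : Conn r x v L) (hR : Conn r v y R) (h1 : v ∉ L) (h2 : v ∉ R) (hd : Disjoint L R)
    (hS : S₁ = insert v (L ∪ R)) (hw : w ∈ R) : Blocked r W g v w := by
  rintro G hG rfl hc
  refine h (f.hasConn hG ?_)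
  have hGd := f.disj₁.mono_right hG
  have := (hL.insert_between f.tour hR h1 h2 hd (by rwa [← hS]) hw hc).merge f.tour f.conn₂ (by
    rw [← hS, Finset.disjoint_union_left]
    exact ⟨f.disj, (f.disj₂.mono_right hG).symm⟩)
  rw [← hS] at this
  convert this using 1
  ext u
  simp only [Finset.mem_union]
  tauto

/-- A pair inside a single path; the crossing pairs alone would only pass domination back and forth
between the two paths. -/
theorem Stuck.exists_between {f : Frame r δ x y S₁ S₂ W} (h : f.Stuck g) (hS : 2 ≤ S₁.card) :
    ∃ v ∈ S₁, ∃ w ∈ S₁, Blocked r W g v w := by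
  obtain ⟨c, S', hxc, hc, hcS, rfl⟩ := f.conn₁.exists_first f.nonempty₁
  rw [Finset.card_insert_of_notMem hcS] at hS
  obtain ⟨w, hw⟩ := Finset.card_pos.1 (show 0 < S'.card by omega)
  exact ⟨c, by simp, w, by simp [hw], h.between (Conn.arc hxc) hc (by simp) hcS (by simp)
    (by simp) hw⟩

/-- If no path in `W` with `g` inner vertices leads from `v` to `v'`, then domination passes along
paths in `W` with `g` vertices. -/
theorem adj_of_blocked {f : Frame r δ x y S₁ S₂ W} {v v' w w' : V} (hb : Blocked r W g v v')
    (hv' : v' ∈ S₁ ∪ S₂) {G : Finset V} (hG : G ⊆ W) (hg : G.card = g) (hs : Seg r w w' G)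
    (hvw : r v w) : r v' w' := by
  by_contra hcon
  refine hb G hG hg (hs.conn hvw (f.tour.of_not ?_ hcon))
  rintro rfl
  rcases Finset.mem_union.1 hv' with h | h
  · exact Finset.disjoint_left.1 f.disj₁ h (hG hs.right_mem)
  · exact Finset.disjoint_left.1 f.disj₂ h (hG hs.right_mem)

theorem Stuck.step_all {f : Frame r δ x y S₁ S₂ W} (h : f.Stuck g) {w w' : V}
    {G : Finset V} (hG : G ⊆ W) (hg : G.card = g) (hs : Seg r w w' G)
    (hw : ∀ s ∈ S₁ ∪ S₂, r s w) : ∀ s ∈ S₁ ∪ S₂, r s w' := by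
  intro s hs'
  obtain ⟨s₁, h₁⟩ := f.nonempty₁
  obtain ⟨s₂, h₂⟩ := f.nonempty₂
  rcases Finset.mem_union.1 hs' with h' | h'
  · exact adj_of_blocked (f := f) (h.swap.cross h₂ h') hs' hG hg hs
      (hw _ (Finset.mem_union_right _ h₂))
  · exact adj_of_blocked (f := f) (h.cross h₁ h') hs' hG hg hs
      (hw _ (Finset.mem_union_left _ h₁))

/-- After one step the domination of `w` by all of `S₁` passes to all of `S₂` and, through the
blocked pair inside `S₁`, to one vertex of `S₁`. The second step then reaches both paths at once. -/
theorem Stuck.exists_all_aux {f : Frame r δ x y S₁ S₂ W} (h : f.Stuck g) {W₀ : Finset V}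
    (hsucc : ∀ w ∈ W₀, ∃ w' ∈ W₀, ∃ G ⊆ W, G.card = g ∧ Seg r w w' G) (hS : 2 ≤ S₁.card)
    {w : V} (hw : w ∈ W₀) (hall : ∀ s ∈ S₁, r s w) : ∃ w ∈ W₀, ∀ s ∈ S₁ ∪ S₂, r s w := by
  obtain ⟨s, hs, s', hs', hb⟩ := h.exists_between hS
  obtain ⟨w₁, hw₁, G₁, hG₁, hc₁, hseg₁⟩ := hsucc w hw
  obtain ⟨w₂, hw₂, G₂, hG₂, hc₂, hseg₂⟩ := hsucc w₁ hw₁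
  have h1 : ∀ t ∈ S₂, r t w₁ := fun t ht =>
    adj_of_blocked (f := f) (h.cross hs ht) (Finset.mem_union_right _ ht) hG₁ hc₁ hseg₁ (hall s hs)
  have h2 : r s' w₁ :=
    adj_of_blocked (f := f) hb (Finset.mem_union_left _ hs') hG₁ hc₁ hseg₁ (hall s hs)
  obtain ⟨t, ht⟩ := f.nonempty₂
  refine ⟨w₂, hw₂, fun u hu => ?_⟩
  rcases Finset.mem_union.1 hu with hu' | hu'
  · exact adj_of_blocked (f := f) (h.swap.cross ht hu') hu hG₂ hc₂ hseg₂ (h1 t ht)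
  · exact adj_of_blocked (f := f) (h.cross hs' hu') hu hG₂ hc₂ hseg₂ h2

/-- One or two crossing steps spread a single arc to a whole path with at least two inner vertices,
to which the preceding lemma applies. Such a path exists as there are at least three inner vertices
in all. -/
theorem Stuck.exists_all {f : Frame r δ x y S₁ S₂ W} (h : f.Stuck g) {W₀ : Finset V}
    (hsucc : ∀ w ∈ W₀, ∃ w' ∈ W₀, ∃ G ⊆ W, G.card = g ∧ Seg r w w' G)
    {v w : V} (hv : v ∈ S₁ ∪ S₂) (hw : w ∈ W₀) (hvw : r v w) :
    ∃ w ∈ W₀, ∀ s ∈ S₁ ∪ S₂, r s w := by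
  have key : ∀ {S₁ S₂ : Finset V} {f : Frame r δ x y S₁ S₂ W}, f.Stuck g → 2 ≤ S₁.card →
      v ∈ S₁ ∪ S₂ → ∃ w ∈ W₀, ∀ s ∈ S₁ ∪ S₂, r s w := by
    intro S₁ S₂ f h hS hv
    obtain ⟨w₁, hw₁, G₁, hG₁, hc₁, hseg₁⟩ := hsucc w hw
    rcases Finset.mem_union.1 hv with hv | hv
    · obtain ⟨t, ht⟩ := f.nonempty₂
      obtain ⟨w₂, hw₂, G₂, hG₂, hc₂, hseg₂⟩ := hsucc w₁ hw₁
      have h1 : ∀ t ∈ S₂, r t w₁ := fun t ht =>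
        adj_of_blocked (f := f) (h.cross hv ht) (Finset.mem_union_right _ ht) hG₁ hc₁ hseg₁ hvw
      exact h.exists_all_aux hsucc hS hw₂ fun s hs => adj_of_blocked (f := f) (h.swap.cross ht hs)
        (Finset.mem_union_left _ hs) hG₂ hc₂ hseg₂ (h1 t ht)
    · exact h.exists_all_aux hsucc hS hw₁ fun s hs => adj_of_blocked (f := f) (h.swap.cross hv hs)
        (Finset.mem_union_left _ hs) hG₁ hc₁ hseg₁ hvw
  rcases (show 2 ≤ S₁.card ∨ 2 ≤ S₂.card by have := f.three_le; omega) with hS | hS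
  · exact key h hS hv
  · obtain ⟨w, hw, h'⟩ := key h.swap hS (by rwa [Finset.union_comm])
    exact ⟨w, hw, fun s hs => h' s (by rwa [Finset.union_comm])⟩

end Frame

end Frames

/-! ### Extending a frame by any number of vertices -/

section Extension

variable {V : Type*} [DecidableEq V] {r : V → V → Prop}

/-- An inclusion-minimal nonempty dominating subset is strong. -/
theorem exists_strong_initial {W : Finset V} {X : Finset V} (hX : X ⊆ W)
    (hne : X.Nonempty) (hdom : ∀ a ∈ X, ∀ b ∈ W, b ∉ X → r a b) :
    ∃ I ⊆ X, I.Nonempty ∧ Strong r I ∧ ∀ a ∈ I, ∀ b ∈ W, b ∉ I → r a b := by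
  induction hn : X.card using Nat.strong_induction_on generalizing X with
  | _ n ih =>
    by_cases hs : Strong r X
    · exact ⟨X, subset_rfl, hne, hs, hdom⟩
    · unfold Strong at hs
      push Not at hs
      obtain ⟨Y, hY, hYne, hYdom, hYX⟩ := hs
      obtain ⟨I, hI, h⟩ := ih Y.card (by
        rw [← hn]
        exact Finset.card_lt_card (Finset.ssubset_iff_subset_ne.2 ⟨hY, hYX⟩)) (hY.trans hX) hYne
        (by
          intro a ha b hb hbY
          by_cases hbX : b ∈ X
          · exact hYdom a ha b hbX hbY
          · exact hdom a (hY ha) b hb hbX) rfl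
      exact ⟨I, hI.trans hY, h⟩

/-- A tournament that is not strong has paths of all lengths at least one from any vertex of its
initial strong component to any vertex of its terminal strong component. -/
theorem exists_seg_of_not_strong (hT : IsTour r) {W : Finset V} (hW : ¬ Strong r W) :
    ∃ I J : Finset V, I ⊆ W ∧ J ⊆ W ∧ Disjoint I J ∧ I.Nonempty ∧ J.Nonempty ∧
      (∀ a ∈ I, ∀ b ∈ W, b ∉ I → r a b) ∧ (∀ a ∈ J, ∀ b ∈ W, b ∉ J → r b a) ∧
      ∀ g, 2 ≤ g → g ≤ W.card → ∀ w ∈ I, ∀ w' ∈ J, ∃ G ⊆ W, G.card = g ∧ Seg r w w' G := by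
  unfold Strong at hW
  push Not at hW
  obtain ⟨X, hX, hXne, hdom, hXW⟩ := hW
  obtain ⟨I, hI, hIne, hIs, hId⟩ := exists_strong_initial hX hXne hdom
  obtain ⟨J, hJ, hJne, hJs, hJd⟩ := exists_strong_initial (r := flip r) (X := W \ X)
    Finset.sdiff_subset (by
      rw [Finset.sdiff_nonempty]; exact fun h' => hXW (Finset.Subset.antisymm hX h')) (by
      intro a ha b hb hbX
      simp only [Finset.mem_sdiff, not_and, not_not] at ha hbX
      exact hdom b (hbX hb) a ha.1 ha.2)
  have hdis : Disjoint I J := Finset.disjoint_left.2 fun a ha ha' =>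
    (Finset.mem_sdiff.1 (hJ ha')).2 (hI ha)
  have hIW := hI.trans hX
  have hJW := hJ.trans Finset.sdiff_subset
  refine ⟨I, J, hIW, hJW, hdis, hIne, hJne, hId, hJd, ?_⟩
  intro g hg hgW w hw w' hw'
  have hJs' : Strong r J := hJs.flip
  have hc := Finset.card_sdiff_of_subset (Finset.union_subset hIW hJW)
  rw [Finset.card_union_of_disjoint hdis] at hc
  have hle := Finset.card_le_card (Finset.union_subset hIW hJW)
  rw [Finset.card_union_of_disjoint hdis] at hle
  have hIpos := Finset.card_pos.2 hIne
  have hJpos := Finset.card_pos.2 hJne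
  -- The path uses g₁ vertices of `I`, then g₂ vertices outside `I` and `J`, then g₃ vertices of
  -- `J`. Any choice in the middle is allowed, since `I` dominates and `J` is dominated by
  -- everything else in `W`.
  obtain ⟨g₁, g₂, g₃, hg1, hg1', hg2, hg3, hg3', rfl⟩ : ∃ g₁ g₂ g₃, 1 ≤ g₁ ∧ g₁ ≤ I.card ∧
      g₂ ≤ (W \ (I ∪ J)).card ∧ 1 ≤ g₃ ∧ g₃ ≤ J.card ∧ g₁ + g₂ + g₃ = g := by
    rw [hc]
    refine ⟨min I.card (g - 1), min (W.card - (I.card + J.card)) (g - 1 - min I.card (g - 1)),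
      g - min I.card (g - 1) -
        min (W.card - (I.card + J.card)) (g - 1 - min I.card (g - 1)), ?_⟩
    omega
  obtain ⟨b, G₁, hs1, hG1, hc1⟩ := hIs.exists_seg_left hT hw hg1 hg1'
  obtain ⟨a, G₃, hs3, hG3, hc3⟩ := hJs'.exists_seg_right hT hw' hg3 hg3'
  obtain ⟨G₂, hG2, hc2⟩ := Finset.exists_subset_card_eq hg2
  have hbI := hG1 hs1.right_mem
  have haJ := hG3 hs3.left_mem
  have hd13 : Disjoint G₁ G₃ := hdis.mono hG1 hG3
  have hG2' : ∀ u ∈ G₂, u ∈ W ∧ u ∉ I ∧ u ∉ J := fun u hu => by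
    have := hG2 hu
    simpa only [Finset.mem_sdiff, Finset.mem_union, not_or] using this
  have hd12 : Disjoint G₁ G₂ := Finset.disjoint_left.2 fun u hu hu' => (hG2' u hu').2.1 (hG1 hu)
  have hd23 : Disjoint G₂ G₃ := Finset.disjoint_left.2 fun u hu hu' => (hG2' u hu).2.2 (hG3 hu')
  refine ⟨G₁ ∪ G₂ ∪ G₃, ?_, ?_, ?_⟩
  · exact Finset.union_subset (Finset.union_subset (hG1.trans hIW) (hG2.trans
      Finset.sdiff_subset)) (hG3.trans hJW)
  · rw [Finset.card_union_of_disjoint (by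
      rw [Finset.disjoint_union_left]; exact ⟨hd13, hd23⟩), Finset.card_union_of_disjoint hd12,
      hc1, hc2, hc3]
  · rcases G₂.eq_empty_or_nonempty with rfl | hne
    · rw [Finset.union_empty]
      exact hs1.append (hId b hbI a (hJW haJ) (fun h => Finset.disjoint_left.1 hdis h haJ)) hs3
        hd13
    · obtain ⟨c, d, hcd⟩ := exists_seg hT hne
      have hc' := hG2' c hcd.left_mem
      have hd' := hG2' d hcd.right_mem
      exact (hs1.append (hId b hbI c hc'.1 hc'.2.1) hcd hd12).append
        (hJd a haJ d hd'.1 hd'.2.2) hs3 (by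
          rw [Finset.disjoint_union_left]; exact ⟨hd13, hd23⟩)

variable [Fintype V] {δ g : ℕ} {x y : V}
  {S₁ S₂ W : Finset V}

namespace Frame

/-- Each vertex of a cycle of length `g` starts a path round the cycle ending at its predecessor, so
domination by all inner vertices spreads over the whole cycle. -/
theorem Stuck.forall_of_seg {f : Frame r δ x y S₁ S₂ W} (h : f.Stuck g) {W₀ : Finset V}
    (hcyc : W₀ ⊆ W ∧ W₀.card = g ∧ CycOn r W₀) {v w : V} (hv : v ∈ S₁ ∪ S₂) (hw : w ∈ W₀)
    (hvw : r v w) : ∀ u ∈ W₀, ∀ s ∈ S₁ ∪ S₂, r s u := by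
  obtain ⟨h1, h2, h3⟩ := hcyc
  obtain ⟨w', hw', hall⟩ := h.exists_all (W₀ := W₀) (fun u hu => by
    obtain ⟨u', hu'⟩ := h3.exists_back hu
    exact ⟨u', hu'.right_mem, W₀, h1, h2, hu'.1⟩) hv hw hvw
  exact h3.forall_of_back (fun u => ∀ s ∈ S₁ ∪ S₂, r s u)
    (fun u u' hu h' => h.step_all h1 h2 hu.1 h') hw' hall

/-- If some inner vertex v has both out- and in-neighbours in `W`, a cycle of length `g` meeting
both kinds contradicts `Stuck.forall_of_seg`. Otherwise each inner vertex behaves uniformly on `W`,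
and one cycle makes them all dominate `W`. -/
theorem stuck_of_three_le {f : Frame r δ x y S₁ S₂ W} (hW : Strong r W) (hg : 3 ≤ g)
    (hgW : g ≤ W.card) (hplus : ¬ ∀ s ∈ S₁ ∪ S₂, ∀ w ∈ W, r s w)
    (hminus : ¬ ∀ s ∈ S₁ ∪ S₂, ∀ w ∈ W, r w s) : ¬ f.Stuck g := by
  intro h
  have hne : ∀ {s w}, s ∈ S₁ ∪ S₂ → w ∈ W → s ≠ w := by
    rintro s w hs hw rfl
    rcases Finset.mem_union.1 hs with hs | hs
    · exact Finset.disjoint_left.1 f.disj₁ hs hw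
    · exact Finset.disjoint_left.1 f.disj₂ hs hw
  push Not at hplus hminus
  obtain ⟨s₁, hs₁, w₁, hw₁, h₁⟩ := hplus
  obtain ⟨s₂, hs₂, w₂, hw₂, h₂⟩ := hminus
  replace h₂ := f.tour.of_not (hne hs₂ hw₂).symm h₂
  by_cases hcol : ∃ v ∈ S₁ ∪ S₂, TwoColoured (r v) W
  · obtain ⟨v, hv, hcol⟩ := hcol
    obtain ⟨G, hG, hcard, hcyc, ⟨a, ha, hva⟩, b, hb, hvb⟩ := hW.exists_cycOn f.tour _ hcol hg hgW
    exact hvb (h.forall_of_seg ⟨hG, hcard, hcyc⟩ hv ha hva b hb v hv)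
  · have hmono : ∀ v ∈ S₁ ∪ S₂, ∀ w ∈ W, r v w → ∀ w' ∈ W, r v w' := by
      intro v hv w hw hvw w' hw'
      by_contra hcon
      exact hcol ⟨v, hv, ⟨w, hw, hvw⟩, w', hw', hcon⟩
    obtain ⟨w₃, hw₃⟩ : (W.erase w₁).Nonempty := by
      rw [← Finset.card_pos, Finset.card_erase_of_mem hw₁]
      omega
    -- Any cycle of length `g` would do; the colouring only serves to obtain one.
    obtain ⟨G, hG, hcard, hcyc, ⟨a, ha, -⟩, -⟩ := hW.exists_cycOn f.tour (· = w₁)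
      ⟨⟨w₁, hw₁, rfl⟩, w₃, Finset.mem_of_mem_erase hw₃, Finset.ne_of_mem_erase hw₃⟩ hg hgW
    exact h₁ (hmono s₁ hs₁ a (hG ha) (h.forall_of_seg ⟨hG, hcard, hcyc⟩ hs₂ ha
      (hmono s₂ hs₂ w₂ hw₂ h₂ a (hG ha)) a ha s₁ hs₁) w₁ hw₁)

/-- There are no cycles of length two, but the paths with two vertices are the arcs of `W`. Hence
the set of vertices dominated by all inner vertices is closed under out-neighbours, and strength
makes it all of `W`. -/
theorem stuck_two {f : Frame r δ x y S₁ S₂ W} (hW : Strong r W)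
    (hgW : 2 ≤ W.card) (hplus : ¬ ∀ s ∈ S₁ ∪ S₂, ∀ w ∈ W, r s w)
    (hminus : ¬ ∀ s ∈ S₁ ∪ S₂, ∀ w ∈ W, r w s) : ¬ f.Stuck 2 := by
  classical
  intro h
  have hpair : ∀ {a b}, a ∈ W → b ∈ W → r a b → ∃ G ⊆ W, G.card = 2 ∧ Seg r a b G := by
    intro a b ha hb hab
    refine ⟨{a, b}, ?_, Finset.card_pair (f.tour.ne hab),
      Seg.cons hab (by simpa using f.tour.ne hab) (Seg.single b)⟩
    intro u
    simp only [Finset.mem_insert, Finset.mem_singleton]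
    rintro (rfl | rfl) <;> assumption
  push Not at hminus
  obtain ⟨s, hs, w, hw, hsw⟩ := hminus
  have hne : w ≠ s := by
    rintro rfl
    rcases Finset.mem_union.1 hs with hs | hs
    · exact Finset.disjoint_left.1 f.disj₁ hs hw
    · exact Finset.disjoint_left.1 f.disj₂ hs hw
  obtain ⟨u, hu, hall⟩ := h.exists_all (W₀ := W) (fun a ha => by
    obtain ⟨a', ha', b, hb, -, hab⟩ := hW.exists_arc f.tour (X := {a}) (by simpa using ha)
      (by simp) (by rintro rfl; simp at hgW)
    rw [Finset.mem_singleton] at ha'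
    subst ha'
    exact ⟨b, hb, hpair ha hb hab⟩) hs hw (f.tour.of_not hne hsw)
  let X := W.filter fun w => ∀ s ∈ S₁ ∪ S₂, r s w
  have hX : X ≠ W := by
    intro hX
    refine hplus fun s hs w hw => ?_
    rw [← hX] at hw
    exact (Finset.mem_filter.1 hw).2 s hs
  obtain ⟨a, ha, b, hb, hbX, hab⟩ := hW.exists_arc f.tour (X := X) (Finset.filter_subset _ _)
    ⟨u, Finset.mem_filter.2 ⟨hu, hall⟩⟩ hX
  obtain ⟨haW, ha⟩ := Finset.mem_filter.1 ha
  obtain ⟨G, hG, hc, hseg⟩ := hpair haW hb hab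
  exact hbX (Finset.mem_filter.2 ⟨hb, h.step_all hG hc hseg ha⟩)

/-- Otherwise follow the first path up to its last inner vertex but one, then u → u', then the whole
second path: one vertex is dropped and two are gained. -/
theorem Stuck.no_arc {f : Frame r δ x y S₁ S₂ W} (h : f.Stuck 1) (hS : 2 ≤ S₁.card) {u u' : V}
    (hu : u ∈ W) (hu' : u' ∈ W) (h1 : ∀ s ∈ S₁ ∪ S₂, r s u) (h2 : ∀ s ∈ S₁ ∪ S₂, r u' s) :
    ¬ r u u' := by
  intro huu
  obtain ⟨c, L, hcy, hL, hcL, hS₁⟩ := f.conn₁.exists_last f.nonempty₁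
  have hLne : L.Nonempty := by
    rw [hS₁, Finset.card_insert_of_notMem hcL] at hS
    exact Finset.card_pos.1 (by omega)
  obtain ⟨d, M, hdc, hM, hdM, rfl⟩ := hL.exists_last hLne
  obtain ⟨t, R, hxt, hR, htR, hS₂⟩ := f.conn₂.exists_first f.nonempty₂
  have hd₁ := f.disj₁
  have hd₂ := f.disj₂
  have hd := f.disj
  rw [Finset.disjoint_left] at hd₁ hd₂ hd
  have hsub : insert d M ⊆ S₁ := by rw [hS₁]; exact Finset.subset_insert _ _
  have huL : u ∉ insert d M := fun h => hd₁ (hsub h) hu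
  have hu'L : u' ∉ insert d M := fun h => hd₁ (hsub h) hu'
  have hu₂ : u ∉ S₂ := fun h => hd₂ h hu
  have hu'₂ : u' ∉ S₂ := fun h => hd₂ h hu'
  have e1 : Conn r x u (insert d M) := by
    simpa using hM.append (Conn.arc (h1 d (Finset.mem_union_left _ (hsub (by simp))))) hdM
      (by simp) (by simp)
  have e2 : Conn r u' y S₂ := by
    rw [hS₂]
    exact Conn.cons (h2 t (Finset.mem_union_right _ (by simp [hS₂]))) htR hR
  have e3 : Conn r u y (insert u' S₂) := Conn.cons huu hu'₂ e2
  have huu' : u ∉ insert u' S₂ := by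
    simp only [Finset.mem_insert, not_or]
    exact ⟨f.tour.ne huu, hu₂⟩
  have hdis : Disjoint (insert d M) (insert u' S₂) := by
    rw [Finset.disjoint_insert_right]
    exact ⟨hu'L, Finset.disjoint_left.2 fun a ha => hd (hsub ha)⟩
  refine h ⟨_, e1.append e3 huL huu' hdis, ?_, ?_, ?_⟩
  · rw [Finset.card_insert_of_notMem (by
      simp only [Finset.mem_union, not_or]; exact ⟨huL, huu'⟩),
      Finset.card_union_of_disjoint hdis, Finset.card_insert_of_notMem hu'₂,
      hS₁, Finset.card_insert_of_notMem hcL]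
    omega
  · simp only [Finset.mem_insert (s := _ ∪ _), Finset.mem_union, Finset.mem_insert (b := u'),
      not_or]
    exact ⟨fun h => f.x_notMem.2.2 (h ▸ hu), fun h => f.x_notMem.1 (hsub h),
      fun h => f.x_notMem.2.2 (h ▸ hu'), f.x_notMem.2.1⟩
  · simp only [Finset.mem_insert (s := _ ∪ _), Finset.mem_union, Finset.mem_insert (b := u'),
      not_or]
    exact ⟨fun h => f.y_notMem.2.2 (h ▸ hu), fun h => f.y_notMem.1 (hsub h),
      fun h => f.y_notMem.2.2 (h ▸ hu'), f.y_notMem.2.1⟩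

/-- With `g = 1` the path is a single vertex, so `W` splits into the set X dominated by all inner
vertices and the set Y dominating all of them. By `Stuck.no_arc` no arc goes from X to Y, so arcs
leaving X and arcs entering Y involve only x and y. Both sets then have at least 2δ - 3 vertices,
too many for p < 3δ. -/
theorem stuck_one {f : Frame r δ x y S₁ S₂ W} (hplus : ¬ ∀ s ∈ S₁ ∪ S₂, ∀ w ∈ W, r s w)
    (hminus : ¬ ∀ s ∈ S₁ ∪ S₂, ∀ w ∈ W, r w s) : ¬ f.Stuck 1 := by
  classical
  intro h
  have hne : ∀ {s w}, s ∈ S₁ ∪ S₂ → w ∈ W → s ≠ w := by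
    rintro s w hs hw rfl
    rcases Finset.mem_union.1 hs with hs | hs
    · exact Finset.disjoint_left.1 f.disj₁ hs hw
    · exact Finset.disjoint_left.1 f.disj₂ hs hw
  let X := W.filter fun w => ∀ s ∈ S₁ ∪ S₂, r s w
  have hmono : ∀ v ∈ S₁ ∪ S₂, ∀ w ∈ W, r v w → w ∈ X := by
    intro v hv w hw hvw
    obtain ⟨w', hw', hall⟩ := h.exists_all (W₀ := {w}) (fun a ha => by
      rw [Finset.mem_singleton] at ha
      subst ha
      exact ⟨a, by simp, {a}, by simpa using hw, by simp, Seg.single a⟩) hv (by simp) hvw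
    rw [Finset.mem_singleton] at hw'
    subst hw'
    exact Finset.mem_filter.2 ⟨hw, hall⟩
  have hYs : ∀ w ∈ W \ X, ∀ s ∈ S₁ ∪ S₂, r w s := by
    intro w hw s hs
    rw [Finset.mem_sdiff] at hw
    exact f.tour.of_not (hne hs hw.1) (fun h' => hw.2 (hmono s hs w hw.1 h'))
  have hXs : ∀ w ∈ X, ∀ s ∈ S₁ ∪ S₂, r s w := fun w hw => (Finset.mem_filter.1 hw).2
  have hXW : X ⊆ W := Finset.filter_subset _ _
  have hXne : X.Nonempty := by
    push Not at hminus
    obtain ⟨s, hs, w, hw, hsw⟩ := hminus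
    exact ⟨w, hmono s hs w hw (f.tour.of_not (hne hs hw).symm hsw)⟩
  have hYne : (W \ X).Nonempty := by
    rw [Finset.sdiff_nonempty]
    exact fun h' => hplus fun s hs w hw => hXs w (h' hw) s hs
  have hYX : ∀ u ∈ X, ∀ u' ∈ W \ X, ¬ r u u' := by
    intro u hu u' hu'
    rcases (show 2 ≤ S₁.card ∨ 2 ≤ S₂.card by have := f.three_le; omega) with hS | hS
    · exact h.no_arc hS (hXW hu) (Finset.mem_sdiff.1 hu').1 (hXs u hu) (hYs u' hu')
    · refine h.swap.no_arc hS (hXW hu) (Finset.mem_sdiff.1 hu').1 ?_ ?_ <;>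
        rw [Finset.union_comm]
      exacts [hXs u hu, hYs u' hu']
  have c1 := card_ge_of_out f.tour f.out_ge (K := {x, y}) hXne (by
    intro v hv u hvu
    have hs : ∀ s ∈ S₁ ∪ S₂, u ≠ s := by
      rintro s hs rfl
      exact f.tour.asymm hvu (hXs v hv u hs)
    by_cases huX : u ∈ X
    · exact Or.inl huX
    · right
      simp only [Finset.mem_insert, Finset.mem_singleton]
      rcases f.cover u with h | h | h | h | h
      · exact Or.inl h
      · exact Or.inr h
      · exact absurd rfl (hs u (Finset.mem_union_left _ h))
      · exact absurd rfl (hs u (Finset.mem_union_right _ h))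
      · exact absurd hvu (hYX v hv u (Finset.mem_sdiff.2 ⟨h, huX⟩)))
  have c2 := card_ge_of_out f.tour.flip f.in_ge (K := {x, y}) hYne (by
    intro v hv u hvu
    have hs : ∀ s ∈ S₁ ∪ S₂, u ≠ s := by
      rintro s hs rfl
      exact f.tour.asymm hvu (hYs v hv u hs)
    by_cases huX : u ∈ W \ X
    · exact Or.inl huX
    · right
      simp only [Finset.mem_insert, Finset.mem_singleton]
      rcases f.cover u with h | h | h | h | h
      · exact Or.inl h
      · exact Or.inr h
      · exact absurd rfl (hs u (Finset.mem_union_left _ h))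
      · exact absurd rfl (hs u (Finset.mem_union_right _ h))
      · rw [Finset.mem_sdiff, not_and, not_not] at huX
        exact absurd hvu (hYX u (huX h) v hv))
  rw [Finset.card_pair f.ne] at c1 c2
  have h1 := Finset.card_sdiff_add_card_eq_card hXW
  have := f.card_eq
  have := f.order
  have := f.three_le
  have := f.four_le
  omega

/-- An initial component of `W` receives arcs from outside `W`. -/
theorem false_of_no_in (f : Frame r δ x y S₁ S₂ W) {I : Finset V} (hI : I ⊆ W) (hne : I.Nonempty)
    (hId : ∀ a ∈ I, ∀ b ∈ W, b ∉ I → r a b) {u : V}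
    (h : ∀ v ∈ I, ∀ s, r s v → s ∉ S₁ ∪ S₂ ∧ (s = x ∨ s = y → s = u)) : False := by
  have c1 := card_ge_of_out f.tour.flip f.in_ge (K := {u}) hne (by
    intro v hv s hsv
    obtain ⟨h1, h2⟩ := h v hv s hsv
    by_cases hs : s ∈ I
    · exact Or.inl hs
    · right
      rw [Finset.mem_singleton]
      rcases f.cover s with h | h | h | h | h
      · exact h2 (Or.inl h)
      · exact h2 (Or.inr h)
      · exact absurd (Finset.mem_union_left _ h) h1
      · exact absurd (Finset.mem_union_right _ h) h1
      · exact absurd hsv (f.tour.asymm (hId v hv s h hs)))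
  obtain ⟨s, hs⟩ := f.nonempty₁
  -- The count gives |I| ≥ 2δ - 1, whereas all of `I` dominates `s`, whose indegree is at most 2δ -
  -- 2.
  have c2 : I ⊆ outSet (_root_.flip r) s := by
    intro v hv
    rw [mem_outSet]
    refine f.tour.of_not ?_ (fun h' => (h v hv s h').1 (Finset.mem_union_left _ hs))
    rintro rfl
    exact Finset.disjoint_left.1 f.disj₁ hs (hI hv)
  have c3 := Finset.card_le_card c2
  have c4 := f.in_le s
  rw [Finset.card_singleton] at c1
  omega

/-- Cut the first path at its first vertex v with property `O`. No vertex before v has `O`, and no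
vertex after v has `E`; only v itself can be counted twice. -/
theorem Stuck.cards {f : Frame r δ x y S₁ S₂ W} (h : f.Stuck g) {O E : V → Prop}
    (hOE : ∀ v w, O v → E w → ¬ Blocked r W g v w) (hO : ∃ v ∈ S₁, O v) :
    (∀ s ∈ S₂, ¬ E s) ∧ ∃ SO SE : Finset V, (∀ s ∈ S₁, O s → s ∈ SO) ∧
      (∀ s ∈ S₁, E s → s ∈ SE) ∧ SO.card + SE.card ≤ S₁.card + 1 := by
  obtain ⟨v, hv, hOv⟩ := hO
  refine ⟨fun s hs hE => hOE v s hOv hE (h.cross hv hs), ?_⟩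
  obtain ⟨v, L, R, hOv, hLO, hL, hR, hvL, hvR, hd, hS⟩ := f.conn₁.split_first O ⟨v, hv, hOv⟩
  refine ⟨insert v R, insert v L, ?_, ?_, ?_⟩
  · intro s hs hOs
    rw [hS] at hs
    simp only [Finset.mem_insert, Finset.mem_union] at hs ⊢
    rcases hs with hs | hs | hs
    · exact Or.inl hs
    · exact absurd hOs (hLO s hs)
    · exact Or.inr hs
  · intro s hs hEs
    rw [hS] at hs
    simp only [Finset.mem_insert, Finset.mem_union] at hs ⊢
    rcases hs with hs | hs | hs
    · exact Or.inl hs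
    · exact Or.inr hs
    · exact absurd (h.between hL hR hvL hvR hd hS hs) (hOE v s hOv hEs)
  · rw [Finset.card_insert_of_notMem hvL, Finset.card_insert_of_notMem hvR, hS,
      Finset.card_insert_of_notMem (by
        simp only [Finset.mem_union, not_or]; exact ⟨hvL, hvR⟩), Finset.card_union_of_disjoint hd]
    omega

theorem stuck_of_not_strong {f : Frame r δ x y S₁ S₂ W} (hW : ¬ Strong r W) (hg : 2 ≤ g)
    (hgW : g ≤ W.card) : ¬ f.Stuck g := by
  intro h
  obtain ⟨I, J, hI, hJ, hdis, hIne, hJne, hId, hJd, hseg⟩ := exists_seg_of_not_strong f.tour hW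
  -- `O` marks the vertices with an arc into the initial component, `E` those with an arc from the
  -- terminal one. From an `O`-vertex to an `E`-vertex there is always a path with `g` inner
  -- vertices in `W`, so such pairs are never blocked.
  let O : V → Prop := fun v => ∃ w ∈ I, r v w
  let E : V → Prop := fun v => ∃ w ∈ J, r w v
  have hOE : ∀ v w, O v → E w → ¬ Blocked r W g v w := by
    rintro v w ⟨a, ha, hva⟩ ⟨b, hb, hbw⟩ hbl
    obtain ⟨G, hG, hc, hs⟩ := hseg g hg hgW a ha b hb
    exact hbl G hG hc (hs.conn hva hbw)
  have hEy : ¬ E y := by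
    intro hE
    refine f.false_of_no_in hI hIne hId (u := y) fun v hv s hsv => ⟨fun hs => ?_, ?_⟩
    · exact hOE s y ⟨v, hv, hsv⟩ hE (h.to_end hs)
    · rintro (rfl | rfl)
      · exact absurd h.ends (hOE _ _ ⟨v, hv, hsv⟩ hE)
      · rfl
  have hOx : ¬ O x := by
    intro hO
    refine f.flip.false_of_no_in hJ hJne hJd (u := x) fun v hv s hsv => ⟨fun hs => ?_, ?_⟩
    · exact hOE x s hO ⟨v, hv, hsv⟩ (h.from_start hs)
    · rintro (rfl | rfl)
      · exact absurd h.ends (hOE _ _ hO ⟨v, hv, hsv⟩)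
      · rfl
  have hO : ∃ v ∈ S₁ ∪ S₂, O v := by
    by_contra hcon
    push Not at hcon
    refine f.false_of_no_in hI hIne hId (u := y) fun v hv s hsv =>
      ⟨fun hs => hcon s hs ⟨v, hv, hsv⟩, ?_⟩
    rintro (rfl | rfl)
    · exact absurd ⟨v, hv, hsv⟩ hOx
    · rfl
  have hE : ∃ v ∈ S₁ ∪ S₂, E v := by
    by_contra hcon
    push Not at hcon
    refine f.flip.false_of_no_in hJ hJne hJd (u := x) fun v hv s hsv =>
      ⟨fun hs => hcon s hs ⟨v, hv, hsv⟩, ?_⟩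
    rintro (rfl | rfl)
    · exact absurd ⟨v, hv, hsv⟩ hEy
    · rfl
  have key : ∀ {S₁ S₂ : Finset V} {f : Frame r δ x y S₁ S₂ W}, f.Stuck g → (∃ v ∈ S₁, O v) →
      (∃ v ∈ S₁ ∪ S₂, E v) → False := by
    intro S₁ S₂ f h hO hE
    obtain ⟨hE2, SO, SE, hSO, hSE, hc⟩ := h.cards hOE hO
    have hE1 : ∃ v ∈ S₁, E v := by
      obtain ⟨v, hv, hEv⟩ := hE
      rcases Finset.mem_union.1 hv with hv | hv
      · exact ⟨v, hv, hEv⟩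
      · exact absurd hEv (hE2 v hv)
    have hO2 : ∀ s ∈ S₂, ¬ O s := by
      obtain ⟨v, hv, hEv⟩ := hE1
      exact fun s hs hOs => hOE s v hOs hEv (h.swap.cross hs hv)
    have c1 := card_ge_of_out f.tour.flip f.in_ge (K := insert y SO) hIne (by
      intro v hv s hsv
      rw [Finset.mem_insert]
      by_cases hs : s ∈ I
      · exact Or.inl hs
      · right
        rcases f.cover s with h | h | h | h | h
        · exact absurd ⟨v, hv, h ▸ hsv⟩ hOx
        · exact Or.inl h
        · exact Or.inr (hSO s h ⟨v, hv, hsv⟩)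
        · exact absurd ⟨v, hv, hsv⟩ (hO2 s h)
        · exact absurd hsv (f.tour.asymm (hId v hv s h hs)))
    have c2 := card_ge_of_out f.tour f.out_ge (K := insert x SE) hJne (by
      intro v hv s hsv
      rw [Finset.mem_insert]
      by_cases hs : s ∈ J
      · exact Or.inl hs
      · right
        rcases f.cover s with h | h | h | h | h
        · exact Or.inl h
        · exact absurd ⟨v, hv, h ▸ hsv⟩ hEy
        · exact Or.inr (hSE s h ⟨v, hv, hsv⟩)
        · exact absurd ⟨v, hv, hsv⟩ (hE2 s h)
        · exact absurd hsv (f.tour.asymm (hJd v hv s h hs)))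
    have c3 := Finset.card_insert_le y SO
    have c4 := Finset.card_insert_le x SE
    have c5 := Finset.card_le_card (Finset.union_subset hI hJ)
    rw [Finset.card_union_of_disjoint hdis] at c5
    -- Adding the bounds gives |I| + |J| ≥ 4δ - 4 - 2|S₁|, while |W| ≤ 3δ - 3 - |S₁| - |S₂|. Hence δ
    -- ≤ 1 + |S₁| - |S₂| ≤ 3; this is where the lengths of the two paths must be nearly equal.
    have := f.card_eq
    have := f.order
    have := f.le₁
    have := f.four_le
    omega
  obtain ⟨v, hv, hOv⟩ := hO
  rcases Finset.mem_union.1 hv with hv | hv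
  · exact key h ⟨v, hv, hOv⟩ hE
  · refine key h.swap ⟨v, hv, hOv⟩ ?_
    rwa [Finset.union_comm]

/-- Two parallel paths that do not uniformly dominate, and are not uniformly dominated by, the
remaining vertices extend to paths of all larger lengths. -/
theorem hasConn_add (f : Frame r δ x y S₁ S₂ W) (hgW : g ≤ W.card)
    (hplus : ¬ ∀ s ∈ S₁ ∪ S₂, ∀ w ∈ W, r s w) (hminus : ¬ ∀ s ∈ S₁ ∪ S₂, ∀ w ∈ W, r w s) :
    HasConn r x y (S₁.card + S₂.card + g) := by
  by_contra hcon
  have h : f.Stuck g := hcon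
  by_cases hg0 : g = 0
  · subst hg0
    apply h
    have := f.hasConn (Finset.empty_subset W) (by simpa using f.conn₁.merge f.tour f.conn₂ f.disj)
    simpa using this
  by_cases hg1 : g = 1
  · subst hg1
    exact stuck_one hplus hminus h
  by_cases hW : Strong r W
  · by_cases hg2 : g = 2
    · subst hg2
      exact stuck_two hW hgW hplus hminus h
    · exact stuck_of_three_le hW (by omega) hgW hplus hminus h
  · exact stuck_of_not_strong hW (by omega) hgW h

open Classical in
/-- A degree condition under which the inner vertices of two parallel paths do not all dominate
all the remaining vertices. -/
theorem not_forall_dominate (f : Frame r δ x y S₁ S₂ W)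
    (h : (S₁.card + S₂.card) * (S₁.card + S₂.card + 3) < 2 * (S₁.card + S₂.card) * δ +
      2 * (((S₁ ∪ S₂).filter (r · x)).card + ((S₁ ∪ S₂).filter (r · y)).card)) :
    ¬ ∀ s ∈ S₁ ∪ S₂, ∀ w ∈ W, r s w := by
  intro hall
  have hcard := Finset.card_union_of_disjoint f.disj
  set S := S₁ ∪ S₂ with hS
  have hd : Disjoint S W := by
    rw [hS, Finset.disjoint_union_left]
    exact ⟨f.disj₁, f.disj₂⟩
  have hx : x ∉ S ∧ x ∉ W := by
    rw [hS, Finset.mem_union, not_or]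
    exact ⟨⟨f.x_notMem.1, f.x_notMem.2.1⟩, f.x_notMem.2.2⟩
  have hy : y ∉ S ∧ y ∉ W := by
    rw [hS, Finset.mem_union, not_or]
    exact ⟨⟨f.y_notMem.1, f.y_notMem.2.1⟩, f.y_notMem.2.2⟩
  -- An inner vertex has outdegree at most p - 1 - δ, and `W` uses up |W| of it; so at most |S| + 1
  -- - δ out-neighbours lie in S ∪ {x, y}. Summing over S, where the inner arcs number |S|(|S| -
  -- 1)/2, contradicts the hypothesis.
  have h1 : ∀ s ∈ S, (S.filter (r s)).card * 2 + 2 * (if r s x then 1 else 0) +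
      2 * (if r s y then 1 else 0) ≤ 2 * (Fintype.card V - 1 - δ - W.card) := by
    intro s hs
    have hsub : W ∪ S.filter (r s) ∪ (({x, y} : Finset V).filter (r s)) ⊆ outSet r s := by
      intro u hu
      rw [mem_outSet]
      simp only [Finset.mem_union, Finset.mem_filter] at hu
      rcases hu with (hu | hu) | hu
      · exact hall s hs u hu
      · exact hu.2
      · exact hu.2
    have h2 := Finset.card_le_card hsub
    rw [Finset.card_union_of_disjoint, Finset.card_union_of_disjoint] at h2
    · have h3 : (({x, y} : Finset V).filter (r s)).card =
          (if r s x then 1 else 0) + (if r s y then 1 else 0) := by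
        rw [Finset.card_filter, Finset.sum_pair f.ne]
      have h4 := card_outSet_add f.tour s
      have h5 := f.in_ge s
      omega
    · exact hd.symm.mono_right (Finset.filter_subset _ _)
    · rw [Finset.disjoint_left]
      intro u hu hu'
      simp only [Finset.mem_union, Finset.mem_filter, Finset.mem_insert,
        Finset.mem_singleton] at hu hu'
      rcases hu'.1 with rfl | rfl <;> tauto
  have h2 := Finset.sum_le_sum h1
  rw [Finset.sum_add_distrib, Finset.sum_add_distrib, sum_card_filter f.tour, ← Finset.mul_sum,
    ← Finset.mul_sum, ← Finset.card_filter, ← Finset.card_filter, Finset.sum_const, smul_eq_mul]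
    at h2
  have hc := f.card_eq
  have h3 := f.three_le
  rw [← hcard] at h hc h3
  obtain ⟨s₀, hs₀⟩ := f.nonempty₁
  have hb := card_outSet_add f.tour s₀
  have hi := f.in_ge s₀
  have hle : δ + W.card + 1 ≤ Fintype.card V := by
    have : W ⊆ outSet r s₀ := fun w hw => by
      rw [mem_outSet]
      exact hall s₀ (by rw [hS]; exact Finset.mem_union_left _ hs₀) w hw
    have := Finset.card_le_card this
    omega
  obtain ⟨d, hd'⟩ := Nat.exists_eq_add_of_le hle
  have e1 : Fintype.card V - 1 - δ - W.card = d := by omega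
  have e2 : S.card + 1 = δ + d := by omega
  rw [e1] at h2
  obtain ⟨n, hn⟩ : ∃ n, S.card = n + 1 := ⟨S.card - 1, by omega⟩
  rw [hn] at h h2 e2
  simp only [Nat.add_sub_cancel] at h2
  nlinarith

end Frame

end Extension

/-! ### Starting pairs of paths and the sorting of vertices relative to x and y -/

section Pairs

variable {V : Type*} {r : V → V → Prop}

section

variable [Fintype V] {δ : ℕ}

/-- A tournament of order less than `3 * δ` whose semidegrees are at least `δ`. -/
structure Dense (r : V → V → Prop) (δ : ℕ) : Prop where
  tour : IsTour r
  four_le : 4 ≤ δ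
  order : Fintype.card V + 1 ≤ 3 * δ
  out_ge : ∀ v, δ ≤ (outSet r v).card
  in_ge : ∀ v, δ ≤ (outSet (flip r) v).card

end

variable [DecidableEq V]

theorem conn_of_isChain {x y : V} {l : List V} (h : (x :: (l ++ [y])).IsChain r) (hl : l.Nodup) :
    Conn r x y l.toFinset := by
  induction l generalizing x with
  | nil =>
    simp only [List.nil_append, List.isChain_cons_cons, List.isChain_singleton, and_true] at h
    exact Conn.arc h
  | cons a l ih =>
    rw [List.nodup_cons] at hl
    simp only [List.cons_append, List.isChain_cons_cons] at h
    rw [List.toFinset_cons]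
    exact Conn.cons h.1 (by simpa using hl.1) (ih h.2 hl.2)

theorem hasConn_of_isChain {x y : V} (l : List V) (h : (x :: (l ++ [y])).IsChain r)
    (hl : (x :: y :: l).Nodup) : HasConn r x y l.length := by
  simp only [List.nodup_cons, List.mem_cons, not_or] at hl
  exact ⟨l.toFinset, conn_of_isChain h hl.2.2, List.toFinset_card_of_nodup hl.2.2,
    by simpa using hl.1.2, by simpa using hl.2.1⟩

variable [Fintype V] {δ : ℕ} {x y : V}

theorem Dense.frame (h : Dense r δ) {l₁ l₂ : List V} (h₁ : (x :: (l₁ ++ [y])).IsChain r)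
    (h₂ : (x :: (l₂ ++ [y])).IsChain r) (hn : (x :: y :: (l₁ ++ l₂)).Nodup) (hl₁ : 1 ≤ l₁.length)
    (hl₂ : 1 ≤ l₂.length) (h3 : 3 ≤ l₁.length + l₂.length) (hle₁ : l₁.length ≤ l₂.length + 2)
    (hle₂ : l₂.length ≤ l₁.length + 2) :
    l₁.toFinset.card = l₁.length ∧ l₂.toFinset.card = l₂.length ∧
      ∃ W, Frame r δ x y l₁.toFinset l₂.toFinset W := by
  simp only [List.nodup_cons, List.mem_cons, not_or, List.mem_append, List.nodup_append] at hn
  obtain ⟨⟨hxy, hx₁, hx₂⟩, ⟨hy₁, hy₂⟩, hn₁, hn₂, hd⟩ := hn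
  have c₁ := List.toFinset_card_of_nodup hn₁
  have c₂ := List.toFinset_card_of_nodup hn₂
  refine ⟨c₁, c₂, Finset.univ \ (insert x (insert y (l₁.toFinset ∪ l₂.toFinset))), ?_⟩
  exact
    { h with
      ne := hxy
      conn₁ := conn_of_isChain h₁ hn₁
      conn₂ := conn_of_isChain h₂ hn₂
      nonempty₁ := Finset.card_pos.1 (by omega)
      nonempty₂ := Finset.card_pos.1 (by omega)
      disj := by
        rw [Finset.disjoint_left]
        intro a ha hb
        rw [List.mem_toFinset] at ha hb
        exact hd a ha a hb rfl
      disj₁ := by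
        rw [Finset.disjoint_left]
        intro a ha hb
        simp only [Finset.mem_sdiff, Finset.mem_insert, Finset.mem_union, not_or] at hb
        exact hb.2.2.2.1 ha
      disj₂ := by
        rw [Finset.disjoint_left]
        intro a ha hb
        simp only [Finset.mem_sdiff, Finset.mem_insert, Finset.mem_union, not_or] at hb
        exact hb.2.2.2.2 ha
      cover := fun v => by
        simp only [Finset.mem_sdiff, Finset.mem_univ, true_and, Finset.mem_insert,
          Finset.mem_union]
        tauto
      x_notMem := by simp [hx₁, hx₂]
      y_notMem := by simp [hy₁, hy₂]
      three_le := by omega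
      le₁ := by omega
      le₂ := by omega }

theorem Frame.forall_hasConn {S₁ S₂ W : Finset V} (f : Frame r δ x y S₁ S₂ W)
    (hplus : ¬ ∀ s ∈ S₁ ∪ S₂, ∀ w ∈ W, r s w) (hminus : ¬ ∀ s ∈ S₁ ∪ S₂, ∀ w ∈ W, r w s) {n : ℕ}
    (hn : S₁.card + S₂.card ≤ n) (hnV : n + 2 ≤ Fintype.card V) : HasConn r x y n := by
  obtain ⟨g, rfl⟩ := Nat.exists_eq_add_of_le hn
  exact f.hasConn_add (by have := f.card_eq; omega) hplus hminus

/-- With n ≤ 5 inner vertices and δ ≥ 4, one arc from an inner vertex to `y` is enough: n(n + 3) <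
8n + 2. -/
theorem Frame.not_forall_of_le_five {S₁ S₂ W : Finset V} (f : Frame r δ x y S₁ S₂ W)
    (h : S₁.card + S₂.card ≤ 5) : ¬ ∀ s ∈ S₁ ∪ S₂, ∀ w ∈ W, r s w := by
  classical
  refine f.not_forall_dominate ?_
  obtain ⟨c, L, hcy, -, -, hS₁⟩ := f.conn₁.exists_last f.nonempty₁
  have h1 : 0 < ((S₁ ∪ S₂).filter (r · y)).card :=
    Finset.card_pos.2 ⟨c, Finset.mem_filter.2 ⟨Finset.mem_union_left _ (by simp [hS₁]), hcy⟩⟩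
  have h3 := f.three_le
  have h4 := f.four_le
  generalize S₁.card + S₂.card = n at *
  interval_cases n <;> omega

theorem Dense.hasConn_of_pair (h : Dense r δ) (l₁ l₂ : List V)
    (h₁ : (x :: (l₁ ++ [y])).IsChain r)
    (h₂ : (x :: (l₂ ++ [y])).IsChain r) (hn : (x :: y :: (l₁ ++ l₂)).Nodup) (hl₁ : 1 ≤ l₁.length)
    (hl₂ : 1 ≤ l₂.length) (h3 : 3 ≤ l₁.length + l₂.length) (hle₁ : l₁.length ≤ l₂.length + 2)
    (hle₂ : l₂.length ≤ l₁.length + 2) (h5 : l₁.length + l₂.length ≤ 5) {n : ℕ}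
    (hln : l₁.length + l₂.length ≤ n) (hnV : n + 2 ≤ Fintype.card V) : HasConn r x y n := by
  obtain ⟨c₁, c₂, W, f⟩ := h.frame h₁ h₂ hn hl₁ hl₂ h3 hle₁ hle₂
  exact f.forall_hasConn (f.not_forall_of_le_five (by omega))
    (f.flip.not_forall_of_le_five (by omega)) (by omega) hnV

open Classical in
/-- The vertices other than `x` and `y` sorted by whether they are dominated by `x` and whether
they dominate `y`. -/
noncomputable def part (r : V → V → Prop) (x y : V) (p q : Prop) : Finset V :=
  Finset.univ.filter fun v => v ≠ x ∧ v ≠ y ∧ (r x v ↔ p) ∧ (r v y ↔ q)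

theorem mem_part {p q : Prop} {v : V} :
    v ∈ part r x y p q ↔ v ≠ x ∧ v ≠ y ∧ (r x v ↔ p) ∧ (r v y ↔ q) := by simp [part]

theorem part_flip {p q : Prop} : part (flip r) y x p q = part r x y q p := by
  ext v
  simp only [mem_part, flip]
  tauto

theorem card_part (hxy : x ≠ y) :
    (part r x y True True).card + (part r x y True False).card + (part r x y False True).card +
      (part r x y False False).card + 2 = Fintype.card V := by
  classical
  have h : (Finset.univ : Finset V) = insert x (insert y (part r x y True True ∪
      part r x y True False ∪ part r x y False True ∪ part r x y False False)) := by
    ext v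
    simp only [Finset.mem_univ, Finset.mem_insert, Finset.mem_union, mem_part, true_iff]
    tauto
  rw [← Finset.card_univ, h, Finset.card_insert_of_notMem, Finset.card_insert_of_notMem,
    Finset.card_union_of_disjoint, Finset.card_union_of_disjoint, Finset.card_union_of_disjoint]
  · rw [Finset.disjoint_left]; intro v; simp only [mem_part]; tauto
  · rw [Finset.disjoint_left]; intro v; simp only [Finset.mem_union, mem_part]; tauto
  · rw [Finset.disjoint_left]; intro v; simp only [Finset.mem_union, mem_part]; tauto
  · simp only [Finset.mem_union, mem_part]; tauto
  · simp only [Finset.mem_insert, Finset.mem_union, mem_part]; tauto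

theorem card_part_out (hT : IsTour r) (x y : V) :
    (outSet r x).card ≤ (part r x y True True).card + (part r x y True False).card + 1 := by
  classical
  have h : outSet r x ⊆ insert y (part r x y True True ∪ part r x y True False) := by
    intro v hv
    rw [mem_outSet] at hv
    have := hT.ne hv
    simp only [Finset.mem_insert, Finset.mem_union, mem_part]
    by_cases h : r v y <;> by_cases h' : v = y <;> simp [*, this.symm]
  have h1 := Finset.card_le_card h
  have h2 := Finset.card_insert_le y (part r x y True True ∪ part r x y True False)
  have h3 := Finset.card_union_le (part r x y True True) (part r x y True False)
  omega

theorem card_part_in (hT : IsTour r) (x y : V) :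
    (outSet (flip r) y).card ≤
      (part r x y True True).card + (part r x y False True).card + 1 := by
  have := card_part_out hT.flip y x
  rwa [part_flip, part_flip] at this

open Classical in
/-- Counting paths of length two from `P` to `Q` by their middle vertices. -/
theorem card_through (hT : IsTour r) (ho : ∀ v, δ ≤ (outSet r v).card)
    (hi : ∀ v, δ ≤ (outSet (flip r) v).card) {P Q M K K' : Finset V} (hP : P.Nonempty)
    (hQ : Q.Nonempty) (h1 : ∀ a ∈ P, ∀ u, r a u → u ∈ P ∨ u ∈ K ∨ u ∈ M)
    (h2 : ∀ b ∈ Q, ∀ u, r u b → u ∈ Q ∨ u ∈ K' ∨ u ∈ M) :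
    ∃ N : Finset V, (∀ c ∈ N, c ∈ M ∧ (∃ a ∈ P, r a c) ∧ ∃ b ∈ Q, r c b) ∧
      4 * δ + 2 ≤ P.card + Q.card + 2 * K.card + 2 * K'.card + 2 * M.card + 2 * N.card := by
  refine ⟨M.filter fun c => (∃ a ∈ P, r a c) ∧ ∃ b ∈ Q, r c b, fun c hc =>
    Finset.mem_filter.1 hc, ?_⟩
  -- `P` is bounded below through the part of `M` that it reaches, and `Q` through the part of `M`
  -- from which it is reached. The two parts overlap exactly in the set of middle vertices.
  have e1 := card_ge_of_out hT ho (K := K ∪ M.filter fun c => ∃ a ∈ P, r a c) hP (by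
    intro a ha u hu
    have := h1 a ha u hu
    simp only [Finset.mem_union, Finset.mem_filter]
    exact this.imp id (Or.imp id fun h => ⟨h, a, ha, hu⟩))
  have e2 := card_ge_of_out hT.flip hi (K := K' ∪ M.filter fun c => ∃ b ∈ Q, r c b) hQ (by
    intro a ha u hu
    have := h2 a ha u hu
    simp only [Finset.mem_union, Finset.mem_filter]
    exact this.imp id (Or.imp id fun h => ⟨h, a, ha, hu⟩))
  have e3 := Finset.card_union_le K (M.filter fun c => ∃ a ∈ P, r a c)
  have e4 := Finset.card_union_le K' (M.filter fun c => ∃ b ∈ Q, r c b)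
  have e5 := Finset.card_union_add_card_inter (M.filter fun c => ∃ a ∈ P, r a c)
    (M.filter fun c => ∃ b ∈ Q, r c b)
  rw [← Finset.filter_and] at e5
  have e6 := Finset.card_le_card (Finset.union_subset
    (Finset.filter_subset (fun c => ∃ a ∈ P, r a c) M)
    (Finset.filter_subset (fun c => ∃ b ∈ Q, r c b) M))
  omega

end Pairs

/-! ### Paths of all lengths at least four -/

section Panconnected

theorem nodup_of_sorted {V : Type*} {P Q : V → Prop} {x y a c b a' c' b' : V} (hxy : x ≠ y)
    (ha : a ≠ x ∧ a ≠ y ∧ P a ∧ ¬ Q a) (hc : c ≠ x ∧ c ≠ y ∧ ¬ P c ∧ ¬ Q c)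
    (hb : b ≠ x ∧ b ≠ y ∧ ¬ P b ∧ Q b) (ha' : a' ≠ x ∧ a' ≠ y ∧ P a' ∧ ¬ Q a')
    (hc' : c' ≠ x ∧ c' ≠ y ∧ ¬ P c' ∧ ¬ Q c') (hb' : b' ≠ x ∧ b' ≠ y ∧ ¬ P b' ∧ Q b')
    (haa : a ≠ a') (hcc : c ≠ c') (hbb : b ≠ b') :
    (x :: y :: [a, c, b, a', c', b']).Nodup := by
  simp only [List.nodup_cons, List.mem_cons, List.not_mem_nil, or_false, not_or,
    not_false_eq_true, List.nodup_nil, and_true]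
  refine ⟨⟨?_, ?_, ?_, ?_, ?_, ?_, ?_⟩, ⟨?_, ?_, ?_, ?_, ?_, ?_⟩, ⟨?_, ?_, ?_, ?_, ?_⟩,
    ⟨?_, ?_, ?_, ?_⟩, ⟨?_, ?_, ?_⟩, ⟨?_, ?_⟩, ?_⟩ <;> grind

variable {V : Type*} [DecidableEq V] {r : V → V → Prop} [Fintype V] {δ : ℕ} {x y : V}

/-- A vertex on a path of length two together with a disjoint path of length three. -/
theorem Dense.hasConn_of_arc (h : Dense r δ) (hxy : x ≠ y) {z a b : V} (hxz : r x z)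
    (hzy : r z y) (hxa : r x a) (hab : r a b) (hby : r b y) (haz : a ≠ z) (hbz : b ≠ z)
    (hay : a ≠ y) (hbx : b ≠ x) {n : ℕ} (hn : 3 ≤ n) (hnV : n + 2 ≤ Fintype.card V) :
    HasConn r x y n := by
  have := h.tour.ne hxz
  have := h.tour.ne hzy
  have := h.tour.ne hxa
  have := h.tour.ne hab
  have := h.tour.ne hby
  exact h.hasConn_of_pair [z] [a, b] (by simp [*]) (by simp [*]) (by simp; grind) (by simp)
    (by simp) (by simp) (by simp) (by simp) (by simp) hn hnV

theorem Dense.hasConn_of_through (h : Dense r δ) (hxy : x ≠ y) {z a c b : V} (hxz : r x z)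
    (hzy : r z y) (hxa : r x a) (hac : r a c) (hcb : r c b) (hby : r b y) (haz : a ≠ z)
    (hcz : c ≠ z) (hbz : b ≠ z) (hay : a ≠ y) (hbx : b ≠ x) (hcx : c ≠ x) (hcy : c ≠ y)
    {n : ℕ} (hn : 3 ≤ n) (hnV : n + 2 ≤ Fintype.card V) : HasConn r x y n := by
  have := h.tour.ne hxz
  have := h.tour.ne hzy
  have := h.tour.ne hxa
  have := h.tour.ne hac
  have := h.tour.ne hcb
  have := h.tour.ne hby
  have : a ≠ b := by
    rintro rfl
    exact h.tour.asymm hac hcb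
  rcases hn.eq_or_lt with rfl | hn
  · exact hasConn_of_isChain [a, c, b] (by simp [*]) (by simp; grind)
  · exact h.hasConn_of_pair [z] [a, c, b] (by simp [*]) (by simp [*]) (by simp; grind) (by simp)
      (by simp) (by simp) (by simp) (by simp) (by simp) hn hnV

/-- A path of length 2 through z is paired with a disjoint path of length 3 or 4. If there is no
such path of length 3, at most two vertices lie on paths of length 2, and counting arcs from A
through C to B produces a path of length 4. -/
theorem Dense.hasConn_of_mid (h : Dense r δ) (hxy : x ≠ y)
    (hZ : (part r x y True True).Nonempty) {n : ℕ} (hn : 3 ≤ n) (hnV : n + 2 ≤ Fintype.card V) :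
    HasConn r x y n := by
  classical
  by_contra hcon
  have F1 : ∀ z ∈ part r x y True True, ∀ a b, r x a → r a b → r b y → a ≠ z → b ≠ z → a ≠ y →
      b ≠ x → False := by
    intro z hz a b h1 h2 h3 h4 h5 h6 h7
    simp only [mem_part, iff_true] at hz
    exact hcon (h.hasConn_of_arc hxy hz.2.2.1 hz.2.2.2 h1 h2 h3 h4 h5 h6 h7 hn hnV)
  have hA := card_part_out h.tour x y
  have hB := card_part_in h.tour x y
  have hcard := card_part (r := r) hxy
  have hox := h.out_ge x
  have hiy := h.in_ge y
  have h4 := h.four_le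
  have hord := h.order
  have hZ2 : (part r x y True True).card ≤ 2 := by
    by_contra hZ3
    obtain ⟨z₁, z₂, z₃, h1, h2, h3, h12, h13, h23⟩ := Finset.two_lt_card_iff.1 (not_le.1 hZ3)
    have m1 := h1
    have m2 := h2
    simp only [mem_part, iff_true] at m1 m2
    rcases h.tour.total h12 with h' | h'
    · exact F1 z₃ h3 z₁ z₂ m1.2.2.1 h' m2.2.2.2 h13 h23 m1.2.1 m2.1
    · exact F1 z₃ h3 z₂ z₁ m2.2.2.1 h' m1.2.2.2 h23 h13 m2.2.1 m1.1
  have hZpos := Finset.card_pos.2 hZ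
  set Z := part r x y True True with hZdef
  set A := part r x y True False with hAdef
  set B := part r x y False True with hBdef
  set C := part r x y False False with hCdef
  obtain ⟨z, hz⟩ := hZ
  have mz := hz
  simp only [hZdef, mem_part, iff_true] at mz
  -- With two middle vertices, an arc joining A or B to one of them in the right direction gives a
  -- path of length 3 that avoids the other. Only a single middle vertex has to be admitted as an
  -- exception in the count.
  let K : Finset V := if Z.card = 1 then {z} else ∅
  have hK : ∀ u ∈ Z, u ∈ K ∨ ∃ u' ∈ Z, u' ≠ u := by
    intro u hu
    by_cases h1 : Z.card = 1
    · left
      simp only [K, h1, if_true, Finset.mem_singleton]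
      exact Finset.card_le_one.1 h1.le u hu z hz
    · right
      obtain ⟨u', hu', hne⟩ := Finset.exists_mem_ne (show 1 < Z.card by omega) u
      exact ⟨u', hu', hne⟩
  have hKc : K.card + Z.card = 2 := by
    by_cases h1 : Z.card = 1
    · simp [K, h1]
    · simp only [K, h1, if_false, Finset.card_empty]
      omega
  have hdich : ∀ u, u = x ∨ u = y ∨ u ∈ Z ∨ u ∈ A ∨ u ∈ B ∨ u ∈ C := by
    intro u
    simp only [hZdef, hAdef, hBdef, hCdef, mem_part]
    tauto
  obtain ⟨N, hN, hthrough⟩ := card_through h.tour h.out_ge h.in_ge (P := A) (Q := B) (M := C)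
    (K := K)
    (K' := K) (Finset.card_pos.1 (by omega)) (Finset.card_pos.1 (by omega)) (by
      intro a ha u hau
      simp only [hAdef, mem_part, iff_true, iff_false] at ha
      rcases hdich u with rfl | rfl | hu | hu | hu | hu
      · exact absurd hau (h.tour.asymm ha.2.2.1)
      · exact absurd hau ha.2.2.2
      · rcases hK u hu with hu' | ⟨u', hu', hne⟩
        · exact Or.inr (Or.inl hu')
        · have mu := hu
          have mu' := hu'
          simp only [hZdef, mem_part, iff_true] at mu mu'
          exact (F1 u' hu' a u ha.2.2.1 hau mu.2.2.2 (by rintro rfl; exact ha.2.2.2 mu'.2.2.2)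
            hne.symm ha.2.1 mu.1).elim
      · exact Or.inl hu
      · simp only [hBdef, mem_part, iff_true, iff_false] at hu
        exact (F1 z hz a u ha.2.2.1 hau hu.2.2.2 (by rintro rfl; exact ha.2.2.2 mz.2.2.2)
          (by rintro rfl; exact hu.2.2.1 mz.2.2.1) ha.2.1 hu.1).elim
      · exact Or.inr (Or.inr hu)) (by
      intro b hb u hub
      simp only [hBdef, mem_part, iff_true, iff_false] at hb
      rcases hdich u with rfl | rfl | hu | hu | hu | hu
      · exact absurd hub hb.2.2.1
      · exact absurd hub (h.tour.asymm hb.2.2.2)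
      · rcases hK u hu with hu' | ⟨u', hu', hne⟩
        · exact Or.inr (Or.inl hu')
        · have mu := hu
          have mu' := hu'
          simp only [hZdef, mem_part, iff_true] at mu mu'
          exact (F1 u' hu' u b mu.2.2.1 hub hb.2.2.2 hne.symm
            (by rintro rfl; exact hb.2.2.1 mu'.2.2.1) mu.2.1 hb.1).elim
      · simp only [hAdef, mem_part, iff_true, iff_false] at hu
        exact (F1 z hz u b hu.2.2.1 hub hb.2.2.2 (by rintro rfl; exact hu.2.2.2 mz.2.2.2)
          (by rintro rfl; exact hb.2.2.1 mz.2.2.1) hu.2.1 hb.1).elim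
      · exact Or.inl hu
      · exact Or.inr (Or.inr hu))
  have hempty : N = ∅ := by
    rw [Finset.eq_empty_iff_forall_notMem]
    intro c hc
    obtain ⟨hc, ⟨a, ha, hac⟩, b, hb, hcb⟩ := hN c hc
    simp only [hAdef, hBdef, hCdef, mem_part, iff_true, iff_false] at ha hb hc
    exact hcon (h.hasConn_of_through hxy mz.2.2.1 mz.2.2.2 ha.2.2.1 hac hcb hb.2.2.2
      (by rintro rfl; exact ha.2.2.2 mz.2.2.2) (by rintro rfl; exact hc.2.2.2 mz.2.2.2)
      (by rintro rfl; exact hb.2.2.1 mz.2.2.1) ha.2.1 hb.1 hc.1 hc.2.1 hn hnV)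
  rw [hempty, Finset.card_empty] at hthrough
  omega

/-- Two disjoint paths of length three. -/
theorem Dense.hasConn_of_two_arcs (h : Dense r δ) (hxy : x ≠ y) {a b a' b' : V} (hxa : r x a)
    (hab : r a b) (hby : r b y) (hxa' : r x a') (hab' : r a' b') (hby' : r b' y) (haa : a ≠ a')
    (hba : a ≠ b') (hba' : a' ≠ b) (hbb : b ≠ b') (hay : a ≠ y) (hay' : a' ≠ y)
    (hbx : b ≠ x) (hbx' : b' ≠ x) {n : ℕ} (hn : 3 ≤ n)
    (hnV : n + 2 ≤ Fintype.card V) : HasConn r x y n := by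
  have := h.tour.ne hxa
  have := h.tour.ne hab
  have := h.tour.ne hby
  have := h.tour.ne hxa'
  have := h.tour.ne hab'
  have := h.tour.ne hby'
  rcases hn.eq_or_lt with rfl | hn
  · rcases h.tour.total haa with h' | h'
    · exact hasConn_of_isChain [a, a', b'] (by simp [*]) (by simp; grind)
    · exact hasConn_of_isChain [a', a, b] (by simp [*]) (by simp; grind)
  · exact h.hasConn_of_pair [a, b] [a', b'] (by simp [*]) (by simp [*]) (by simp; grind) (by simp)
      (by simp) (by simp) (by simp) (by simp) (by simp) hn hnV

/-- Disjoint paths of lengths three and four. -/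
theorem Dense.hasConn_of_arc_through (h : Dense r δ) {a₀ b₀ a c b : V} (hxa₀ : r x a₀)
    (hab₀ : r a₀ b₀) (hby₀ : r b₀ y) (hxa : r x a) (hac : r a c) (hcb : r c b) (hby : r b y)
    (hn : (x :: y :: [a₀, b₀, a, c, b]).Nodup) {n : ℕ} (hn3 : 3 ≤ n)
    (hnV : n + 2 ≤ Fintype.card V) : HasConn r x y n := by
  have hne := hn
  simp only [List.nodup_cons, List.mem_cons, List.not_mem_nil, or_false, not_or] at hne
  rcases hn3.eq_or_lt with rfl | hn4
  · exact hasConn_of_isChain [a, c, b] (by simp [*]) (by simp; grind)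
  rcases (Nat.succ_le_of_lt hn4).eq_or_lt with rfl | hn5
  · by_contra hcon
    have hT := h.tour
    have e1 : r a a₀ := hT.of_not (by grind) fun h' =>
      hcon (hasConn_of_isChain [a₀, a, c, b] (by simp [*]) (by simp; grind))
    have e2 : r c a₀ := hT.of_not (by grind) fun h' =>
      hcon (hasConn_of_isChain [a, a₀, c, b] (by simp [*]) (by simp; grind))
    have e3 : r b a₀ := hT.of_not (by grind) fun h' =>
      hcon (hasConn_of_isChain [a, c, a₀, b] (by simp [*]) (by simp; grind))
    have e4 : r b₀ b := hT.of_not (by grind) fun h' =>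
      hcon (hasConn_of_isChain [a, c, b, b₀] (by simp [*]) (by simp; grind))
    exact hcon (hasConn_of_isChain [a, a₀, b₀, b] (by simp [*]) (by simp; grind))
  · exact h.hasConn_of_pair [a₀, b₀] [a, c, b] (by simp [*]) (by simp [*]) hn (by simp)
      (by simp) (by simp) (by simp) (by simp) (by simp) hn5 hnV

/-- Two disjoint paths of length four with an arc between their middle vertices. -/
theorem Dense.hasConn_of_two_through (h : Dense r δ) {a c b a' c' b' : V} (hxa : r x a)
    (hac : r a c) (hcb : r c b) (hby : r b y) (hxa' : r x a') (hac' : r a' c') (hcb' : r c' b')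
    (hby' : r b' y) (hcx : r c x) (hcx' : r c' x) (hyc : r y c) (hyc' : r y c') (hcc : r c c')
    (hn : (x :: y :: [a, c, b, a', c', b']).Nodup) {n : ℕ} (hn3 : 3 ≤ n)
    (hnV : n + 2 ≤ Fintype.card V) : HasConn r x y n := by
  classical
  have hne := hn
  simp only [List.nodup_cons, List.mem_cons, List.not_mem_nil, or_false, not_or] at hne
  rcases hn3.eq_or_lt with rfl | hn4
  · exact hasConn_of_isChain [a, c, b] (by simp [*]) (by simp; grind)
  rcases (Nat.succ_le_of_lt hn4).eq_or_lt with rfl | hn5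
  · exact hasConn_of_isChain [a, c, c', b'] (by simp [*]) (by simp; grind)
  rcases (Nat.succ_le_of_lt hn5).eq_or_lt with rfl | hn6
  -- For n = 5: if `a'` fits neither before `a` nor between `a` and `c`, then a → a' and c → a', and
  -- a, c, a', c', b' is a path.
  · by_contra hcon
    have hT := h.tour
    have e1 : r a a' := hT.of_not (by grind) fun h' =>
      hcon (hasConn_of_isChain [a', a, c, c', b'] (by simp [*]) (by simp; grind))
    have e2 : r c a' := hT.of_not (by grind) fun h' =>
      hcon (hasConn_of_isChain [a, a', c, c', b'] (by simp [*]) (by simp; grind))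
    exact hcon (hasConn_of_isChain [a, c, a', c', b'] (by simp [*]) (by simp; grind))
  · obtain ⟨c₁, c₂, W, f⟩ := h.frame (l₁ := [a, c, b]) (l₂ := [a', c', b']) (by simp [*])
      (by simp [*]) hn (by simp) (by simp) (by simp) (by simp) (by simp)
    have h4 := h.four_le
    have hc2 : ∀ {s t : V} {P : V → Prop} [DecidablePred P], P s → P t → s ≠ t →
        s ∈ [a, c, b].toFinset ∪ [a', c', b'].toFinset →
        t ∈ [a, c, b].toFinset ∪ [a', c', b'].toFinset →
        2 ≤ (([a, c, b].toFinset ∪ [a', c', b'].toFinset).filter P).card := by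
      intro s t P _ hs ht hst hs' ht'
      rw [← Finset.card_pair hst]
      apply Finset.card_le_card
      intro u hu
      rw [Finset.mem_insert, Finset.mem_singleton] at hu
      rcases hu with rfl | rfl <;> exact Finset.mem_filter.2 ⟨‹_›, ‹_›⟩
    -- Six inner vertices require 54 < 12δ + 2q, where q counts their arcs to x and y (from x and y
    -- in the reversed case). For δ = 4 this means q ≥ 4, which the arcs at the middle vertices
    -- supply.
    refine f.forall_hasConn (f.not_forall_dominate ?_) (f.flip.not_forall_dominate ?_)
      (by rw [c₁, c₂]; exact hn6) hnV
    · rw [c₁, c₂]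
      have g1 := hc2 (P := fun s => r s x) hcx hcx' (by grind) (by simp) (by simp)
      have g2 := hc2 (P := fun s => r s y) hby hby' (by grind) (by simp) (by simp)
      simp only [List.length_cons, List.length_nil]
      omega
    · rw [c₁, c₂]
      have g1 := hc2 (P := fun s => _root_.flip r s y) hyc hyc' (by grind) (by simp) (by simp)
      have g2 := hc2 (P := fun s => _root_.flip r s x) hxa hxa' (by grind) (by simp) (by simp)
      simp only [List.length_cons, List.length_nil]
      omega

/-- Two disjoint arcs from A to B give two paths of length 3. If such arcs exist but all share an
end, one of them is combined with a path from A through C to B. If there are none, two disjoint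
paths through C are found, and the arc between their middle vertices takes care of the short
lengths. -/
theorem Dense.hasConn_of_no_mid (h : Dense r δ) (hxy : x ≠ y)
    (hZ : part r x y True True = ∅) {n : ℕ} (hn : 3 ≤ n) (hnV : n + 2 ≤ Fintype.card V) :
    HasConn r x y n := by
  classical
  by_contra hcon
  have hA := card_part_out h.tour x y
  have hB := card_part_in h.tour x y
  have hcard := card_part (r := r) hxy
  have hox := h.out_ge x
  have hiy := h.in_ge y
  have h4 := h.four_le
  have hord := h.order
  have hT := h.tour
  rw [hZ, Finset.card_empty] at hA hB hcard
  have mA : ∀ u, u ∈ part r x y True False ↔ u ≠ x ∧ u ≠ y ∧ r x u ∧ ¬ r u y := by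
    simp [mem_part]
  have mB : ∀ u, u ∈ part r x y False True ↔ u ≠ x ∧ u ≠ y ∧ ¬ r x u ∧ r u y := by
    simp [mem_part]
  have mC : ∀ u, u ∈ part r x y False False ↔ u ≠ x ∧ u ≠ y ∧ ¬ r x u ∧ ¬ r u y := by
    simp [mem_part]
  have hdich : ∀ u, u = x ∨ u = y ∨ u ∈ part r x y True False ∨ u ∈ part r x y False True ∨
      u ∈ part r x y False False := by
    intro u
    have : u ∉ part r x y True True := by simp [hZ]
    simp only [mem_part] at *
    tauto
  set A := part r x y True False with hAdef
  set B := part r x y False True with hBdef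
  set C := part r x y False False with hCdef
  have houtA : ∀ a ∈ A, ∀ u, r a u → u ∈ A ∨ u ∈ B ∨ u ∈ C := by
    intro a ha u hau
    rw [mA] at ha
    rcases hdich u with rfl | rfl | hu
    · exact absurd hau (hT.asymm ha.2.2.1)
    · exact absurd hau ha.2.2.2
    · exact hu
  have hinB : ∀ b ∈ B, ∀ u, r u b → u ∈ A ∨ u ∈ B ∨ u ∈ C := by
    intro b hb u hub
    rw [mB] at hb
    rcases hdich u with rfl | rfl | hu
    · exact absurd hub hb.2.2.1
    · exact absurd hub (hT.asymm hb.2.2.2)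
    · exact hu
  have E3 : ∀ a ∈ A, ∀ b ∈ B, r a b → ∀ a' ∈ A, ∀ b' ∈ B, r a' b' → a ≠ a' → b ≠ b' → False := by
    intro a ha b hb hab a' ha' b' hb' hab' haa hbb
    rw [mA] at ha ha'
    rw [mB] at hb hb'
    exact hcon (h.hasConn_of_two_arcs hxy ha.2.2.1 hab hb.2.2.2 ha'.2.2.1 hab' hb'.2.2.2 haa
      (by grind) (by grind) hbb ha.2.1 ha'.2.1 hb.1 hb'.1 hn hnV)
  by_cases harc : ∃ a₀ ∈ A, ∃ b₀ ∈ B, r a₀ b₀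
  · obtain ⟨a₀, ha₀, b₀, hb₀, hab₀⟩ := harc
    have hcA := Finset.card_erase_of_mem ha₀
    have hcB := Finset.card_erase_of_mem hb₀
    -- With at most three exceptional vertices and no middle vertex the count reads 4δ + 2 ≤ 4δ; a
    -- fourth would leave no contradiction.
    have hcontr : ∀ K K' : Finset V, K.card + K'.card ≤ 3 →
        (∀ a ∈ A.erase a₀, ∀ u, r a u → u ∈ A.erase a₀ ∨ u ∈ K ∨ u ∈ C) →
        (∀ b ∈ B.erase b₀, ∀ u, r u b → u ∈ B.erase b₀ ∨ u ∈ K' ∨ u ∈ C) → False := by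
      intro K K' hK h1 h2
      obtain ⟨N, hN, hth⟩ := card_through hT h.out_ge h.in_ge (P := A.erase a₀) (Q := B.erase b₀)
        (Finset.card_pos.1 (by omega)) (Finset.card_pos.1 (by omega)) h1 h2
      have hempty : N = ∅ := by
        rw [Finset.eq_empty_iff_forall_notMem]
        intro c hc
        obtain ⟨hc, ⟨a, ha, hac⟩, b, hb, hcb⟩ := hN c hc
        rw [Finset.mem_erase, mA] at ha
        rw [Finset.mem_erase, mB] at hb
        rw [mA] at ha₀
        rw [mB] at hb₀
        rw [mC] at hc
        refine hcon (h.hasConn_of_arc_through ha₀.2.2.1 hab₀ hb₀.2.2.2 ha.2.2.2.1 hac hcb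
          hb.2.2.2.2 ?_ hn hnV)
        simp only [List.nodup_cons, List.mem_cons, List.not_mem_nil, or_false, not_or,
          not_false_eq_true, List.nodup_nil, and_true]
        grind
      rw [hempty, Finset.card_empty] at hth
      omega
    have hno : ∀ a ∈ A.erase a₀, ∀ b ∈ B.erase b₀, ¬ r a b := by
      intro a ha b hb hab
      rw [Finset.mem_erase] at ha hb
      exact E3 a₀ ha₀ b₀ hb₀ hab₀ a ha.2 b hb.2 hab ha.1.symm hb.1.symm
    -- The arcs from A to B form a star: all end in `b₀`, or all start in `a₀`. This keeps the
    -- number of exceptions at three.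
    by_cases hfirst : ∃ a ∈ A.erase a₀, r a b₀
    · obtain ⟨a, ha, hab⟩ := hfirst
      have hno' : ∀ b ∈ B.erase b₀, ¬ r a₀ b := by
        intro b hb hab'
        rw [Finset.mem_erase] at ha hb
        exact E3 a ha.2 b₀ hb₀ hab a₀ ha₀ b hb.2 hab' ha.1 hb.1.symm
      refine hcontr {a₀, b₀} {b₀} ?_ ?_ ?_
      · have := Finset.card_le_two (a := a₀) (b := b₀)
        rw [Finset.card_singleton]
        omega
      · intro a ha u hau
        rcases houtA a (Finset.mem_of_mem_erase ha) u hau with hu | hu | hu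
        · by_cases hua : u = a₀
          · simp [hua]
          · exact Or.inl (Finset.mem_erase.2 ⟨hua, hu⟩)
        · by_cases hub : u = b₀
          · simp [hub]
          · exact absurd hau (hno a ha u (Finset.mem_erase.2 ⟨hub, hu⟩))
        · exact Or.inr (Or.inr hu)
      · intro b hb u hub
        rcases hinB b (Finset.mem_of_mem_erase hb) u hub with hu | hu | hu
        · by_cases hua : u = a₀
          · exact absurd (hua ▸ hub) (hno' b hb)
          · exact absurd hub (hno u (Finset.mem_erase.2 ⟨hua, hu⟩) b hb)
        · by_cases hub : u = b₀
          · simp [hub]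
          · exact Or.inl (Finset.mem_erase.2 ⟨hub, hu⟩)
        · exact Or.inr (Or.inr hu)
    · push Not at hfirst
      refine hcontr {a₀} {a₀, b₀} ?_ ?_ ?_
      · have := Finset.card_le_two (a := a₀) (b := b₀)
        rw [Finset.card_singleton]
        omega
      · intro a ha u hau
        rcases houtA a (Finset.mem_of_mem_erase ha) u hau with hu | hu | hu
        · by_cases hua : u = a₀
          · simp [hua]
          · exact Or.inl (Finset.mem_erase.2 ⟨hua, hu⟩)
        · by_cases hub : u = b₀
          · exact absurd (hub ▸ hau) (hfirst a ha)
          · exact absurd hau (hno a ha u (Finset.mem_erase.2 ⟨hub, hu⟩))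
        · exact Or.inr (Or.inr hu)
      · intro b hb u hub
        rcases hinB b (Finset.mem_of_mem_erase hb) u hub with hu | hu | hu
        · by_cases hua : u = a₀
          · simp [hua]
          · exact absurd hub (hno u (Finset.mem_erase.2 ⟨hua, hu⟩) b hb)
        · by_cases hub : u = b₀
          · simp [hub]
          · exact Or.inl (Finset.mem_erase.2 ⟨hub, hu⟩)
        · exact Or.inr (Or.inr hu)
  · push Not at harc
    obtain ⟨N, hN, hth⟩ := card_through hT h.out_ge h.in_ge (P := A) (Q := B) (M := C)
      (K := ∅) (K' := ∅)
      (Finset.card_pos.1 (by omega)) (Finset.card_pos.1 (by omega)) (by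
        intro a ha u hau
        rcases houtA a ha u hau with hu | hu | hu
        · exact Or.inl hu
        · exact absurd hau (harc a ha u hu)
        · exact Or.inr (Or.inr hu)) (by
        intro b hb u hub
        rcases hinB b hb u hub with hu | hu | hu
        · exact absurd hub (harc u hu b hb)
        · exact Or.inl hu
        · exact Or.inr (Or.inr hu))
    rw [Finset.card_empty] at hth
    obtain ⟨c, hc⟩ : N.Nonempty := Finset.card_pos.1 (by omega)
    obtain ⟨hc, ⟨a, ha, hac⟩, b, hb, hcb⟩ := hN c hc
    have hcA := Finset.card_erase_of_mem ha
    have hcB := Finset.card_erase_of_mem hb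
    obtain ⟨N', hN', hth'⟩ := card_through hT h.out_ge h.in_ge (P := A.erase a)
      (Q := B.erase b) (M := C)
      (K := {a}) (K' := {b}) (Finset.card_pos.1 (by omega)) (Finset.card_pos.1 (by omega)) (by
        intro a' ha' u hau
        rcases houtA a' (Finset.mem_of_mem_erase ha') u hau with hu | hu | hu
        · by_cases hua : u = a
          · simp [hua]
          · exact Or.inl (Finset.mem_erase.2 ⟨hua, hu⟩)
        · exact absurd hau (harc a' (Finset.mem_of_mem_erase ha') u hu)
        · exact Or.inr (Or.inr hu)) (by
        intro b' hb' u hub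
        rcases hinB b' (Finset.mem_of_mem_erase hb') u hub with hu | hu | hu
        · exact absurd hub (harc u hu b' (Finset.mem_of_mem_erase hb'))
        · by_cases hua : u = b
          · simp [hua]
          · exact Or.inl (Finset.mem_erase.2 ⟨hua, hu⟩)
        · exact Or.inr (Or.inr hu))
    rw [Finset.card_singleton, Finset.card_singleton] at hth'
    -- The count leaves at least two middle vertices, so `c` need not be removed from C beforehand.
    obtain ⟨c', hc', hne⟩ := Finset.exists_mem_ne (show 1 < N'.card by omega) c
    obtain ⟨hc', ⟨a', ha', hac'⟩, b', hb', hcb'⟩ := hN' c' hc'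
    rw [Finset.mem_erase, mA] at ha'
    rw [Finset.mem_erase, mB] at hb'
    rw [mA] at ha
    rw [mB] at hb
    rw [mC] at hc hc'
    have hcx := hT.of_not hc.1.symm hc.2.2.1
    have hcx' := hT.of_not hc'.1.symm hc'.2.2.1
    have hyc := hT.of_not hc.2.1 hc.2.2.2
    have hyc' := hT.of_not hc'.2.1 hc'.2.2.2
    rcases hT.total hne with hcc | hcc
    · exact hcon (h.hasConn_of_two_through ha'.2.2.2.1 hac' hcb' hb'.2.2.2.2 ha.2.2.1 hac hcb
        hb.2.2.2 hcx' hcx hyc' hyc hcc (nodup_of_sorted (P := fun v => r x v)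
        (Q := fun v => r v y) hxy ha'.2 hc' hb'.2 ha hc hb ha'.1 hne hb'.1) hn hnV)
    · exact hcon (h.hasConn_of_two_through ha.2.2.1 hac hcb hb.2.2.2 ha'.2.2.2.1 hac' hcb'
        hb'.2.2.2.2 hcx hcx' hyc hyc' hcc (nodup_of_sorted (P := fun v => r x v)
        (Q := fun v => r v y) hxy ha hc hb ha'.2 hc' hb'.2 ha'.1.symm hne.symm hb'.1.symm) hn hnV)

theorem Dense.hasConn (h : Dense r δ) (hxy : x ≠ y) {n : ℕ} (hn : 3 ≤ n)
    (hnV : n + 2 ≤ Fintype.card V) : HasConn r x y n := by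
  rcases (part r x y True True).eq_empty_or_nonempty with hZ | hZ
  · exact h.hasConn_of_no_mid hxy hZ hn hnV
  · exact h.hasConn_of_mid hxy hZ hn hnV

end Panconnected

/-! ### Regular subtournaments and the equality case of the degree count -/

section Regular

variable {V : Type*} {r : V → V → Prop}

open Classical in
/-- The subtournament induced by `X` is regular. -/
def RegOn (r : V → V → Prop) (X : Finset V) : Prop :=
  ∀ v ∈ X, 2 * (X.filter (r v)).card + 1 = X.card

open Classical in
theorem card_filter_add (hT : IsTour r) {X : Finset V} {v : V} (hv : v ∈ X) :
    (X.filter (r v)).card + (X.filter (r · v)).card + 1 = X.card := by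
  rw [← Finset.card_union_of_disjoint, ← Finset.card_erase_add_one hv]
  · congr 2
    ext u
    simp only [Finset.mem_union, Finset.mem_filter, Finset.mem_erase]
    constructor
    · rintro (⟨h, h'⟩ | ⟨h, h'⟩)
      · exact ⟨(hT.ne h').symm, h⟩
      · exact ⟨hT.ne h', h⟩
    · rintro ⟨h, h'⟩
      rcases hT.total h with h | h
      · exact Or.inr ⟨h', h⟩
      · exact Or.inl ⟨h', h⟩
  · rw [Finset.disjoint_left]
    intro u hu hu'
    exact hT.asymm (Finset.mem_filter.1 hu).2 (Finset.mem_filter.1 hu').2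

theorem RegOn.flip (hT : IsTour r) {X : Finset V} (h : RegOn r X) : RegOn (flip r) X := by
  classical
  intro v hv
  have h1 := card_filter_add hT hv
  have h2 := h v hv
  have h3 : X.filter (_root_.flip r v) = X.filter (r · v) := rfl
  rw [h3]
  omega

open Classical in
-- The outdegrees within `X` average exactly (|X| - 1)/2, so a lower bound by the average is an
-- equality everywhere.
theorem regOn_of_le (hT : IsTour r) {X : Finset V}
    (h : ∀ v ∈ X, X.card ≤ 2 * (X.filter (r v)).card + 1) : RegOn r X := by
  intro v hv
  have h1 := sum_card_filter hT X
  have h2 : ∑ v ∈ X, (X.card - 1) = ∑ v ∈ X, (X.filter (r v)).card * 2 := by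
    rw [h1, Finset.sum_const, smul_eq_mul]
  rw [Finset.sum_eq_sum_iff_of_le (fun v hv => by have := h v hv; omega)] at h2
  have := h2 v hv
  have := Finset.card_pos.2 ⟨v, hv⟩
  omega

/-- The equality case of `card_ge_of_out`. -/
theorem regOn_and_dominate [Fintype V] (hT : IsTour r) {δ : ℕ}
    (hδ : ∀ v, δ ≤ (outSet r v).card) {I M : Finset V} (hcard : I.card + 2 * M.card = 2 * δ + 1)
    (h : ∀ v ∈ I, ∀ u, r v u → u ∈ I ∨ u ∈ M) : RegOn r I ∧ ∀ a ∈ I, ∀ b ∈ M, r a b := by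
  classical
  have key : ∀ v ∈ I, δ ≤ (I.filter (r v)).card + (M.filter (r v)).card := by
    intro v hv
    refine (hδ v).trans ((Finset.card_le_card ?_).trans (Finset.card_union_le _ _))
    intro u hu
    rw [mem_outSet] at hu
    simp only [Finset.mem_union, Finset.mem_filter]
    exact (h v hv u hu).imp (⟨·, hu⟩) (⟨·, hu⟩)
  have hreg : RegOn r I := regOn_of_le hT fun v hv => by
    have h1 := key v hv
    have h2 := Finset.card_filter_le M (r v)
    omega
  refine ⟨hreg, fun a ha b hb => ?_⟩
  have h1 := key a ha
  have h2 : 2 * (I.filter (r a)).card + 1 = I.card := by convert hreg a ha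
  have h3 : M.filter (r a) = M :=
    Finset.eq_of_subset_of_card_le (Finset.filter_subset _ _) (by omega)
  rw [← h3] at hb
  exact (Finset.mem_filter.1 hb).2

end Regular

/-! ### The configuration forced by a missing path of length three -/

section Config

variable {V : Type*} [DecidableEq V] {r : V → V → Prop} [Fintype V] {δ : ℕ} {x y : V}

open Classical in
/-- The structure of a tournament that is the exceptional configuration without the set `S`. -/
structure Config (r : V → V → Prop) (k : ℕ) (x y z : V) (A B C : Finset V) : Prop where
  tour : IsTour r
  one_le : 1 ≤ k
  card_A : A.card = 2 * k - 1
  card_B : B.card = k + 2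
  card_C : C.card = 2 * k - 1
  ne : x ≠ y
  z_ne : z ≠ x ∧ z ≠ y
  notMem_A : x ∉ A ∧ y ∉ A ∧ z ∉ A
  notMem_B : x ∉ B ∧ y ∉ B ∧ z ∉ B
  notMem_C : x ∉ C ∧ y ∉ C ∧ z ∉ C
  disj_AB : Disjoint A B
  disj_AC : Disjoint A C
  disj_BC : Disjoint B C
  cover : ∀ v, v = x ∨ v = y ∨ v = z ∨ v ∈ A ∨ v ∈ B ∨ v ∈ C
  reg_A : RegOn r A
  reg_C : RegOn r C
  A_to_B : ∀ a ∈ A, ∀ b ∈ B, r a b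
  B_to_C : ∀ b ∈ B, ∀ c ∈ C, r b c
  C_to_A : ∀ c ∈ C, ∀ a ∈ A, r c a
  C_to_z : ∀ c ∈ C, r c z
  z_to_A : ∀ a ∈ A, r z a
  x_to_y : r x y
  x_to_z : r x z
  z_to_y : r z y
  x_to_A : ∀ a ∈ A, r x a
  C_to_y : ∀ c ∈ C, r c y
  y_to_A : ∀ a ∈ A, r y a
  y_to_B : ∀ b ∈ B, r y b
  B_to_x : ∀ b ∈ B, r b x
  C_to_x : ∀ c ∈ C, r c x
  -- These bounds say that the missing outdegree k + 1 minus the present one lies between 0 and k,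
  -- so it can be supplied by k new vertices.
  deg : ∀ w ∈ insert z B, 1 ≤ ((insert z B).filter (r w)).card ∧
    ((insert z B).filter (r w)).card ≤ k + 1

theorem card_part_out_of_not (hT : IsTour r) (hxy : ¬ r x y) :
    (outSet r x).card ≤ (part r x y True True).card + (part r x y True False).card := by
  classical
  refine (Finset.card_le_card ?_).trans (Finset.card_union_le _ _)
  intro v hv
  rw [mem_outSet] at hv
  have := (hT.ne hv).symm
  have : v ≠ y := by rintro rfl; exact hxy hv
  simp only [Finset.mem_union, mem_part]
  tauto

theorem card_part_in_of_not (hT : IsTour r) (hxy : ¬ r x y) :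
    (outSet (flip r) y).card ≤ (part r x y True True).card + (part r x y False True).card := by
  have := card_part_out_of_not (r := flip r) (x := y) (y := x) hT.flip hxy
  rwa [part_flip, part_flip] at this

open Classical in
/-- In a tournament with large semidegrees, two vertices that are not joined by a path of length
three belong to an exceptional configuration. -/
theorem exists_config (hT : IsTour r) (ho : ∀ v, δ ≤ (outSet r v).card)
    (hi : ∀ v, δ ≤ (outSet (flip r) v).card) (h4 : 4 ≤ δ) (hord : 2 * Fintype.card V ≤ 5 * δ + 1)
    (hxy : x ≠ y) (hno : ¬ HasConn r x y 2) : ∃ k z A B C, Config r k x y z A B C := by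
  have F : ∀ a b, r x a → r a b → r b y → a ≠ y → b ≠ x → False := by
    intro a b h1 h2 h3 h4 h5
    have := hT.ne h1
    have := hT.ne h2
    have := hT.ne h3
    exact hno (hasConn_of_isChain [a, b] (by simp [*]) (by simp; grind))
  have hA := card_part_out hT x y
  have hB := card_part_in hT x y
  have hcard := card_part (r := r) hxy
  have hox := ho x
  have hiy := hi y
  have hnA := card_part_out_of_not (x := x) (y := y) hT
  have hnB := card_part_in_of_not (x := x) (y := y) hT
  have mZ : ∀ u, u ∈ part r x y True True ↔ u ≠ x ∧ u ≠ y ∧ r x u ∧ r u y := by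
    simp [mem_part]
  have mA : ∀ u, u ∈ part r x y True False ↔ u ≠ x ∧ u ≠ y ∧ r x u ∧ ¬ r u y := by
    simp [mem_part]
  -- The letters follow the exceptional family: C now consists of the in-neighbours of y that x does
  -- not dominate, and B of the vertices with neither property.
  have mC : ∀ u, u ∈ part r x y False True ↔ u ≠ x ∧ u ≠ y ∧ ¬ r x u ∧ r u y := by
    simp [mem_part]
  have mB : ∀ u, u ∈ part r x y False False ↔ u ≠ x ∧ u ≠ y ∧ ¬ r x u ∧ ¬ r u y := by
    simp [mem_part]
  have hZ1 : (part r x y True True).card ≤ 1 := by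
    rw [Finset.card_le_one]
    intro a ha b hb
    rw [mZ] at ha hb
    by_contra hab
    rcases hT.total hab with h | h
    · exact F a b ha.2.2.1 h hb.2.2.2 ha.2.1 hb.1
    · exact F b a hb.2.2.1 h ha.2.2.2 hb.2.1 ha.1
  set Z := part r x y True True with hZdef
  set A := part r x y True False with hAdef
  set C := part r x y False True with hCdef
  set B := part r x y False False with hBdef
  have hdich : ∀ u, u = x ∨ u = y ∨ u ∈ Z ∨ u ∈ A ∨ u ∈ B ∨ u ∈ C := by
    intro u
    rw [mZ, mA, mB, mC]
    tauto
  have hAout : ∀ a ∈ A, ∀ u, r a u → u ∈ A ∨ u ∈ B := by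
    intro a ha u hau
    rw [mA] at ha
    rcases hdich u with rfl | rfl | hu | hu | hu | hu
    · exact absurd hau (hT.asymm ha.2.2.1)
    · exact absurd hau ha.2.2.2
    · rw [mZ] at hu
      exact (F a u ha.2.2.1 hau hu.2.2.2 ha.2.1 hu.1).elim
    · exact Or.inl hu
    · exact Or.inr hu
    · rw [mC] at hu
      exact (F a u ha.2.2.1 hau hu.2.2.2 ha.2.1 hu.1).elim
  have hCin : ∀ c ∈ C, ∀ u, flip r c u → u ∈ C ∨ u ∈ B := by
    intro c hc u huc
    rw [mC] at hc
    rcases hdich u with rfl | rfl | hu | hu | hu | hu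
    · exact absurd huc hc.2.2.1
    · exact absurd huc (hT.asymm hc.2.2.2)
    · rw [mZ] at hu
      exact (F u c hu.2.2.1 huc hc.2.2.2 hu.2.1 hc.1).elim
    · rw [mA] at hu
      exact (F u c hu.2.2.1 huc hc.2.2.2 hu.2.1 hc.1).elim
    · exact Or.inr hu
    · exact Or.inl hu
  have hAne : A.Nonempty := Finset.card_pos.1 (by omega)
  have hCne : C.Nonempty := Finset.card_pos.1 (by omega)
  have cA := card_ge_of_out hT ho hAne hAout
  have cC := card_ge_of_out hT.flip hi hCne hCin
  have hrxy : r x y := by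
    by_contra h
    have := hnA h
    have := hnB h
    omega
  -- The bounds |A| + 2|B| ≥ 2δ + 1, |C| + 2|B| ≥ 2δ + 1 and |A|, |C| ≥ δ - 1 - |Z| add up to 4p ≥
  -- 10δ + 4 - 2|Z|, while 4p ≤ 10δ + 2. So |Z| = 1 and all of them are equalities; in particular
  -- 2|B| = δ + 3 and δ is odd.
  have hZcard : Z.card = 1 := by omega
  obtain ⟨k, hk⟩ : ∃ k, δ = 2 * k + 1 := ⟨δ / 2, by omega⟩
  obtain ⟨regA, hAB⟩ := regOn_and_dominate hT ho (by omega) hAout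
  obtain ⟨regC, hBC⟩ := regOn_and_dominate hT.flip hi (by omega) hCin
  obtain ⟨z, hz⟩ := Finset.card_eq_one.1 hZcard
  have hzZ : z ∈ Z := by simp [hz]
  rw [mZ] at hzZ
  obtain ⟨hzx, hzy, hxz, hzy'⟩ := hzZ
  have hzA : z ∉ A := fun h => ((mA z).1 h).2.2.2 hzy'
  have hzB : z ∉ B := fun h => ((mB z).1 h).2.2.1 hxz
  have hzC : z ∉ C := fun h => ((mC z).1 h).2.2.1 hxz
  have dAB : Disjoint A B := Finset.disjoint_left.2 fun v h h' =>
    ((mB v).1 h').2.2.1 ((mA v).1 h).2.2.1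
  have dAC : Disjoint A C := Finset.disjoint_left.2 fun v h h' =>
    ((mC v).1 h').2.2.1 ((mA v).1 h).2.2.1
  have dBC : Disjoint B C := Finset.disjoint_left.2 fun v h h' =>
    ((mB v).1 h).2.2.2 ((mC v).1 h').2.2.2
  have hcov : ∀ v, v = x ∨ v = y ∨ v = z ∨ v ∈ A ∨ v ∈ B ∨ v ∈ C := by
    intro v
    have := hdich v
    rw [hz, Finset.mem_singleton] at this
    exact this
  have hCA : ∀ c ∈ C, ∀ a ∈ A, r c a := fun c hc a ha =>
    hT.of_not (fun h => Finset.disjoint_left.1 dAC ha (h ▸ hc))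
      (fun h => F a c ((mA a).1 ha).2.2.1 h ((mC c).1 hc).2.2.2 ((mA a).1 ha).2.1 ((mC c).1 hc).1)
  have hCz : ∀ c ∈ C, r c z := fun c hc => hT.of_not (fun h => hzC (h ▸ hc))
    (fun h => F z c hxz h ((mC c).1 hc).2.2.2 hzy ((mC c).1 hc).1)
  have hzA' : ∀ a ∈ A, r z a := fun a ha => hT.of_not (fun h => hzA (h ▸ ha))
    (fun h => F a z ((mA a).1 ha).2.2.1 h hzy' ((mA a).1 ha).2.1 hzx)
  have hyA : ∀ a ∈ A, r y a := fun a ha => hT.of_not ((mA a).1 ha).2.1 ((mA a).1 ha).2.2.2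
  have hyB : ∀ b ∈ B, r y b := fun b hb => hT.of_not ((mB b).1 hb).2.1 ((mB b).1 hb).2.2.2
  have hBx : ∀ b ∈ B, r b x := fun b hb => hT.of_not ((mB b).1 hb).1.symm ((mB b).1 hb).2.2.1
  have hCx : ∀ c ∈ C, r c x := fun c hc => hT.of_not ((mC c).1 hc).1.symm ((mC c).1 hc).2.2.1
  refine ⟨k, z, A, B, C, ⟨hT, by omega, by omega, by omega, by omega, hxy, ⟨hzx, hzy⟩, ?_, ?_, ?_,
    dAB, dAC, dBC, hcov, regA, regC.flip hT.flip, hAB, fun b hb c hc => hBC c hc b hb, hCA, hCz,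
    hzA', hrxy, hxz, hzy', fun a ha => ((mA a).1 ha).2.2.1, fun c hc => ((mC c).1 hc).2.2.2, hyA,
    hyB, hBx, hCx, ?_⟩⟩
  · exact ⟨fun h => ((mA x).1 h).1 rfl, fun h => ((mA y).1 h).2.1 rfl, hzA⟩
  · exact ⟨fun h => ((mB x).1 h).1 rfl, fun h => ((mB y).1 h).2.1 rfl, hzB⟩
  · exact ⟨fun h => ((mC x).1 h).1 rfl, fun h => ((mC y).1 h).2.1 rfl, hzC⟩
  · intro w hw
    have hadd := card_filter_add hT hw
    rw [Finset.card_insert_of_notMem hzB] at hadd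
    -- Outside {z} ∪ B, a vertex w of this set has at most 2k out-neighbours and at most 2k
    -- in-neighbours. Since δ = 2k + 1, it has at least one of each inside.
    have main : ∃ (p q : V) (P Q : Finset V), P.card + 1 ≤ 2 * k ∧ Q.card + 1 ≤ 2 * k ∧
        (∀ u, r w u → u ∈ insert z B ∨ u ∈ insert p P) ∧
        (∀ u, r u w → u ∈ insert z B ∨ u ∈ insert q Q) := by
      rcases Finset.mem_insert.1 hw with rfl | hw
      · refine ⟨y, x, A, C, by omega, by omega, fun u hu => ?_, fun u hu => ?_⟩
        · rcases hcov u with rfl | rfl | h | h | h | h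
          · exact absurd hu (hT.asymm hxz)
          · simp
          · simp [h]
          · simp [h]
          · simp [h]
          · exact absurd hu (hT.asymm (hCz u h))
        · rcases hcov u with rfl | rfl | h | h | h | h
          · simp
          · exact absurd hu (hT.asymm hzy')
          · simp [h]
          · exact absurd hu (hT.asymm (hzA' u h))
          · simp [h]
          · simp [h]
      · refine ⟨x, y, C, A, by omega, by omega, fun u hu => ?_, fun u hu => ?_⟩
        · rcases hcov u with rfl | rfl | h | h | h | h
          · simp
          · exact absurd hu (hT.asymm (hyB w hw))
          · simp [h]
          · exact absurd hu (hT.asymm (hAB u h w hw))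
          · simp [h]
          · simp [h]
        · rcases hcov u with rfl | rfl | h | h | h | h
          · exact absurd hu (hT.asymm (hBx w hw))
          · simp
          · simp [h]
          · simp [h]
          · simp [h]
          · exact absurd hu (hT.asymm (hBC u h w hw))
    obtain ⟨p, q, P, Q, hP, hQ, h1, h2⟩ := main
    have c1 : outSet r w ⊆ (insert z B).filter (r w) ∪ insert p P := by
      intro u hu
      rw [mem_outSet] at hu
      rw [Finset.mem_union, Finset.mem_filter]
      exact (h1 u hu).imp (⟨·, hu⟩) id
    have c2 : outSet (flip r) w ⊆ (insert z B).filter (r · w) ∪ insert q Q := by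
      intro u hu
      rw [mem_outSet] at hu
      rw [Finset.mem_union, Finset.mem_filter]
      exact (h2 u hu).imp (⟨·, hu⟩) id
    have c3 := (Finset.card_le_card c1).trans (Finset.card_union_le _ _)
    have c4 := (Finset.card_le_card c2).trans (Finset.card_union_le _ _)
    have c5 := Finset.card_insert_le p P
    have c6 := Finset.card_insert_le q Q
    have c7 := ho w
    have c8 := hi w
    omega

end Config

/-! ### Balanced bipartite graphs and a nearly regular tournament -/

section Balanced

theorem card_filter_cyclic {k : ℕ} (hk : 0 < k) (a f : ℕ) (hf : f ≤ k) :
    (Finset.univ.filter fun j : Fin k => ∃ t ∈ Finset.Ico a (a + f), t % k = j).card = f := by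
  have hinj : Set.InjOn (fun t : ℕ => (⟨t % k, Nat.mod_lt _ hk⟩ : Fin k))
      (Finset.Ico a (a + f) : Set ℕ) := by
    intro s hs t ht hst
    rw [Finset.mem_coe, Finset.mem_Ico] at hs ht
    have h : s ≡ t [MOD k] := by simpa [Nat.ModEq] using hst
    rcases le_total s t with hle | hle
    · have := (Nat.modEq_iff_dvd' hle).1 h
      have := Nat.eq_zero_of_dvd_of_lt this (by omega)
      omega
    · have := (Nat.modEq_iff_dvd' hle).1 h.symm
      have := Nat.eq_zero_of_dvd_of_lt this (by omega)
      omega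
  have h : (Finset.univ.filter fun j : Fin k => ∃ t ∈ Finset.Ico a (a + f), t % k = j) =
      (Finset.Ico a (a + f)).image fun t : ℕ => (⟨t % k, Nat.mod_lt _ hk⟩ : Fin k) := by
    ext j
    simp only [Finset.mem_filter, Finset.mem_univ, true_and, Finset.mem_image, Fin.ext_iff]
  rw [h, Finset.card_image_of_injOn hinj, Nat.card_Ico]
  omega

theorem count_add_cyclic {k : ℕ} (a f : ℕ) (hf : f ≤ k) (j : Fin k) :
    Nat.count (· % k = j) (a + f) = Nat.count (· % k = j) a +
      if ∃ t ∈ Finset.Ico a (a + f), t % k = j then 1 else 0 := by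
  rw [Nat.count_eq_card_filter_range, Nat.count_eq_card_filter_range, Finset.range_eq_Ico,
    Finset.range_eq_Ico, ← Finset.Ico_union_Ico_eq_Ico (Nat.zero_le a) (Nat.le_add_right a f),
    Finset.filter_union, Finset.card_union_of_disjoint
      (Finset.disjoint_filter_filter (Finset.Ico_disjoint_Ico_consecutive _ _ _))]
  congr 1
  split_ifs with h
  · obtain ⟨t, ht, htj⟩ := h
    rw [Finset.card_eq_one]
    refine ⟨t, ?_⟩
    ext s
    rw [Finset.mem_filter, Finset.mem_singleton]
    constructor
    · rintro ⟨hs, hsj⟩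
      rw [Finset.mem_Ico] at hs ht
      have h : s ≡ t [MOD k] := hsj.trans htj.symm
      rcases le_total s t with hle | hle
      · have := (Nat.modEq_iff_dvd' hle).1 h
        have := Nat.eq_zero_of_dvd_of_lt this (by omega)
        omega
      · have := (Nat.modEq_iff_dvd' hle).1 h.symm
        have := Nat.eq_zero_of_dvd_of_lt this (by omega)
        omega
    · rintro rfl
      exact ⟨ht, htj⟩
  · rw [Finset.card_eq_zero, Finset.filter_eq_empty_iff]
    exact fun t ht htj => h ⟨t, ht, htj⟩

open Classical in
/-- A bipartite graph with given degrees on one side and balanced degrees on the other side. -/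
theorem exists_balanced {V : Type*} {k : ℕ} (hk : 0 < k) (R : Finset V) (f : V → ℕ)
    (hf : ∀ w ∈ R, f w ≤ k) : ∃ M : V → Fin k → Prop,
      (∀ w ∈ R, (Finset.univ.filter (M w)).card = f w) ∧
      ∀ j, (R.filter (M · j)).card = Nat.count (· % k = j) (∑ w ∈ R, f w) := by
  induction R using Finset.induction_on with
  | empty => exact ⟨fun _ _ => False, by simp, by simp⟩
  | insert w R hw ih =>
    obtain ⟨M, h1, h2⟩ := ih fun v hv => hf v (Finset.mem_insert_of_mem hv)
    set a := ∑ v ∈ R, f v with ha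
    have hfw := hf w (Finset.mem_insert_self _ _)
    have hne : ∀ v ∈ R, v ≠ w := by
      rintro v hv rfl
      exact hw hv
    -- The new vertices are dealt out cyclically: `w` receives the `f w` residues following the `a`
    -- already used. They are distinct because `f w ≤ k`.
    refine ⟨fun v j => if v = w then ∃ t ∈ Finset.Ico a (a + f w), t % k = j else M v j, ?_, ?_⟩
    · intro v hv
      rcases Finset.mem_insert.1 hv with rfl | hv
      · simp only [if_true]
        convert card_filter_cyclic hk a (f v) hfw
      · simp only [hne v hv, if_false]
        exact h1 v hv
    · intro j
      rw [Finset.sum_insert hw, ← ha, add_comm (f w), count_add_cyclic a _ hfw, ← h2 j,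
        Finset.filter_insert]
      have h3 : (R.filter fun v => if v = w then ∃ t ∈ Finset.Ico a (a + f w), t % k = j
          else M v j) = R.filter (M · j) :=
        Finset.filter_congr fun v hv => by simp [hne v hv]
      simp only [if_true]
      split_ifs with h
      · rw [Finset.card_insert_of_notMem (fun h' => hw (Finset.mem_filter.1 h').1), h3]
      · rw [h3, add_zero]

/-- A nearly regular tournament on `Fin k`. -/
def cyc {k : ℕ} (i j : Fin k) : Prop :=
  (i < j ∧ (j : ℕ) ≤ i + k / 2) ∨ (j < i ∧ (j : ℕ) + k / 2 < i)

theorem isTour_cyc {k : ℕ} : IsTour (cyc (k := k)) where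
  irrefl := by simp [cyc]
  asymm := by
    intro i j
    simp only [cyc, Fin.lt_def]
    omega
  total := by
    intro i j h
    have : (i : ℕ) ≠ j := fun h' => h (Fin.ext h')
    simp only [cyc, Fin.lt_def]
    omega

open Classical in
theorem card_cyc {k : ℕ} (i : Fin k) :
    (Finset.univ.filter (cyc i)).card = min (k / 2) (k - 1 - i) + (i - k / 2) := by
  have h : (Finset.univ.filter (cyc i)).map Fin.valEmbedding =
      Finset.Ioc (i : ℕ) (min (i + k / 2) (k - 1)) ∪ Finset.range (i - k / 2) := by
    ext t
    simp only [Finset.mem_map, Finset.mem_filter, Finset.mem_univ, true_and, Fin.valEmbedding_apply,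
      cyc, Finset.mem_union, Finset.mem_Ioc, Finset.mem_range, Fin.lt_def]
    have hi := i.2
    constructor
    · rintro ⟨j, hj, rfl⟩
      have := j.2
      omega
    · intro ht
      exact ⟨⟨t, by omega⟩, by simp only; omega, rfl⟩
  rw [← Finset.card_map Fin.valEmbedding, h, Finset.card_union_of_disjoint, Nat.card_Ioc,
    Finset.card_range]
  · have := i.2
    omega
  · rw [Finset.disjoint_left]
    intro t
    simp only [Finset.mem_Ioc, Finset.mem_range]
    omega

/-- The right side is the outdegree of `j` in `cyc` plus 2. Cyclic dealing of k(k + 3)/2 arcs thus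
favours precisely the vertices of larger outdegree in `cyc` when k is even, so that every new vertex
gets total outdegree k + 1. -/
theorem count_balanced {k N : ℕ} (hN : 2 * N = k * (k + 3)) (j : Fin k) :
    Nat.count (· % k = j) N = min (k / 2) (k - 1 - j) + (j - k / 2) + 2 := by
  have hj := j.2
  have hcount := Nat.count_modEq_card N (show 0 < k by omega) j
  have h1 : (fun t : ℕ => t % k = (j : ℕ)) = (· ≡ (j : ℕ) [MOD k]) := by
    ext t
    rw [Nat.ModEq, Nat.mod_eq_of_lt hj]
  have h2 : Nat.count (· % k = (j : ℕ)) N = Nat.count (· ≡ (j : ℕ) [MOD k]) N := by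
    simp only [Nat.ModEq, Nat.mod_eq_of_lt hj]
  rw [h2, hcount, Nat.mod_eq_of_lt hj]
  rcases Nat.even_or_odd' k with ⟨h, rfl | rfl⟩
  · have hN' : N = h + (2 * h) * (h + 1) := by nlinarith
    have e1 : N / (2 * h) = h + 1 := by
      rw [hN', Nat.add_mul_div_left _ _ (by omega), Nat.div_eq_of_lt (by omega)]
      omega
    have e2 : N % (2 * h) = h := by
      rw [hN', Nat.add_mul_mod_self_left, Nat.mod_eq_of_lt (by omega)]
    rw [e1, e2]
    split_ifs <;> omega
  · have hN' : N = (2 * h + 1) * (h + 2) := by nlinarith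
    have e1 : N / (2 * h + 1) = h + 2 := by
      rw [hN', Nat.mul_div_cancel_left _ (by omega)]
    have e2 : N % (2 * h + 1) = 0 := by
      rw [hN', Nat.mul_mod_right]
    rw [e1, e2]
    split_ifs <;> omega

end Balanced

/-! ### Translation to digraphs -/

section Digraphs

variable {V : Type*}

theorem isTour_iff {D : Digraph V} : IsTour D.Adj ↔ D.IsTournament := by
  constructor
  · exact fun h => ⟨h.irrefl, fun x y hxy => ⟨h.asymm, fun h' => h.of_not hxy.symm h'⟩⟩
  · rintro ⟨h1, h2⟩
    refine ⟨h1, fun {x y} h => ?_, fun {x y} h => ?_⟩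
    · exact (h2 x y (by rintro rfl; exact h1 x h)).1 h
    · by_cases h' : D.Adj y x
      · exact Or.inr h'
      · exact Or.inl ((h2 x y h).2 h')

variable [Fintype V]

theorem outdegree_eq (D : Digraph V) (v : V) : D.outdegree v = (outSet D.Adj v).card := by
  rw [Digraph.outdegree, ← Set.ncard_coe_finset]
  congr 1
  ext u
  simp [mem_outSet]

theorem indegree_eq (D : Digraph V) (v : V) : D.indegree v = (outSet (flip D.Adj) v).card := by
  rw [Digraph.indegree, ← Set.ncard_coe_finset]
  congr 1
  ext u
  simp [mem_outSet, flip]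

theorem isRegularTournament_of {D : Digraph V} (hT : IsTour D.Adj)
    (h : ∀ v, 2 * (outSet D.Adj v).card + 1 = Fintype.card V) : D.IsRegularTournament := by
  refine ⟨isTour_iff.1 hT, ?_⟩
  rw [Digraph.irregularity, ← bot_eq_zero, Finset.sup_eq_bot_iff]
  intro v _
  rw [outdegree_eq, indegree_eq, bot_eq_zero, Int.natAbs_eq_zero]
  have h1 := card_outSet_add hT v
  have h2 := h v
  omega

theorem isRegularTournament_induce {V : Type*} {D : Digraph V} (hT : IsTour D.Adj)
    {X : Finset V} (h : RegOn D.Adj X) : (D.induce X).IsRegularTournament := by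
  classical
  refine isRegularTournament_of ⟨fun v => hT.irrefl v, fun h => hT.asymm h, fun {u v} h =>
    hT.total fun h' => h (Subtype.ext h')⟩ fun v => ?_
  have h1 : (outSet (D.induce X).Adj v).map (Function.Embedding.subtype _) =
      X.filter (D.Adj v) := by
    ext u
    simp only [Finset.mem_map, mem_outSet, Digraph.induce, Function.Embedding.subtype_apply,
      Subtype.exists, exists_and_right, exists_eq_right, Finset.mem_filter]
    exact ⟨fun ⟨h, h'⟩ => ⟨h, h'⟩, fun ⟨h, h'⟩ => ⟨h, h'⟩⟩
  have h2 := h v v.2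
  rw [Fintype.card_coe, ← Finset.card_map (Function.Embedding.subtype _), h1]
  convert h2

end Digraphs

/-! ### Adding new vertices to a tournament -/

section Extension

variable {V : Type*} {k : ℕ}

/-- The tournament obtained from `r` by adding a nearly regular tournament on `Fin k`, with `M`
describing the arcs from the old to the new vertices. -/
def extRel (r : V → V → Prop) (M : V → Fin k → Prop) : V ⊕ Fin k → V ⊕ Fin k → Prop
  | .inl u, .inl v => r u v
  | .inl u, .inr j => M u j
  | .inr i, .inl v => ¬ M v i
  | .inr i, .inr j => cyc i j

theorem isTour_extRel {r : V → V → Prop} (hT : IsTour r) (M : V → Fin k → Prop) :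
    IsTour (extRel r M) where
  irrefl := by
    rintro (v | j)
    · exact hT.irrefl v
    · exact isTour_cyc.irrefl j
  asymm := by
    rintro (u | i) (v | j)
    · exact hT.asymm
    · exact fun h h' => h' h
    · exact fun h h' => h h'
    · exact isTour_cyc.asymm
  total := by
    rintro (u | i) (v | j) h
    · exact hT.total fun h' => h (by rw [h'])
    · exact em _
    · exact (em _).symm
    · exact isTour_cyc.total fun h' => h (by rw [h'])

variable {U : Type*} [DecidableEq U]

open Classical in
theorem card_filter_extRel (r : V → V → Prop) (M : V → Fin k → Prop) (e : V ⊕ Fin k ≃ U)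
    (X : Finset V) (Y : Finset (Fin k)) (s : V ⊕ Fin k) :
    ((X.map (Function.Embedding.inl.trans e.toEmbedding) ∪
      Y.map (Function.Embedding.inr.trans e.toEmbedding)).filter
        (fun t => extRel r M s (e.symm t))).card =
      (X.filter fun v => extRel r M s (.inl v)).card +
        (Y.filter fun j => extRel r M s (.inr j)).card := by
  rw [Finset.filter_union, Finset.card_union_of_disjoint, Finset.filter_map, Finset.filter_map,
    Finset.card_map, Finset.card_map]
  · congr 2
    · ext v
      simp
    · ext j
      simp
  · refine Finset.disjoint_filter_filter ?_
    rw [Finset.disjoint_left]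
    intro u hu hu'
    rw [Finset.mem_map] at hu hu'
    obtain ⟨v, -, rfl⟩ := hu
    obtain ⟨j, -, hj⟩ := hu'
    simp at hj

open Classical in
theorem regOn_extRel (r : V → V → Prop) (M : V → Fin k → Prop) (e : V ⊕ Fin k ≃ U)
    (X : Finset V) (Y : Finset (Fin k))
    (hX : ∀ v ∈ X, 2 * ((X.filter (r v)).card + (Y.filter (M v)).card) + 1 = X.card + Y.card)
    (hY : ∀ i ∈ Y, 2 * ((X.filter fun v => ¬ M v i).card + (Y.filter (cyc i)).card) + 1 =
      X.card + Y.card) :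
    RegOn (fun s t => extRel r M (e.symm s) (e.symm t))
      (X.map (Function.Embedding.inl.trans e.toEmbedding) ∪
      Y.map (Function.Embedding.inr.trans e.toEmbedding)) := by
  intro u hu
  have hcard : (X.map (Function.Embedding.inl.trans e.toEmbedding) ∪
      Y.map (Function.Embedding.inr.trans e.toEmbedding)).card = X.card + Y.card := by
    rw [Finset.card_union_of_disjoint, Finset.card_map, Finset.card_map]
    rw [Finset.disjoint_left]
    intro u hu hu'
    rw [Finset.mem_map] at hu hu'
    obtain ⟨v, -, rfl⟩ := hu
    obtain ⟨j, -, hj⟩ := hu'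
    simp at hj
  rw [hcard]
  rw [Finset.mem_union, Finset.mem_map, Finset.mem_map] at hu
  have h := card_filter_extRel r M e X Y (e.symm u)
  rcases hu with ⟨v, hv, rfl⟩ | ⟨j, hj, rfl⟩
  · have h1 := hX v hv
    rw [← h1]
    simp only [Function.Embedding.trans_apply, Function.Embedding.inl_apply, Equiv.coe_toEmbedding,
      Equiv.symm_apply_apply] at h ⊢
    rw [h]
    rfl
  · have h1 := hY j hj
    rw [← h1]
    simp only [Function.Embedding.trans_apply, Function.Embedding.inr_apply, Equiv.coe_toEmbedding,
      Equiv.symm_apply_apply] at h ⊢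
    rw [h]
    congr!

end Extension

/-! ### Reconstruction of the exceptional tournament -/

namespace Config

variable {V : Type*} [DecidableEq V] {r : V → V → Prop} {k : ℕ} {x y z : V}
  {A B C : Finset V}

open Classical in
-- `M` prescribes the arcs to the new vertices so that {z} ∪ B together with them becomes regular of
-- degree k + 1.
theorem exists_relation (h : Config r k x y z A B C) : ∃ M : V → Fin k → Prop,
    (∀ w ∈ insert z B,
      ((insert z B).filter (r w)).card + (Finset.univ.filter (M w)).card = k + 1) ∧
    (∀ j, ((insert z B).filter fun w => ¬ M w j).card + (Finset.univ.filter (cyc j)).card =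
      k + 1) ∧
    (∀ j, M x j) ∧ (∀ j, ¬ M y j) ∧ (∀ a ∈ A, ∀ j, M a j) ∧ ∀ c ∈ C, ∀ j, ¬ M c j := by
  have hk := h.one_le
  have hR : (insert z B).card = k + 3 := by
    rw [Finset.card_insert_of_notMem h.notMem_B.2.2, h.card_B]
  obtain ⟨M, h1, h2⟩ := exists_balanced (k := k) hk (insert z B)
    (fun w => k + 1 - ((insert z B).filter (r w)).card) (fun w hw => by
      have := h.deg w hw
      omega)
  have hA := h.notMem_A
  have hB := h.notMem_B
  have hC := h.notMem_C
  have hz := h.z_ne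
  -- The missing outdegrees total (k + 1)(k + 3) - (k + 2)(k + 3)/2 = k(k + 3)/2, exactly the number
  -- in `count_balanced`.
  have hsum : 2 * ∑ w ∈ insert z B, (k + 1 - ((insert z B).filter (r w)).card) =
      k * (k + 3) := by
    have h3 := sum_card_filter h.tour (insert z B)
    have h4 : ∑ w ∈ insert z B, (k + 1 - ((insert z B).filter (r w)).card) * 2 +
        ∑ w ∈ insert z B, ((insert z B).filter (r w)).card * 2 =
        ∑ w ∈ insert z B, (k + 1) * 2 := by
      rw [← Finset.sum_add_distrib]
      refine Finset.sum_congr rfl fun w hw => ?_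
      have := (h.deg w hw).2
      omega
    rw [h3, Finset.sum_const, smul_eq_mul, hR, ← Finset.sum_mul] at h4
    have h5 : k + 3 - 1 = k + 2 := by omega
    rw [h5] at h4
    nlinarith
  have hxR : x ∉ insert z B := by
    rw [Finset.mem_insert, not_or]
    exact ⟨hz.1.symm, hB.1⟩
  have hyR : y ∉ insert z B := by
    rw [Finset.mem_insert, not_or]
    exact ⟨hz.2.symm, hB.2.1⟩
  have hCR : ∀ c ∈ C, c ∉ insert z B := by
    intro c hc hc'
    rcases Finset.mem_insert.1 hc' with rfl | hc'
    · exact hC.2.2 hc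
    · exact Finset.disjoint_left.1 h.disj_BC hc' hc
  have hAR : ∀ a ∈ A, a ∉ insert z B := by
    intro c hc hc'
    rcases Finset.mem_insert.1 hc' with rfl | hc'
    · exact hA.2.2 hc
    · exact Finset.disjoint_left.1 h.disj_AB hc hc'
  obtain ⟨M', hM'⟩ : ∃ M' : V → Fin k → Prop, ∀ v j, M' v j ↔
      v = x ∨ v ∈ A ∨ v ∈ insert z B ∧ M v j := ⟨_, fun _ _ => Iff.rfl⟩
  refine ⟨M', ?_, ?_, ?_, ?_, ?_, ?_⟩
  · intro w hw
    have h3 : Finset.univ.filter (M' w) = Finset.univ.filter (M w) := by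
      refine Finset.filter_congr fun j _ => ?_
      rw [hM']
      have : w ≠ x := by rintro rfl; exact hxR hw
      have : w ∉ A := fun h' => hAR w h' hw
      tauto
    rw [h3, h1 w hw]
    have := h.deg w hw
    omega
  · intro j
    have h3 : ((insert z B).filter fun w => ¬ M' w j) =
        (insert z B).filter fun w => ¬ M w j := by
      refine Finset.filter_congr fun w hw => ?_
      rw [hM']
      have : w ≠ x := by rintro rfl; exact hxR hw
      have : w ∉ A := fun h' => hAR w h' hw
      tauto
    have h4 := Finset.card_filter_add_card_filter_not (s := insert z B) (M · j)
    rw [h2 j, count_balanced hsum j, hR] at h4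
    rw [h3, card_cyc]
    omega
  · exact fun j => (hM' x j).2 (Or.inl rfl)
  · intro j hj
    rcases (hM' y j).1 hj with h' | h' | h'
    · exact h.ne h'.symm
    · exact hA.2.1 h'
    · exact hyR h'.1
  · exact fun a ha j => (hM' a j).2 (Or.inr (Or.inl ha))
  · intro c hc j hj
    rcases (hM' c j).1 hj with rfl | h' | h'
    · exact hC.1 hc
    · exact Finset.disjoint_left.1 h.disj_AC h' hc
    · exact hCR c hc h'.1

variable [Fintype V]

theorem sum_univ (h : Config r k x y z A B C) (f : V → ℕ) :
    ∑ v, f v = f x + f y + ∑ v ∈ insert z B, f v + ∑ v ∈ A, f v + ∑ v ∈ C, f v := by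
  have hu : (Finset.univ : Finset V) = insert x (insert y (insert z B ∪ A ∪ C)) := by
    ext v
    have := h.cover v
    simp only [Finset.mem_univ, Finset.mem_insert, Finset.mem_union, true_iff]
    tauto
  have hA := h.notMem_A
  have hB := h.notMem_B
  have hC := h.notMem_C
  have hz := h.z_ne
  rw [hu, Finset.sum_insert, Finset.sum_insert, Finset.sum_union, Finset.sum_union]
  · ring
  · rw [Finset.disjoint_insert_left]
    exact ⟨hA.2.2, h.disj_AB.symm⟩
  · rw [Finset.disjoint_union_left, Finset.disjoint_insert_left]
    exact ⟨⟨hC.2.2, h.disj_BC⟩, h.disj_AC⟩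
  · simp only [Finset.mem_insert, Finset.mem_union, not_or]
    exact ⟨⟨⟨hz.2.symm, hB.2.1⟩, hA.2.1⟩, hC.2.1⟩
  · simp only [Finset.mem_insert, Finset.mem_union, not_or]
    exact ⟨h.ne, ⟨⟨hz.1.symm, hB.1⟩, hA.1⟩, hC.1⟩

theorem card_univ (h : Config r k x y z A B C) : Fintype.card V = 5 * k + 3 := by
  have h1 := h.sum_univ fun _ => 1
  simp only [Finset.sum_const, smul_eq_mul, mul_one, Finset.card_univ,
    Finset.card_insert_of_notMem h.notMem_B.2.2] at h1
  have := h.card_A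
  have := h.card_B
  have := h.card_C
  have := h.one_le
  omega

open Classical in
theorem card_filter_univ (h : Config r k x y z A B C) (P : V → Prop) :
    (Finset.univ.filter P).card = (if P x then 1 else 0) + (if P y then 1 else 0) +
      ((insert z B).filter P).card + (A.filter P).card + (C.filter P).card := by
  simp only [Finset.card_filter]
  exact h.sum_univ _

end Config

/-! ### Regularity of the extended tournament and membership in the family -/

section Exceptional

open Classical in
theorem card_filter_of_forall {V : Type*} {X : Finset V} {P : V → Prop} (h : ∀ v ∈ X, P v) :
    (X.filter P).card = X.card := by
  rw [Finset.filter_true_of_mem h]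

open Classical in
theorem card_filter_of_forall_not {V : Type*} {X : Finset V} {P : V → Prop}
    (h : ∀ v ∈ X, ¬ P v) : (X.filter P).card = 0 := by
  rw [Finset.filter_false_of_mem h, Finset.card_empty]

variable {V : Type*} [DecidableEq V] [Fintype V] {k : ℕ} {x y z : V} {A B C : Finset V}

open Classical in
-- A vertex of {z} ∪ B has exactly 2k out-neighbours among x, y, A and C, and k + 1 others by the
-- choice of `M`. For the remaining vertices the sizes of the sets give the same total.
theorem Config.card_out_add {r : V → V → Prop} (h : Config r k x y z A B C)
    {M : V → Fin k → Prop} (hMR : ∀ w ∈ insert z B,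
      ((insert z B).filter (r w)).card + (Finset.univ.filter (M w)).card = k + 1)
    (hMx : ∀ j, M x j) (hMy : ∀ j, ¬ M y j) (hMA : ∀ a ∈ A, ∀ j, M a j)
    (hMC : ∀ c ∈ C, ∀ j, ¬ M c j) (v : V) :
    (Finset.univ.filter (r v)).card + (Finset.univ.filter (M v)).card = 3 * k + 1 := by
  have hT := h.tour
  have hk := h.one_le
  have cA := h.card_A
  have cB := h.card_B
  have cC := h.card_C
  have hB : ∀ P : V → Prop, ((insert z B).filter P).card =
      (if P z then 1 else 0) + (B.filter P).card := by
    intro P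
    rw [Finset.card_filter, Finset.sum_insert h.notMem_B.2.2, ← Finset.card_filter]
  have key : ∀ w ∈ insert z B, (if r w x then 1 else 0) + (if r w y then 1 else 0) +
      (A.filter (r w)).card + (C.filter (r w)).card = 2 * k := by
    intro w hw
    rcases Finset.mem_insert.1 hw with rfl | hw
    · rw [if_neg (hT.asymm h.x_to_z), if_pos h.z_to_y, card_filter_of_forall h.z_to_A,
        card_filter_of_forall_not fun c hc => hT.asymm (h.C_to_z c hc)]
      omega
    · rw [if_pos (h.B_to_x w hw), if_neg (hT.asymm (h.y_to_B w hw)),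
        card_filter_of_forall (h.B_to_C w hw),
        card_filter_of_forall_not fun a ha => hT.asymm (h.A_to_B a ha w hw)]
      omega
  rw [h.card_filter_univ]
  rcases h.cover v with rfl | rfl | hv | hv | hv | hv
  · rw [if_neg (hT.irrefl v), if_pos h.x_to_y, hB, if_pos h.x_to_z,
      card_filter_of_forall_not fun b hb => hT.asymm (h.B_to_x b hb),
      card_filter_of_forall h.x_to_A,
      card_filter_of_forall_not fun c hc => hT.asymm (h.C_to_x c hc),
      card_filter_of_forall fun j _ => hMx j, Finset.card_univ, Fintype.card_fin]
    omega
  · rw [if_neg (hT.asymm h.x_to_y), if_neg (hT.irrefl v), hB, if_neg (hT.asymm h.z_to_y),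
      card_filter_of_forall h.y_to_B, card_filter_of_forall h.y_to_A,
      card_filter_of_forall_not fun c hc => hT.asymm (h.C_to_y c hc),
      card_filter_of_forall_not fun j _ => hMy j]
    omega
  · subst hv
    have h1 := hMR v (Finset.mem_insert_self _ _)
    have h2 := key v (Finset.mem_insert_self _ _)
    omega
  · have h1 : 2 * (A.filter (r v)).card + 1 = A.card := by convert h.reg_A v hv
    rw [if_neg (hT.asymm (h.x_to_A v hv)), if_neg (hT.asymm (h.y_to_A v hv)), hB,
      if_neg (hT.asymm (h.z_to_A v hv)), card_filter_of_forall (h.A_to_B v hv),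
      card_filter_of_forall_not fun c hc => hT.asymm (h.C_to_A c hc v hv),
      card_filter_of_forall fun j _ => hMA v hv j, Finset.card_univ, Fintype.card_fin]
    omega
  · have h1 := hMR v (Finset.mem_insert_of_mem hv)
    have h2 := key v (Finset.mem_insert_of_mem hv)
    omega
  · have h1 : 2 * (C.filter (r v)).card + 1 = C.card := by convert h.reg_C v hv
    rw [if_pos (h.C_to_x v hv), if_pos (h.C_to_y v hv), hB, if_pos (h.C_to_z v hv),
      card_filter_of_forall_not fun b hb => hT.asymm (h.B_to_C b hb v hv),
      card_filter_of_forall (h.C_to_A v hv),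
      card_filter_of_forall_not fun j _ => hMC v hv j]
    omega

theorem Config.comesFromExceptional {T : Digraph V} (h : Config T.Adj k x y z A B C) :
    T.ComesFromExceptional := by
  classical
  obtain ⟨M, hMR, hMS, hMx, hMy, hMA, hMC⟩ := h.exists_relation
  have hk := h.one_le
  have hcV := h.card_univ
  have cA := h.card_A
  have cB := h.card_B
  have cC := h.card_C
  have cR := Finset.card_insert_of_notMem h.notMem_B.2.2
  have hcard : Fintype.card (V ⊕ Fin k) = Fintype.card (Fin (6 * k + 3)) := by
    rw [Fintype.card_sum, hcV, Fintype.card_fin, Fintype.card_fin]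
    ring
  let e : V ⊕ Fin k ≃ Fin (6 * k + 3) := Fintype.equivOfCardEq hcard
  let G : Digraph (Fin (6 * k + 3)) := ⟨fun s t => extRel T.Adj M (e.symm s) (e.symm t)⟩
  have hT := h.tour
  have hG : IsTour G.Adj := by
    have h1 := isTour_extRel hT M
    exact ⟨fun s => h1.irrefl _, fun h => h1.asymm h,
      fun h => h1.total fun h' => h (e.symm.injective h')⟩
  let ι : V ↪ Fin (6 * k + 3) := Function.Embedding.inl.trans e.toEmbedding
  let σ : Fin k ↪ Fin (6 * k + 3) := Function.Embedding.inr.trans e.toEmbedding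
  have a1 : ∀ u v, G.Adj (ι u) (ι v) ↔ T.Adj u v := fun u v => by simp [G, ι, extRel]
  have a2 : ∀ u j, G.Adj (ι u) (σ j) ↔ M u j := fun u v => by simp [G, ι, σ, extRel]
  have a3 : ∀ u j, G.Adj (σ j) (ι u) ↔ ¬ M u j := fun u v => by simp [G, ι, σ, extRel]
  have hcases : ∀ s, (∃ v, ι v = s) ∨ ∃ j, σ j = s := by
    intro s
    obtain ⟨t, rfl⟩ := e.surjective s
    rcases t with v | j
    · exact Or.inl ⟨v, rfl⟩
    · exact Or.inr ⟨j, rfl⟩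
  have hισ : ∀ v j, ι v ≠ σ j := fun v j => by simp [ι, σ]
  have hreg : ∀ (X : Finset V) (Y : Finset (Fin k)),
      (∀ v ∈ X, 2 * ((X.filter (T.Adj v)).card + (Y.filter (M v)).card) + 1 =
        X.card + Y.card) →
      (∀ i ∈ Y, 2 * ((X.filter fun v => ¬ M v i).card + (Y.filter (cyc i)).card) + 1 =
        X.card + Y.card) → RegOn G.Adj (X.map ι ∪ Y.map σ) := by
    intro X Y hX hY
    refine regOn_extRel T.Adj M e X Y (fun v hv => ?_) (fun j hj => ?_)
    · convert hX v hv
    · convert hY j hj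
  have regA : RegOn G.Adj (A.map ι) := by
    have := hreg A ∅ (by
      intro v hv
      have : 2 * (A.filter (T.Adj v)).card + 1 = A.card := by convert h.reg_A v hv
      simpa using this) (by simp)
    simpa using this
  have regC : RegOn G.Adj (C.map ι) := by
    have := hreg C ∅ (by
      intro v hv
      have : 2 * (C.filter (T.Adj v)).card + 1 = C.card := by convert h.reg_C v hv
      simpa using this) (by simp)
    simpa using this
  have regR : RegOn G.Adj ({ι z} ∪ B.map ι ∪ Finset.univ.map σ) := by
    have := hreg (insert z B) Finset.univ (by
      intro w hw
      have h1 := hMR w hw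
      rw [Finset.card_univ, Fintype.card_fin]
      have h2 : ((insert z B).filter (T.Adj w)).card + (Finset.univ.filter (M w)).card =
        k + 1 := by convert h1
      omega) (by
      intro j _
      have h1 := hMS j
      rw [Finset.card_univ, Fintype.card_fin]
      have h2 : ((insert z B).filter fun w => ¬ M w j).card +
        (Finset.univ.filter (cyc j)).card = k + 1 := by convert h1
      omega)
    rwa [Finset.map_insert, Finset.insert_eq] at this
  have regU : ∀ s, 2 * (outSet G.Adj s).card + 1 = Fintype.card (Fin (6 * k + 3)) := by
    have huniv : (Finset.univ : Finset V).map ι ∪ Finset.univ.map σ = Finset.univ := by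
      ext s
      simp only [Finset.mem_union, Finset.mem_map, Finset.mem_univ, true_and, iff_true]
      exact hcases s
    have := hreg Finset.univ Finset.univ (by
      intro v _
      have h1 := h.card_out_add (M := M) (fun w hw => by convert hMR w hw) hMx hMy hMA hMC v
      rw [Finset.card_univ, Finset.card_univ, Fintype.card_fin, hcV]
      have h2 : (Finset.univ.filter (T.Adj v)).card + (Finset.univ.filter (M v)).card =
        3 * k + 1 := by convert h1
      omega) (by
      -- A new vertex dominates y and C, which makes 2k, and k + 1 vertices in {z} ∪ B and among the
      -- new ones.
      intro j _
      have h1 := hMS j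
      have h2 : ((insert z B).filter fun w => ¬ M w j).card +
        (Finset.univ.filter (cyc j)).card = k + 1 := by convert h1
      have h3 := h.card_filter_univ fun v => ¬ M v j
      rw [if_neg (not_not.2 (hMx j)), if_pos (hMy j),
        card_filter_of_forall_not (fun a ha => not_not.2 (hMA a ha j)),
        card_filter_of_forall (fun c hc => hMC c hc j)] at h3
      have h4 : (Finset.univ.filter fun v => ¬ M v j).card = 0 + 1 +
        ((insert z B).filter fun w => ¬ M w j).card + 0 + C.card := by convert h3
      rw [Finset.card_univ, Finset.card_univ, Fintype.card_fin, hcV]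
      omega)
    rw [huniv] at this
    intro s
    have h1 := this s (Finset.mem_univ s)
    rw [Finset.card_univ] at h1
    rw [← h1]
    rfl
  refine ⟨k, G, ι x, ι y, ι z, A.map ι, B.map ι, C.map ι, Finset.univ.map σ, ?_, ?_⟩
  · constructor
    · exact isRegularTournament_of hG regU
    · exact hk
    · simp
    · ext s
      simp only [Finset.mem_univ, iff_true, Finset.mem_union, Finset.mem_insert,
        Finset.mem_singleton, Finset.mem_map, true_and]
      rcases hcases s with ⟨v, rfl⟩ | hj
      · rcases h.cover v with rfl | rfl | rfl | hv | hv | hv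
        · tauto
        · tauto
        · tauto
        · exact Or.inl (Or.inl (Or.inl (Or.inr ⟨v, hv, rfl⟩)))
        · exact Or.inl (Or.inl (Or.inr ⟨v, hv, rfl⟩))
        · exact Or.inl (Or.inr ⟨v, hv, rfl⟩)
      · exact Or.inr hj
    · rw [Finset.card_map, cA]
    · rw [Finset.card_map, cC]
    · rw [Finset.card_map, cB]
    · rw [Finset.card_map, Finset.card_univ, Fintype.card_fin]
    · exact isRegularTournament_induce hG regA
    · exact isRegularTournament_induce hG regC
    · exact isRegularTournament_induce hG regR
    all_goals
      intro s hs t ht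
      simp only [Finset.mem_union, Finset.mem_insert, Finset.mem_singleton, Finset.mem_map,
        Finset.mem_univ, true_and] at hs ht
    · obtain ⟨a, ha, rfl⟩ := hs
      rcases ht with ⟨b, hb, rfl⟩ | ⟨j, rfl⟩
      · exact (a1 _ _).2 (h.A_to_B a ha b hb)
      · exact (a2 _ _).2 (hMA a ha j)
    · obtain ⟨c, hc, rfl⟩ := ht
      rcases hs with ⟨b, hb, rfl⟩ | ⟨j, rfl⟩
      · exact (a1 _ _).2 (h.B_to_C b hb c hc)
      · exact (a3 _ _).2 (hMC c hc j)
    · obtain ⟨c, hc, rfl⟩ := hs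
      obtain ⟨a, ha, rfl⟩ := ht
      exact (a1 _ _).2 (h.C_to_A c hc a ha)
    · obtain ⟨c, hc, rfl⟩ := hs
      rw [ht]
      exact (a1 _ _).2 (h.C_to_z c hc)
    · obtain ⟨a, ha, rfl⟩ := ht
      rw [hs]
      exact (a1 _ _).2 (h.z_to_A a ha)
    · rw [hs]
      rcases ht with ((rfl | rfl) | ⟨a, ha, rfl⟩) | ⟨j, rfl⟩
      · exact (a1 _ _).2 h.x_to_y
      · exact (a1 _ _).2 h.x_to_z
      · exact (a1 _ _).2 (h.x_to_A a ha)
      · exact (a2 _ _).2 (hMx j)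
    · rw [ht]
      rcases hs with ((rfl | rfl) | ⟨c, hc, rfl⟩) | ⟨j, rfl⟩
      · exact (a1 _ _).2 h.x_to_y
      · exact (a1 _ _).2 h.z_to_y
      · exact (a1 _ _).2 (h.C_to_y c hc)
      · exact (a3 _ _).2 (hMy j)
    · rw [hs]
      rcases ht with ⟨a, ha, rfl⟩ | ⟨b, hb, rfl⟩
      · exact (a1 _ _).2 (h.y_to_A a ha)
      · exact (a1 _ _).2 (h.y_to_B b hb)
    · rw [ht]
      rcases hs with ⟨b, hb, rfl⟩ | ⟨c, hc, rfl⟩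
      · exact (a1 _ _).2 (h.B_to_x b hb)
      · exact (a1 _ _).2 (h.C_to_x c hc)
  · have hmem : ∀ v, ι v ∈ (Finset.univ.map σ)ᶜ := by
      intro v
      rw [Finset.mem_compl, Finset.mem_map]
      rintro ⟨j, -, hj⟩
      exact hισ v j hj.symm
    refine ⟨⟨Equiv.ofBijective (fun v => ⟨ι v, hmem v⟩) ⟨fun u v huv => ?_, fun s => ?_⟩, ?_⟩⟩
    · exact ι.injective (Subtype.ext_iff.1 huv)
    · obtain ⟨s, hs⟩ := s
      rcases hcases s with ⟨v, rfl⟩ | ⟨j, rfl⟩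
      · exact ⟨v, rfl⟩
      · rw [Finset.mem_compl] at hs
        exact absurd (Finset.mem_map_of_mem σ (Finset.mem_univ j)) hs
    · intro u v
      exact a1 u v

end Exceptional

/-! ### Vertex lists, semidegree bounds and the conclusion -/

section Semidegrees

theorem hasPath_of_hasConn {V : Type*} [DecidableEq V] {T : Digraph V} {x y : V} {n : ℕ}
    (hxy : x ≠ y)
    (h : HasConn T.Adj x y n) : T.HasPath x y (n + 1) := by
  obtain ⟨S, h, rfl, hx, hy⟩ := h
  have key : ∃ l : List V, l.Nodup ∧ l.IsChain T.Adj ∧ l.head? = some x ∧ l.getLast? = some y ∧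
      l.length = S.card + 2 ∧ ∀ v ∈ l, v = x ∨ v = y ∨ v ∈ S := by
    induction h with
    | @arc a b h => exact ⟨[a, b], by simp [hxy], by simp [h], by simp, by simp, by simp, by simp⟩
    | @cons a c b S hac hc h ih =>
      simp only [Finset.mem_insert, not_or] at hx hy
      obtain ⟨l, h1, h2, h3, h4, h5, h6⟩ := ih (fun h => hy.1 h.symm) hc hy.2
      obtain ⟨l', rfl⟩ : ∃ l', l = c :: l' := by
        cases l with
        | nil => simp at h3
        | cons d l' => exact ⟨l', by simpa using h3⟩
      refine ⟨a :: c :: l', ?_, ?_, by simp, ?_, ?_, ?_⟩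
      · rw [List.nodup_cons]
        refine ⟨fun h => ?_, h1⟩
        rcases h6 a h with h | h | h
        · exact hx.1 h
        · exact hxy h
        · exact hx.2 h
      · rw [List.isChain_cons_cons]
        exact ⟨hac, h2⟩
      · rw [List.getLast?_cons_cons]
        exact h4
      · rw [List.length_cons, h5, Finset.card_insert_of_notMem hc]
      · intro v hv
        rcases List.mem_cons.1 hv with rfl | hv
        · exact Or.inl rfl
        · rw [Finset.mem_insert]
          rcases h6 v hv with h | h | h <;> tauto
  obtain ⟨l, h1, h2, h3, h4, h5, -⟩ := key
  exact ⟨l, h1, h2, h3, h4, h5⟩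

variable {V : Type*} [Fintype V] {T : Digraph V}

theorem outdegree_add_indegree (hT : T.IsTournament) (v : V) :
    T.outdegree v + T.indegree v + 1 = Fintype.card V := by
  rw [outdegree_eq, indegree_eq]
  exact card_outSet_add (isTour_iff.2 hT) v

theorem dense_of_le (hT : T.IsTournament) {δ : ℕ} (h4 : 4 ≤ δ) (hord : Fintype.card V + 1 ≤ 3 * δ)
    (ho : ∀ v, δ ≤ T.outdegree v) (hi : ∀ v, δ ≤ T.indegree v) : Dense T.Adj δ :=
  ⟨isTour_iff.2 hT, h4, hord, fun v => by rw [← outdegree_eq]; exact ho v,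
    fun v => by rw [← indegree_eq]; exact hi v⟩

theorem stronglyPanconnectedFrom_four {δ : ℕ} (h : Dense T.Adj δ) :
    T.StronglyPanconnectedFrom 4 := by
  classical
  have key : ∀ x y, x ≠ y → ∀ k, 4 ≤ k → k ≤ Fintype.card V - 1 → T.HasPath x y k := by
    intro x y hxy k hk hkV
    obtain ⟨n, rfl⟩ : ∃ n, k = n + 1 := ⟨k - 1, by omega⟩
    exact hasPath_of_hasConn hxy (h.hasConn hxy (by omega) (by omega))
  exact fun x y hxy k hk hkV => ⟨key x y hxy k hk hkV, key y x hxy.symm k hk hkV⟩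

theorem stronglyPanconnected_or {δ : ℕ} (h : Dense T.Adj δ)
    (hord : 2 * Fintype.card V ≤ 5 * δ + 1) :
    T.StronglyPanconnected ∨ T.ComesFromExceptional := by
  classical
  by_cases h3 : ∃ x y, x ≠ y ∧ ¬ HasConn T.Adj x y 2
  · right
    obtain ⟨x, y, hxy, hno⟩ := h3
    obtain ⟨k, z, A, B, C, hc⟩ := exists_config h.tour h.out_ge h.in_ge h.four_le hord hxy hno
    exact hc.comesFromExceptional
  · left
    push Not at h3
    intro x y hxy k hk hkV
    rcases hk.eq_or_lt with rfl | hk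
    · exact ⟨hasPath_of_hasConn hxy (h3 x y hxy), hasPath_of_hasConn hxy.symm (h3 y x hxy.symm)⟩
    · exact stronglyPanconnectedFrom_four h x y hxy k hk hkV

theorem irregularity_le_iff {n : ℕ} : T.irregularity ≤ n ↔
    ∀ v, ((T.outdegree v : ℤ) - (T.indegree v : ℤ)).natAbs ≤ n := by
  simp [Digraph.irregularity]

/-- Immediate from d⁺ + d⁻ = p - 1. The empty tournament must be excluded, as the right side is
vacuous for it and the left side false. -/
theorem semidegrees_third_iff (hT : T.IsTournament) (hV : 0 < Fintype.card V) :
    3 * T.irregularity + 5 ≤ Fintype.card V ↔ ∀ v,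
      (Fintype.card V + 1 ≤ 3 * T.outdegree v ∧ 3 * T.outdegree v + 4 ≤ 2 * Fintype.card V) ∧
      (Fintype.card V + 1 ≤ 3 * T.indegree v ∧ 3 * T.indegree v + 4 ≤ 2 * Fintype.card V) := by
  constructor
  · intro h v
    have h1 := outdegree_add_indegree hT v
    have h2 := irregularity_le_iff.1 (le_refl T.irregularity) v
    omega
  · intro h
    have h5 : 5 ≤ Fintype.card V := by
      obtain ⟨v⟩ := Fintype.card_pos_iff.1 hV
      have := h v
      omega
    have : T.irregularity ≤ (Fintype.card V - 5) / 3 := irregularity_le_iff.2 fun v => by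
      have h1 := outdegree_add_indegree hT v
      have h2 := h v
      omega
    omega

theorem semidegrees_fifth_iff (hT : T.IsTournament) (hV : 0 < Fintype.card V) :
    5 * T.irregularity + 3 ≤ Fintype.card V ↔ ∀ v,
      (2 * Fintype.card V ≤ 5 * T.outdegree v + 1 ∧
        5 * T.outdegree v + 4 ≤ 3 * Fintype.card V) ∧
      (2 * Fintype.card V ≤ 5 * T.indegree v + 1 ∧
        5 * T.indegree v + 4 ≤ 3 * Fintype.card V) := by
  constructor
  · intro h v
    have h1 := outdegree_add_indegree hT v
    have h2 := irregularity_le_iff.1 (le_refl T.irregularity) v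
    omega
  · intro h
    have h5 : 3 ≤ Fintype.card V := by
      obtain ⟨v⟩ := Fintype.card_pos_iff.1 hV
      have := h v
      omega
    have : T.irregularity ≤ (Fintype.card V - 3) / 5 := irregularity_le_iff.2 fun v => by
      have h1 := outdegree_add_indegree hT v
      have h2 := h v
      omega
    omega

end Semidegrees

end TournamentPaths

theorem theorem1p5 {V : Type*} [Fintype V] (T : Digraph V) (m p : ℕ)
    (hT : T.IsIrregularTournament m) (hp : Fintype.card V = p) (hpm : 11 ≤ p + m) :
    ((m : ℝ) ≤ 1 / 3 * ((p : ℝ) - 5) → T.StronglyPanconnectedFrom 4) ∧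
    ((m : ℝ) ≤ 1 / 5 * ((p : ℝ) - 3) → T.StronglyPanconnected ∨ T.ComesFromExceptional) ∧
    (T.SemidegreesBetween (1 / 3 * ((p : ℝ) + 1)) (2 / 3 * ((p : ℝ) - 2)) →
      T.StronglyPanconnectedFrom 4) ∧
    (T.SemidegreesBetween (1 / 5 * (2 * (p : ℝ) - 1)) (1 / 5 * (3 * (p : ℝ) - 4)) →
      T.StronglyPanconnected ∨ T.ComesFromExceptional) ∧
    ((m : ℝ) ≤ 1 / 3 * ((p : ℝ) - 5) ↔
      T.SemidegreesBetween (1 / 3 * ((p : ℝ) + 1)) (2 / 3 * ((p : ℝ) - 2))) ∧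
    ((m : ℝ) ≤ 1 / 5 * ((p : ℝ) - 3) ↔
      T.SemidegreesBetween (1 / 5 * (2 * (p : ℝ) - 1)) (1 / 5 * (3 * (p : ℝ) - 4))) := by
  obtain ⟨hT, rfl⟩ := hT
  subst hp
  set p := Fintype.card V with hp
  set m := T.irregularity with hm
  have hV : 0 < p := by
    rw [Nat.pos_iff_ne_zero]
    intro h0
    have : m ≤ 0 := TournamentPaths.irregularity_le_iff.2 fun v =>
      ((Fintype.card_eq_zero_iff.1 h0).false v).elim
    omega
  have ha : (m : ℝ) ≤ 1 / 3 * ((p : ℝ) - 5) ↔ 3 * m + 5 ≤ p := by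
    rw [← @Nat.cast_le ℝ]
    push_cast
    constructor <;> intro h <;> linarith
  have hb : (m : ℝ) ≤ 1 / 5 * ((p : ℝ) - 3) ↔ 5 * m + 3 ≤ p := by
    rw [← @Nat.cast_le ℝ]
    push_cast
    constructor <;> intro h <;> linarith
  have hda : 3 * m + 5 ≤ p ↔
      T.SemidegreesBetween (1 / 3 * ((p : ℝ) + 1)) (2 / 3 * ((p : ℝ) - 2)) := by
    rw [TournamentPaths.semidegrees_third_iff hT hV, Digraph.SemidegreesBetween]
    refine forall_congr' fun v => ?_
    simp only [← hp, ← @Nat.cast_le ℝ]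
    push_cast
    constructor <;> rintro ⟨⟨h1, h2⟩, h3, h4⟩ <;> refine ⟨⟨?_, ?_⟩, ?_, ?_⟩ <;> linarith
  have hdb : 5 * m + 3 ≤ p ↔
      T.SemidegreesBetween (1 / 5 * (2 * (p : ℝ) - 1)) (1 / 5 * (3 * (p : ℝ) - 4)) := by
    rw [TournamentPaths.semidegrees_fifth_iff hT hV, Digraph.SemidegreesBetween]
    refine forall_congr' fun v => ?_
    simp only [← hp, ← @Nat.cast_le ℝ]
    push_cast
    constructor <;> rintro ⟨⟨h1, h2⟩, h3, h4⟩ <;> refine ⟨⟨?_, ?_⟩, ?_, ?_⟩ <;> linarith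
  have main_a : 3 * m + 5 ≤ p → T.StronglyPanconnectedFrom 4 := by
    intro h
    have h1 := (TournamentPaths.semidegrees_third_iff hT hV).1 h
    -- δ is (p + 1)/3 rounded up. From p + m ≥ 11 and 3m + 5 ≤ p one gets p ≥ 10, hence δ ≥ 4.
    exact TournamentPaths.stronglyPanconnectedFrom_four (δ := (p + 3) / 3)
      (TournamentPaths.dense_of_le hT (by omega) (by omega)
        (fun v => by have := h1 v; omega) (fun v => by have := h1 v; omega))
  have main_b : 5 * m + 3 ≤ p → T.StronglyPanconnected ∨ T.ComesFromExceptional := by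
    intro h
    have h1 := (TournamentPaths.semidegrees_fifth_iff hT hV).1 h
    -- δ is (2p - 1)/5 rounded up. Again p ≥ 10, which gives both δ ≥ 4 and p + 1 ≤ 3δ.
    exact TournamentPaths.stronglyPanconnected_or (δ := (2 * p + 3) / 5)
      (TournamentPaths.dense_of_le hT (by omega) (by omega)
        (fun v => by have := h1 v; omega) (fun v => by have := h1 v; omega)) (by omega)
  exact ⟨fun h => main_a (ha.1 h), fun h => main_b (hb.1 h), fun h => main_a (hda.2 h),
    fun h => main_b (hdb.2 h), ha.trans hda, hb.trans hdb⟩
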